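/- Let $k\ge 1$ and let $K$ be a finite CW complex of dimension $k$. For a finite CW complex $L$ write $\beta_j(L)=\operatorname{rank} H_j(L;\mathbb Z)$ (singular homology), and define the polynomial $$T^k_L(X,Y)=\sum_{S} X^{\beta_{k-1}(S)-\beta_{k-1}(L)}\,Y^{\beta_k(S)}\in\mathbb Z[X,Y],$$ the sum being over all subcomplexes $S$ of $L$ with $L_{(k-1)}\subseteq S\subseteq L_{(k)}$, where $L_{(j)}$ denotes the $j$-skeleton (the $k$-th Tutte–Krushkal–Renardy polynomial). Let $\sigma$ be a (open) $k$-cell of $K$, with closure $\bar\sigma$ and boundary $\partial\sigma=\bar\sigma\setminus\sigma$; assume, as usual, that $\bar\sigma$ (and hence $\partial\sigma$) is a subcomplex of $K$. Let $K\setminus\sigma$ be the subcomplex obtained by removing the open cell $\sigma$, and $K/\bar\sigma$ the quotient CW complex obtained by collapsing $\bar\sigma$ to a point. Call $\sigma$ a *loop* if $H_k(\bar\sigma;\mathbb Z)\cong\mathbb Z$; a *bridge* if $\beta_{k-1}(K\setminus\sigma)=\beta_{k-1}(K)+1$; *boundary regular* if $\tilde H_{k-1}(\partial\sigma;\mathbb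 Z)\cong\mathbb Z$ (reduced homology). Then: (i) If $\sigma$ is neither a bridge nor a loop and is boundary regular, then $T^k_K(X,Y)=T^k_{K/\bar\sigma}(X,Y)+T^k_{K\setminus\sigma}(X,Y)$. (ii) If $\sigma$ is a loop, then $T^k_K(X,Y)=(Y+1)\,T^k_{K\setminus\sigma}(X,Y)$. (iii) If $\sigma$ is a bridge and boundary regular, then $T^k_K(X,Y)=(X+1)\,T^k_{K/\bar\sigma}(X,Y)$. -/

import Mathlib

open Topology Metric Set
open Topology.RelCWComplex (cell map openCell closedCell cellFrontier Subcomplex skeletonLT skeleton)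

noncomputable section

universe u

/-! ### Singular homology of subspaces, Betti numbers -/

/-- The `n`-th singular homology group with integer coefficients of the subspace `A` of `X`. -/
def singH {X : Type u} [TopologicalSpace X] (n : ℕ) (A : Set X) : ModuleCat.{u} ℤ :=
  ((AlgebraicTopology.singularHomologyFunctor (ModuleCat.{u} ℤ) n).obj
    (ModuleCat.of ℤ (ULift.{u} ℤ))).obj (TopCat.of A)

/-- The map induced in singular homology by the map from `A` to a one-point space. -/
def singHToPoint {X : Type u} [TopologicalSpace X] (n : ℕ) (A : Set X) :
    singH n A ⟶ ((AlgebraicTopology.singularHomologyFunctor (ModuleCat.{u} ℤ) n).obj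
      (ModuleCat.of ℤ (ULift.{u} ℤ))).obj (TopCat.of PUnit.{u + 1}) :=
  ((AlgebraicTopology.singularHomologyFunctor (ModuleCat.{u} ℤ) n).obj
    (ModuleCat.of ℤ (ULift.{u} ℤ))).map
      (TopCat.ofHom (ContinuousMap.const A PUnit.unit))

/-- The `n`-th reduced singular homology group of the subspace `A`: the kernel of the map
to the homology of a point. -/
def redSingH {X : Type u} [TopologicalSpace X] (n : ℕ) (A : Set X) :
    Submodule ℤ (singH n A) :=
  LinearMap.ker (singHToPoint n A).hom

/-- The `n`-th Betti number of the subspace `A`: the rank of `H_n(A; ℤ)`. -/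
def betti {X : Type u} [TopologicalSpace X] (n : ℕ) (A : Set X) : ℕ :=
  Module.finrank ℤ (singH n A)

/-! ### Spanning subcomplexes and the Tutte-Krushkal-Renardy polynomial -/

theorem finite_subcomplex {X : Type u} [TopologicalSpace X] (C : Set X)
    [CWComplex C] [CWComplex.Finite C] : Finite (Subcomplex C) := by
  have : Finite (Σ n, cell C n) := CWComplex.finite_cells_of_finite
  refine Finite.of_injective
    (fun E : Subcomplex C => {x : Σ n, cell C n | x.2 ∈ E.I x.1}) ?_
  intro E F h
  have hI : E.I = F.I := by
    funext n
    ext i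
    exact Set.ext_iff.1 h ⟨n, i⟩
  apply SetLike.coe_injective
  rw [← CWComplex.Subcomplex.union (E := E), ← CWComplex.Subcomplex.union (E := F), hI]

/-- The spanning subcomplexes `S` of dimension `j` of a finite CW complex `C`:
the `(j-1)`-skeleton of `C` is contained in `S`, and `S` in the `j`-skeleton.
(`skeletonLT C j` consists of the cells of dimension `< j`.) -/
def spanningSubcomplexes {X : Type u} [TopologicalSpace X] [T2Space X] (C : Set X)
    [CWComplex C] [CWComplex.Finite C] (j : ℕ) : Finset (Subcomplex C) :=
  haveI := finite_subcomplex C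
  (Set.toFinite {S : Subcomplex C |
    (skeletonLT C j : Set X) ⊆ S ∧ (S : Set X) ⊆ skeleton C j}).toFinset

/-- The dimension `j` Tutte-Krushkal-Renardy polynomial (for `1 ≤ j`) of a finite CW complex,
in the variables `X = MvPolynomial.X 0` and `Y = MvPolynomial.X 1`.
The subtraction in the first exponent never truncates: a spanning subcomplex `S` contains the
`(j-1)`-skeleton, so that `H_{j-1}(S) → H_{j-1}(C)` is onto. -/
def tkrPoly {X : Type u} [TopologicalSpace X] [T2Space X] (C : Set X)
    [CWComplex C] [CWComplex.Finite C] (j : ℕ) : MvPolynomial (Fin 2) ℤ :=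
  ∑ S ∈ spanningSubcomplexes C j,
    MvPolynomial.X 0 ^ (betti (j - 1) (S : Set X) - betti (j - 1) C) *
      MvPolynomial.X 1 ^ betti j (S : Set X)

/-! ### Loops, bridges and boundary regular cells -/

section Cells

variable {X : Type u} [TopologicalSpace X] {C : Set X} [CWComplex C] {k : ℕ}

/-- A `k`-cell `σ` is a loop if the `k`-th homology of its closure is infinite cyclic. -/
def IsLoopCell (σ : cell C k) : Prop :=
  Nonempty (singH k (closedCell k σ) ≃ₗ[ℤ] ℤ)

/-- A `k`-cell `σ` is a bridge if removing the open cell raises the Betti number in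
degree `k - 1` by one. -/
def IsBridgeCell (σ : cell C k) : Prop :=
  betti (k - 1) (C \ openCell k σ) = betti (k - 1) C + 1

/-- A `k`-cell `σ` is boundary regular if the reduced homology of its boundary in
degree `k - 1` is infinite cyclic. -/
def IsBoundaryRegular (σ : cell C k) : Prop :=
  Nonempty (redSingH (k - 1) (cellFrontier k σ) ≃ₗ[ℤ] ℤ)

end Cells

/-! ### Deletion of a top-dimensional cell -/

/-- The subcomplex `K ∖ σ` obtained by removing an open cell `σ` of top dimension `k`. -/
def deleteCell {X : Type u} [TopologicalSpace X] [T2Space X] (C : Set X) [CWComplex C] {k : ℕ}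
    (hdim : ∀ n, k < n → IsEmpty (cell C n)) (σ : cell C k) : Subcomplex C :=
  CWComplex.Subcomplex.mk' C (C \ openCell k σ)
    (fun n => {τ | (⟨n, τ⟩ : Σ m, cell C m) ≠ ⟨k, σ⟩})
    (by
      rintro n ⟨τ, hτ⟩ x hx
      refine ⟨CWComplex.closedCell_subset_complex n τ hx, fun hxσ => ?_⟩
      rw [← CWComplex.cellFrontier_union_openCell_eq_closedCell] at hx
      rcases hx with hx | hx
      · have hnk : n ≤ k := by
          by_contra h
          exact (hdim n (not_le.1 h)).false τ
        exact (CWComplex.disjoint_skeletonLT_openCell (C := C) (n := (n : ℕ∞)) (j := σ)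
          (by exact_mod_cast hnk)).notMem_of_mem_left
          (CWComplex.cellFrontier_subset_skeletonLT n τ hx) hxσ
      · exact (CWComplex.disjoint_openCell_of_ne hτ).notMem_of_mem_left hx hxσ)
    (by
      ext x
      simp only [mem_iUnion, mem_sdiff]
      constructor
      · rintro ⟨n, ⟨τ, hτ⟩, hx⟩
        exact ⟨CWComplex.openCell_subset_complex n τ hx,
          (CWComplex.disjoint_openCell_of_ne hτ).notMem_of_mem_left hx⟩
      · rintro ⟨hx, hxσ⟩
        rw [← CWComplex.iUnion_openCell_eq_complex (C := C)] at hx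
        simp only [mem_iUnion] at hx
        obtain ⟨n, τ, hx⟩ := hx
        refine ⟨n, ⟨τ, fun h => hxσ ?_⟩, hx⟩
        cases h
        exact hx)

/-! ### Contraction of a subcomplex -/

section Contraction

variable {X : Type u} [TopologicalSpace X] {C : Set X} [CWComplex C]

/-- The equivalence relation on the space `C` that identifies all the points of `E`. -/
def collapseSetoid (E : Subcomplex C) : Setoid C where
  r x y := x = y ∨ ((x : X) ∈ (E : Set X) ∧ (y : X) ∈ (E : Set X))
  iseqv :=
    { refl := fun _ => Or.inl rfl
      symm := by
        rintro x y (h | h)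
        · exact Or.inl h.symm
        · exact Or.inr h.symm
      trans := by
        rintro x y z (rfl | h) (rfl | h')
        · exact Or.inl rfl
        · exact Or.inr h'
        · exact Or.inr h
        · exact Or.inr ⟨h.1, h'.2⟩ }

/-- The quotient space `C / E`, with the quotient topology. -/
def Collapse (E : Subcomplex C) : Type u := Quotient (collapseSetoid E)

instance (E : Subcomplex C) : TopologicalSpace (Collapse E) :=
  inferInstanceAs (TopologicalSpace (Quotient (collapseSetoid E)))

/-- The quotient map `C → C / E`. -/
def Collapse.mk (E : Subcomplex C) (x : C) : Collapse E := Quotient.mk (collapseSetoid E) x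

theorem Collapse.isQuotientMap_mk (E : Subcomplex C) : IsQuotientMap (Collapse.mk E) :=
  isQuotientMap_quot_mk

theorem Collapse.mk_eq_iff (E : Subcomplex C) {x y : C} : Collapse.mk E x = Collapse.mk E y ↔
    x = y ∨ ((x : X) ∈ (E : Set X) ∧ (y : X) ∈ (E : Set X)) :=
  Quotient.eq (r := collapseSetoid E)

/-- The image in `C / E` of a subset of `C` that is disjoint from `E` or contains `E` is open as
soon as the subset is open. -/
theorem Collapse.isOpen_image (E : Subcomplex C) {U : Set C} (hU : IsOpen U)
    (h : (∀ x ∈ U, (x : X) ∉ (E : Set X)) ∨ (∀ x : C, (x : X) ∈ (E : Set X) → x ∈ U)) :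
    IsOpen (Collapse.mk E '' U) := by
  rw [← (Collapse.isQuotientMap_mk E).isOpen_preimage]
  convert hU using 1
  ext x
  constructor
  · rintro ⟨y, hy, hyx⟩
    rcases (Collapse.mk_eq_iff E).1 hyx with rfl | ⟨h1, h2⟩
    · exact hy
    · rcases h with h | h
      · exact absurd h1 (h y hy)
      · exact h x h2
  · intro hx
    exact ⟨x, hx, rfl⟩

theorem isCompact_subcomplex [T2Space X] [CWComplex.Finite C] (E : Subcomplex C) :
    IsCompact (E : Set X) := by
  have : Finite (Σ n, cell C n) := CWComplex.finite_cells_of_finite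
  have hC : IsCompact C := by
    have : C = ⋃ p : (Σ n, cell C n), closedCell p.1 p.2 := by
      conv_lhs => rw [← CWComplex.union (C := C)]
      rw [iUnion_sigma]
    rw [this]
    exact isCompact_iUnion fun p => CWComplex.isCompact_closedCell
  exact hC.of_isClosed_subset E.closed' (CWComplex.Subcomplex.subset_complex E)

theorem Collapse.exists_separation [T2Space X] [CWComplex.Finite C] (E : Subcomplex C) {x y : C}
    (hy : (y : X) ∉ (E : Set X)) (hne : Collapse.mk E x ≠ Collapse.mk E y) :
    ∃ U V : Set (Collapse E), IsOpen U ∧ IsOpen V ∧ Collapse.mk E x ∈ U ∧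
      Collapse.mk E y ∈ V ∧ Disjoint U V := by
  have hcl : IsClosed (Subtype.val ⁻¹' (E : Set X) : Set C) :=
    E.closed'.preimage continuous_subtype_val
  have hdisj : ∀ U V : Set C, Disjoint U V → (∀ z ∈ V, (z : X) ∉ (E : Set X)) →
      Disjoint (Collapse.mk E '' U) (Collapse.mk E '' V) := by
    intro U V hUV hV
    rw [Set.disjoint_left]
    rintro _ ⟨a, ha, rfl⟩ ⟨b, hb, hba⟩
    rcases (Collapse.mk_eq_iff E).1 hba with rfl | ⟨h1, _⟩
    · exact Set.disjoint_left.1 hUV ha hb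
    · exact hV b hb h1
  by_cases hx : (x : X) ∈ (E : Set X)
  · obtain ⟨U, V, hU, hV, hEU, hyV, hUV⟩ :=
      SeparatedNhds.of_isCompact_isCompact (isCompact_subcomplex E)
        (isCompact_singleton (x := (y : X))) (by simpa using hy)
    refine ⟨Collapse.mk E '' (Subtype.val ⁻¹' U), Collapse.mk E '' (Subtype.val ⁻¹' V),
      Collapse.isOpen_image E (hU.preimage continuous_subtype_val)
        (Or.inr fun z hz => hEU hz),
      Collapse.isOpen_image E (hV.preimage continuous_subtype_val)
        (Or.inl fun z hz hzE => Set.disjoint_left.1 hUV (hEU hzE) hz),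
      ⟨x, hEU hx, rfl⟩, ⟨y, hyV rfl, rfl⟩, hdisj _ _ (hUV.preimage _) ?_⟩
    exact fun z hz hzE => Set.disjoint_left.1 hUV (hEU hzE) hz
  · have hxy : x ≠ y := fun h => hne (by rw [h])
    obtain ⟨U, V, hU, hV, hxU, hyV, hUV⟩ := t2_separation hxy
    refine ⟨Collapse.mk E '' (U ∩ (Subtype.val ⁻¹' (E : Set X))ᶜ),
      Collapse.mk E '' (V ∩ (Subtype.val ⁻¹' (E : Set X))ᶜ),
      Collapse.isOpen_image E (hU.inter hcl.isOpen_compl) (Or.inl fun z hz => hz.2),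
      Collapse.isOpen_image E (hV.inter hcl.isOpen_compl) (Or.inl fun z hz => hz.2),
      ⟨x, ⟨hxU, hx⟩, rfl⟩, ⟨y, ⟨hyV, hy⟩, rfl⟩, hdisj _ _ ?_ fun z hz => hz.2⟩
    exact hUV.mono inter_subset_left inter_subset_left

instance Collapse.instT2Space [T2Space X] [CWComplex.Finite C] (E : Subcomplex C) :
    T2Space (Collapse E) where
  t2 := by
    intro p q hpq
    obtain ⟨x, rfl⟩ := (Collapse.isQuotientMap_mk E).surjective p
    obtain ⟨y, rfl⟩ := (Collapse.isQuotientMap_mk E).surjective q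
    by_cases hy : (y : X) ∈ (E : Set X)
    · have hx : (x : X) ∉ (E : Set X) := fun hx =>
        hpq ((Collapse.mk_eq_iff E).2 (Or.inr ⟨hx, hy⟩))
      obtain ⟨U, V, hU, hV, hyU, hxV, hUV⟩ := Collapse.exists_separation E hx hpq.symm
      exact ⟨V, U, hV, hU, hxV, hyU, hUV.symm⟩
    · exact Collapse.exists_separation E hy hpq

/-- The point of `C / E` to which a nonempty subcomplex `E` is collapsed. -/
def Collapse.base (E : Subcomplex C) (hE : (E : Set X).Nonempty) : Collapse E :=
  Collapse.mk E ⟨hE.some, CWComplex.Subcomplex.subset_complex E hE.some_mem⟩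

open scoped Classical in
/-- The quotient map `C → C / E`, extended by a constant to the whole ambient space. -/
def Collapse.proj (E : Subcomplex C) (hE : (E : Set X).Nonempty) (x : X) : Collapse E :=
  if h : x ∈ C then Collapse.mk E ⟨x, h⟩ else Collapse.base E hE

/-- A choice of representatives in `C` of the points of `C / E`. -/
def Collapse.rep (E : Subcomplex C) (q : Collapse E) : X :=
  ((Collapse.isQuotientMap_mk E).surjective q).choose

theorem Collapse.proj_of_mem (E : Subcomplex C) (hE : (E : Set X).Nonempty) {x : X} (h : x ∈ C) :
    Collapse.proj E hE x = Collapse.mk E ⟨x, h⟩ := dif_pos h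

theorem Collapse.proj_of_mem_sub (E : Subcomplex C) (hE : (E : Set X).Nonempty) {x : X}
    (h : x ∈ (E : Set X)) : Collapse.proj E hE x = Collapse.base E hE := by
  rw [Collapse.proj_of_mem E hE (CWComplex.Subcomplex.subset_complex E h), Collapse.base,
    Collapse.mk_eq_iff]
  exact Or.inr ⟨h, hE.some_mem⟩

theorem Collapse.continuousOn_proj (E : Subcomplex C) (hE : (E : Set X).Nonempty) :
    ContinuousOn (Collapse.proj E hE) C := by
  rw [continuousOn_iff_continuous_domRestrict]
  convert (Collapse.isQuotientMap_mk E).continuous using 1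
  funext x
  exact Collapse.proj_of_mem E hE x.2

theorem Collapse.proj_eq_iff (E : Subcomplex C) (hE : (E : Set X).Nonempty) {x y : X}
    (hx : x ∈ C) (hy : y ∈ C) : Collapse.proj E hE x = Collapse.proj E hE y ↔
      x = y ∨ (x ∈ (E : Set X) ∧ y ∈ (E : Set X)) := by
  rw [Collapse.proj_of_mem E hE hx, Collapse.proj_of_mem E hE hy, Collapse.mk_eq_iff]
  simp

theorem Collapse.rep_proj (E : Subcomplex C) (hE : (E : Set X).Nonempty) {x : X} (hx : x ∈ C)
    (hxE : x ∉ (E : Set X)) : Collapse.rep E (Collapse.proj E hE x) = x := by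
  have h := ((Collapse.isQuotientMap_mk E).surjective (Collapse.proj E hE x)).choose_spec
  rw [Collapse.proj_of_mem E hE hx, Collapse.mk_eq_iff] at h
  rcases h with h | h
  · rw [Collapse.proj_of_mem E hE hx]
    exact congrArg Subtype.val h
  · exact absurd h.2 hxE

theorem Collapse.continuousOn_rep (E : Subcomplex C) (hE : (E : Set X).Nonempty) :
    ContinuousOn (Collapse.rep E) (Collapse.proj E hE '' (C \ E)) := by
  rw [continuousOn_open_iff]
  · intro V hV
    convert Collapse.isOpen_image E (U := Subtype.val ⁻¹' (V \ E))
      ((hV.sdiff E.closed').preimage continuous_subtype_val) (Or.inl fun z hz => hz.2) using 1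
    ext q
    constructor
    · rintro ⟨⟨x, hx, rfl⟩, hq⟩
      rw [mem_preimage, Collapse.rep_proj E hE hx.1 hx.2] at hq
      exact ⟨⟨x, hx.1⟩, ⟨hq, hx.2⟩, (Collapse.proj_of_mem E hE hx.1).symm⟩
    · rintro ⟨x, hx, rfl⟩
      rw [← Collapse.proj_of_mem E hE x.2]
      refine ⟨⟨x, ⟨x.2, hx.2⟩, rfl⟩, ?_⟩
      rw [mem_preimage, Collapse.rep_proj E hE x.2 hx.2]
      exact hx.1
  · convert Collapse.isOpen_image E (U := Subtype.val ⁻¹' (E : Set X)ᶜ)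
      (E.closed'.isOpen_compl.preimage continuous_subtype_val) (Or.inl fun z hz => hz) using 1
    ext q
    constructor
    · rintro ⟨x, hx, rfl⟩
      exact ⟨⟨x, hx.1⟩, hx.2, (Collapse.proj_of_mem E hE hx.1).symm⟩
    · rintro ⟨x, hx, rfl⟩
      exact ⟨x, ⟨x.2, hx⟩, Collapse.proj_of_mem E hE x.2⟩

theorem openCell_subset_diff (E : Subcomplex C) {n : ℕ} {i : cell C n} (hi : i ∉ E.I n) :
    openCell n i ⊆ C \ E := fun _ hx =>
  ⟨CWComplex.openCell_subset_complex n i hx,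
    (CWComplex.Subcomplex.disjoint_openCell_subcomplex_of_not_mem E hi).notMem_of_mem_left hx⟩

/-- The `n`-cells of `C / E`: the `n`-cells of `C` outside `E` and, for `n = 0`, one new cell,
the point to which `E` is collapsed. -/
def Collapse.cells (E : Subcomplex C) (n : ℕ) : Type u :=
  {i : cell C n // i ∉ E.I n} ⊕ ULift.{u} (PLift (n = 0))

/-- The characteristic maps of `C / E`: those of the cells of `C` outside `E` followed by the
quotient map, and the inclusion of the point to which `E` is collapsed. -/
def Collapse.charMap (E : Subcomplex C) (hE : (E : Set X).Nonempty) (n : ℕ) :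
    Collapse.cells E n → PartialEquiv (Fin n → ℝ) (Collapse E)
  | Sum.inl i =>
    { toFun := fun v => Collapse.proj E hE (map n i.1 v)
      invFun := fun q => (map n i.1).symm (Collapse.rep E q)
      source := ball 0 1
      target := Collapse.proj E hE '' openCell n i.1
      map_source' := fun v hv => ⟨_, ⟨v, hv, rfl⟩, rfl⟩
      map_target' := by
        rintro _ ⟨_, ⟨v, hv, rfl⟩, rfl⟩
        have h := openCell_subset_diff E i.2 ⟨v, hv, rfl⟩
        rw [Collapse.rep_proj E hE h.1 h.2, (map n i.1).left_inv
          (by rw [RelCWComplex.source_eq]; exact hv)]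
        exact hv
      left_inv' := by
        intro v hv
        have h := openCell_subset_diff E i.2 ⟨v, hv, rfl⟩
        rw [Collapse.rep_proj E hE h.1 h.2, (map n i.1).left_inv
          (by rw [RelCWComplex.source_eq]; exact hv)]
      right_inv' := by
        rintro _ ⟨_, ⟨v, hv, rfl⟩, rfl⟩
        have h := openCell_subset_diff E i.2 ⟨v, hv, rfl⟩
        rw [Collapse.rep_proj E hE h.1 h.2, (map n i.1).left_inv
          (by rw [RelCWComplex.source_eq]; exact hv)] }
  | Sum.inr h =>
    { toFun := fun _ => Collapse.base E hE
      invFun := fun _ => 0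
      source := ball 0 1
      target := {Collapse.base E hE}
      map_source' := fun _ _ => rfl
      map_target' := fun _ _ => by simp
      left_inv' := by
        intro v _
        obtain ⟨⟨rfl⟩⟩ := h
        exact Subsingleton.elim _ _
      right_inv' := fun _ hq => hq.symm }

theorem Collapse.charMap_inl_image (E : Subcomplex C) (hE : (E : Set X).Nonempty) {n : ℕ}
    (i : {i : cell C n // i ∉ E.I n}) (s : Set (Fin n → ℝ)) :
    Collapse.charMap E hE n (Sum.inl i) '' s = Collapse.proj E hE '' (map n i.1 '' s) := by
  rw [image_image]
  rfl

theorem Collapse.charMap_inr_image (E : Subcomplex C) (hE : (E : Set X).Nonempty) {n : ℕ}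
    (h : ULift (PLift (n = 0))) {s : Set (Fin n → ℝ)} (hs : s.Nonempty) :
    Collapse.charMap E hE n (Sum.inr h) '' s = {Collapse.base E hE} :=
  hs.image_const _

theorem Collapse.disjoint_of_ne (E : Subcomplex C) (hE : (E : Set X).Nonempty)
    {p q : Σ n, Collapse.cells E n} (hpq : p ≠ q) :
    Disjoint (Collapse.charMap E hE p.1 p.2 '' ball 0 1)
      (Collapse.charMap E hE q.1 q.2 '' ball 0 1) := by
  have hb : ∀ n, (ball (0 : Fin n → ℝ) 1).Nonempty := fun n => nonempty_ball.2 one_pos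
  have key : ∀ {n : ℕ} (i : {i : cell C n // i ∉ E.I n}),
      Disjoint (Collapse.proj E hE '' openCell n i.1) {Collapse.base E hE} := by
    intro n i
    rw [disjoint_singleton_right]
    rintro ⟨x, hx, hxb⟩
    have h := openCell_subset_diff E i.2 hx
    rw [← Collapse.proj_of_mem_sub E hE hE.some_mem, Collapse.proj_eq_iff E hE h.1
      (CWComplex.Subcomplex.subset_complex E hE.some_mem)] at hxb
    rcases hxb with hxb | hxb
    · exact h.2 (hxb ▸ hE.some_mem)
    · exact h.2 hxb.1
  obtain ⟨n, i | i⟩ := p <;> obtain ⟨m, j | j⟩ := q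
  · simp only [Collapse.charMap_inl_image]
    rw [Set.disjoint_left]
    rintro _ ⟨x, hx, rfl⟩ ⟨y, hy, hyx⟩
    have hx' := openCell_subset_diff E i.2 hx
    have hy' := openCell_subset_diff E j.2 hy
    rw [Collapse.proj_eq_iff E hE hy'.1 hx'.1] at hyx
    rcases hyx with rfl | hyx
    · refine (CWComplex.disjoint_openCell_of_ne (C := C) (i := i.1) (j := j.1) ?_).notMem_of_mem_left
        hx hy
      intro h
      apply hpq
      obtain ⟨i, hi⟩ := i
      obtain ⟨j, hj⟩ := j
      cases h
      rfl
    · exact hy'.2 hyx.1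
  · rw [Collapse.charMap_inl_image, Collapse.charMap_inr_image E hE _ (hb m)]
    exact key i
  · rw [Collapse.charMap_inl_image, Collapse.charMap_inr_image E hE _ (hb n)]
    exact (key j).symm
  · exfalso
    obtain ⟨⟨rfl⟩⟩ := i
    obtain ⟨⟨rfl⟩⟩ := j
    exact hpq rfl

theorem Collapse.proj_mem_iUnion [T2Space X] (E : Subcomplex C) (hE : (E : Set X).Nonempty) {n m : ℕ}
    (hm : m < n) {j : cell C m} {x : X} (hx : x ∈ openCell m j) :
    Collapse.proj E hE x ∈ ⋃ (m < n) (j : Collapse.cells E m),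
      Collapse.charMap E hE m j '' closedBall 0 1 := by
  simp only [mem_iUnion]
  by_cases hj : j ∈ E.I m
  · refine ⟨0, by lia, Sum.inr ⟨⟨rfl⟩⟩, 0, by simp, ?_⟩
    exact (Collapse.proj_of_mem_sub E hE
      (CWComplex.Subcomplex.openCell_subset_of_mem E hj hx)).symm
  · refine ⟨m, hm, Sum.inl ⟨j, hj⟩, ?_⟩
    rw [Collapse.charMap_inl_image]
    exact ⟨x, CWComplex.openCell_subset_closedCell m j hx, rfl⟩

theorem Collapse.eventually_isEmpty_cells [CWComplex.Finite C] (E : Subcomplex C) :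
    ∀ᶠ n in Filter.atTop, IsEmpty (Collapse.cells E n) := by
  have h : ∀ᶠ n in Filter.atTop, IsEmpty (cell C n) :=
    RelCWComplex.FiniteDimensional.eventually_isEmpty_cell
  filter_upwards [h, Filter.eventually_gt_atTop 0]
    with n hn hn0
  refine ⟨?_⟩
  rintro (i | ⟨⟨⟨h⟩⟩⟩)
  · exact hn.false i.1
  · exact hn0.ne' h

theorem Collapse.finite_cells [CWComplex.Finite C] (E : Subcomplex C) (n : ℕ) :
    Finite (Collapse.cells E n) := by
  have : Finite (cell C n) := CWComplex.FiniteType.finite_cell n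
  unfold Collapse.cells
  infer_instance

theorem Collapse.charMap_source (E : Subcomplex C) (hE : (E : Set X).Nonempty) (n : ℕ)
    (i : Collapse.cells E n) : (Collapse.charMap E hE n i).source = ball 0 1 := by
  rcases i with i | i <;> rfl

theorem Collapse.continuousOn_charMap (E : Subcomplex C) (hE : (E : Set X).Nonempty) (n : ℕ)
    (i : Collapse.cells E n) : ContinuousOn (Collapse.charMap E hE n i) (closedBall 0 1) := by
  rcases i with i | i
  · exact (Collapse.continuousOn_proj E hE).comp (RelCWComplex.continuousOn n i.1)
      fun v hv => CWComplex.closedCell_subset_complex n i.1 ⟨v, hv, rfl⟩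
  · exact continuousOn_const

theorem Collapse.continuousOn_charMap_symm (E : Subcomplex C) (hE : (E : Set X).Nonempty) (n : ℕ)
    (i : Collapse.cells E n) :
    ContinuousOn (Collapse.charMap E hE n i).symm (Collapse.charMap E hE n i).target := by
  rcases i with i | i
  · refine (RelCWComplex.continuousOn_symm n i.1).comp
      ((Collapse.continuousOn_rep E hE).mono (image_mono (openCell_subset_diff E i.2))) ?_
    rintro _ ⟨x, hx, rfl⟩
    have h := openCell_subset_diff E i.2 hx
    rw [Collapse.rep_proj E hE h.1 h.2]
    obtain ⟨v, hv, rfl⟩ := hx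
    exact (map n i.1).map_source (by rw [RelCWComplex.source_eq]; exact hv)
  · exact continuousOn_const

theorem Collapse.mapsTo_charMap [T2Space X] (E : Subcomplex C) (hE : (E : Set X).Nonempty) (n : ℕ)
    (i : Collapse.cells E n) : MapsTo (Collapse.charMap E hE n i) (sphere 0 1)
      (⋃ (m < n) (j : Collapse.cells E m), Collapse.charMap E hE m j '' closedBall 0 1) := by
  intro v hv
  rcases i with i | ⟨⟨⟨rfl⟩⟩⟩
  · obtain ⟨I, hI⟩ := CWComplex.cellFrontier_subset_finite_openCell n i.1
    have h := hI ⟨v, hv, rfl⟩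
    simp only [mem_iUnion] at h
    obtain ⟨m, hm, j, _, hj⟩ := h
    exact Collapse.proj_mem_iUnion E hE hm hj
  · simp [sphere_eq_empty_of_subsingleton] at hv

theorem Collapse.iUnion_charMap [T2Space X] (E : Subcomplex C) (hE : (E : Set X).Nonempty) :
    ⋃ (n : ℕ) (j : Collapse.cells E n), Collapse.charMap E hE n j '' closedBall 0 1 = univ := by
  rw [eq_univ_iff_forall]
  intro q
  obtain ⟨⟨x, hx⟩, rfl⟩ := (Collapse.isQuotientMap_mk E).surjective q
  rw [← Collapse.proj_of_mem E hE hx]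
  rw [← CWComplex.iUnion_openCell_eq_complex (C := C)] at hx
  simp only [mem_iUnion] at hx
  obtain ⟨n, j, hx⟩ := hx
  have h := Collapse.proj_mem_iUnion E hE (Nat.lt_succ_self n) hx
  simp only [mem_iUnion] at h ⊢
  obtain ⟨m, _, i, h⟩ := h
  exact ⟨m, i, h⟩

/-- The CW structure on the quotient space `K / E` of a finite CW complex `K = C` by a nonempty
subcomplex `E`. -/
@[reducible]
def Collapse.cwComplex [T2Space X] [CWComplex.Finite C] (E : Subcomplex C)
    (hE : (E : Set X).Nonempty) : CWComplex (univ : Set (Collapse E)) :=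
  CWComplex.mkFinite univ (Collapse.cells E) (Collapse.charMap E hE)
    (Collapse.eventually_isEmpty_cells E) (Collapse.finite_cells E)
    (Collapse.charMap_source E hE) (Collapse.continuousOn_charMap E hE)
    (Collapse.continuousOn_charMap_symm E hE)
    (fun _ _ _ _ hpq => Collapse.disjoint_of_ne E hE hpq)
    (Collapse.mapsTo_charMap E hE) (Collapse.iUnion_charMap E hE)

theorem Collapse.finite_cwComplex [T2Space X] [CWComplex.Finite C] (E : Subcomplex C)
    (hE : (E : Set X).Nonempty) :
    letI := Collapse.cwComplex E hE
    CWComplex.Finite (univ : Set (Collapse E)) :=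
  CWComplex.finite_mkFinite univ (Collapse.cells E) (Collapse.charMap E hE)
    (Collapse.eventually_isEmpty_cells E) (Collapse.finite_cells E)
    (Collapse.charMap_source E hE) (Collapse.continuousOn_charMap E hE)
    (Collapse.continuousOn_charMap_symm E hE)
    (fun _ _ _ _ hpq => Collapse.disjoint_of_ne E hE hpq)
    (Collapse.mapsTo_charMap E hE) (Collapse.iUnion_charMap E hE)

end Contraction

/-- The dimension `j` Tutte-Krushkal-Renardy polynomial of the quotient complex `C / E`. -/
def tkrPolyCollapse {X : Type u} [TopologicalSpace X] [T2Space X] {C : Set X} [CWComplex C]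
    [CWComplex.Finite C] (E : Subcomplex C) (hE : (E : Set X).Nonempty) (j : ℕ) :
    MvPolynomial (Fin 2) ℤ :=
  letI := Collapse.cwComplex E hE
  haveI := Collapse.finite_cwComplex E hE
  tkrPoly (univ : Set (Collapse E)) j

end

noncomputable section

/-! ### Affine chains -/

/-! Because the dimension is at most k, a spanning subcomplex is the (k-1)-skeleton together with an
arbitrary set A of k-cells (`tkrPoly_eq_rankPoly`). Let F(A) and G(A) be its Betti numbers in
degrees k and k-1. The theorem then becomes a statement about generating functions over subsets.

Attaching one k-cell to L gives a pair (L', L) whose homology is ℤ in degree k and zero elsewhere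
(`Attaches.concentrated`). The long exact sequence leaves two cases. Either some cycle of L' runs
over the new cell and F grows by one, or none does and G drops by one (`rankStep_levelSet`). The
case is decided by whether H_k(L') → H_k(L', L) vanishes. By naturality, vanishing passes to every
smaller complex to which the same cell can be attached (`Attaches.toRel_eq_zero_of_subset`). A loop
already has a cycle in its closure, so it always creates one. No cycle of the whole complex runs
over a bridge, so it never creates one.

Consequently F(A) - G(A) - |A| is constant (`RankStep.add_card`), and the exponents of X are
determined by those of Y and by cardinalities. Subsets avoiding σ give the deletion, with the right
normalization as long as σ is not a bridge. Subsets containing σ give the contraction, provided that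
β_k is unchanged by collapsing the closure of σ (`rankPoly_contraction`); β_{k-1} of the quotient
need not be computed.

The invariance of β_k uses both hypotheses on σ. If σ is not a loop, its closure has β_k = 0, and
the boundary of the relative generator is a nonzero class in the reduced H_{k-1} of the frontier.
Boundary regularity makes that group ℤ, so killing this class leaves torsion
(`torsionKer_toPoint_closedCell`). Starting from the closure of σ, the remaining cells are attached
one at a time, and homology is compared along the quotient map by four lemmas modulo torsion
(`bettiRel_image_proj`).

The homology theory needed is developed on explicit chains: prisms give homotopy invariance,
barycentric subdivision gives excision, and the long exact sequence of a triple is chased on chains.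
`singHEquiv` identifies the result with the singular homology of the statement. -/

/-- The augmented complex of affine chains in `E`: the free abelian group on the finite sequences
of points of `E`; a sequence of `n + 1` points spans an affine simplex of dimension `n`. -/
abbrev AffineChain (E : Type*) := (Σ n : ℕ, (Fin n → E)) →₀ ℤ

/-- A linear combination of members of a submodule `N` is in `N`. -/
theorem Finsupp.linearCombination_mem_of_supported {α M : Type*} [AddCommGroup M] {f : α → M}
    {s : Set α} {N : Submodule ℤ M} (h : ∀ x ∈ s, f x ∈ N) {c : α →₀ ℤ}
    (hc : c ∈ Finsupp.supported ℤ ℤ s) : Finsupp.linearCombination ℤ f c ∈ N := by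
  rw [Finsupp.linearCombination_apply]
  exact N.sum_mem fun x hx => N.smul_mem _ (h x (hc hx))

namespace AffineChain

variable {E F : Type*}

/-- The affine simplex with the given vertices. -/
abbrev spx {n : ℕ} (w : Fin n → E) : AffineChain E := Finsupp.single ⟨n, w⟩ 1

theorem hom_ext {M : Type*} [AddCommGroup M] {f g : AffineChain E →ₗ[ℤ] M}
    (h : ∀ n (w : Fin n → E), f (spx w) = g (spx w)) : f = g := by
  apply Finsupp.lhom_ext'
  rintro ⟨n, w⟩
  exact LinearMap.ext_ring (h n w)

/-- The boundary of an affine simplex. -/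
def bdSimp : (Σ n : ℕ, (Fin n → E)) → AffineChain E
  | ⟨0, _⟩ => 0
  | ⟨n + 1, w⟩ => ∑ i : Fin (n + 1), (-1 : ℤ) ^ (i : ℕ) • spx (w ∘ i.succAbove)

/-- The (augmented) boundary operator. -/
def bd : AffineChain E →ₗ[ℤ] AffineChain E := Finsupp.linearCombination ℤ bdSimp

/-- The cone with apex `b`. -/
def cone (b : E) : AffineChain E →ₗ[ℤ] AffineChain E :=
  Finsupp.lmapDomain ℤ ℤ fun s => ⟨s.1 + 1, Fin.cons b s.2⟩

/-- The chain map induced by a map of vertices. -/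
def push (f : E → F) : AffineChain E →ₗ[ℤ] AffineChain F :=
  Finsupp.lmapDomain ℤ ℤ fun s => ⟨s.1, f ∘ s.2⟩

theorem bd_spx_zero (w : Fin 0 → E) : bd (spx w) = 0 := by
  simp [bd, spx, bdSimp]

theorem bd_spx_succ {n : ℕ} (w : Fin (n + 1) → E) :
    bd (spx w) = ∑ i : Fin (n + 1), (-1 : ℤ) ^ (i : ℕ) • spx (w ∘ i.succAbove) := by
  simp [bd, spx, bdSimp]

theorem cone_spx (b : E) {n : ℕ} (w : Fin n → E) :
    cone b (spx w) = spx (Fin.cons b w : Fin (n + 1) → E) := by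
  simp [cone, spx]

theorem push_spx (f : E → F) {n : ℕ} (w : Fin n → E) : push f (spx w) = spx (f ∘ w) := by
  simp [push, spx]

theorem spx_succ {n : ℕ} (w : Fin (n + 1) → E) : spx w = cone (w 0) (spx (Fin.tail w)) := by
  rw [cone_spx, Fin.cons_self_tail]

/-- The augmentation makes this hold without exception: for the empty simplex it says that a vertex
has the empty simplex as boundary. Since each nonempty simplex is a cone over its tail, the later
identities follow from this one by induction. -/
theorem bd_cone (b : E) (c : AffineChain E) : bd (cone b c) = c - cone b (bd c) := by
  suffices h : bd ∘ₗ cone b = LinearMap.id - cone b ∘ₗ bd from LinearMap.congr_fun h c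
  refine hom_ext fun n w => ?_
  simp only [LinearMap.comp_apply, LinearMap.sub_apply, LinearMap.id_apply, cone_spx]
  rw [bd_spx_succ, Fin.sum_univ_succ, sub_eq_add_neg]
  congr 1
  · simp [Function.comp_def]
  · cases n with
    | zero => simp [bd_spx_zero]
    | succ n =>
      rw [bd_spx_succ, map_sum, ← Finset.sum_neg_distrib]
      refine Finset.sum_congr rfl fun i _ => ?_
      rw [map_smul, cone_spx, Fin.val_succ, pow_succ, mul_neg_one, neg_smul]
      congr 3
      funext j
      refine Fin.cases ?_ (fun j => ?_) j <;> simp [Fin.succ_succAbove_succ]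

theorem bd_bd (c : AffineChain E) : bd (bd c) = 0 := by
  suffices h : ∀ n (w : Fin n → E), bd (bd (spx w)) = 0 from
    LinearMap.congr_fun (hom_ext (f := bd ∘ₗ bd) (g := 0) h) c
  intro n
  induction n with
  | zero => intro w; simp [bd_spx_zero]
  | succ n ih =>
    intro w
    rw [spx_succ, bd_cone, map_sub, bd_cone, ih, map_zero, sub_zero, sub_self]

theorem bd_push (f : E → F) (c : AffineChain E) : bd (push f c) = push f (bd c) := by
  refine LinearMap.congr_fun (hom_ext (f := bd ∘ₗ push f) (g := push f ∘ₗ bd) ?_) c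
  intro n w
  simp only [LinearMap.comp_apply, push_spx]
  cases n with
  | zero => simp [bd_spx_zero]
  | succ n =>
    simp only [bd_spx_succ, map_sum, map_smul, push_spx]
    rfl

theorem push_cone (f : E → F) (b : E) (c : AffineChain E) :
    push f (cone b c) = cone (f b) (push f c) := by
  refine LinearMap.congr_fun (hom_ext (f := push f ∘ₗ cone b) (g := cone (f b) ∘ₗ push f) ?_) c
  intro n w
  simp only [LinearMap.comp_apply, push_spx, cone_spx]
  congr 2
  exact (Fin.comp_cons f b w)

theorem push_push {G : Type*} (f : E → F) (g : F → G) (c : AffineChain E) :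
    push g (push f c) = push (g ∘ f) c := by
  refine LinearMap.congr_fun (hom_ext (f := push g ∘ₗ push f) (g := push (g ∘ f)) ?_) c
  intro n w
  simp only [LinearMap.comp_apply, push_spx]
  rfl

/-! ### The prism operator -/

/-- The decomposition of the prism over an affine simplex. -/
def prismSimp : ∀ n : ℕ, (Fin n → E) → AffineChain (E × ℝ)
  | 0, _ => 0
  | n + 1, w => spx (Fin.cons (w 0, 0) fun i => (w i, 1) : Fin (n + 2) → E × ℝ) -
      cone (w 0, 0) (prismSimp n (Fin.tail w))

/-- The prism operator. -/
def prism : AffineChain E →ₗ[ℤ] AffineChain (E × ℝ) :=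
  Finsupp.linearCombination ℤ fun s => prismSimp s.1 s.2

theorem prism_spx {n : ℕ} (w : Fin n → E) : prism (spx w) = prismSimp n w := by
  simp [prism, spx]

/-- This is the recursion of `prismSimp` made linear in the chain; together with `bd_cone` it
reduces the homotopy formula to algebra. -/
theorem prism_cone (b : E) (c : AffineChain E) : prism (cone b c) =
    cone (b, 0) (cone (b, 1) (push (fun x => (x, 1)) c)) - cone (b, 0) (prism c) := by
  refine LinearMap.congr_fun (hom_ext (f := prism ∘ₗ cone b) (g := cone (b, 0) ∘ₗ cone (b, 1) ∘ₗ
    push (fun x => (x, 1)) - cone (b, 0) ∘ₗ prism) ?_) c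
  intro n w
  simp only [LinearMap.comp_apply, push_spx, cone_spx, LinearMap.sub_apply, prism_spx,
    prismSimp, Fin.cons_zero, Fin.tail_cons]
  congr 4
  exact Fin.comp_cons (fun x => (x, (1 : ℝ))) b w

theorem bd_prism (c : AffineChain E) : bd (prism c) =
    push (fun x => (x, 1)) c - push (fun x => (x, 0)) c - prism (bd c) := by
  refine LinearMap.congr_fun (hom_ext (f := bd ∘ₗ prism) (g := push (fun x => (x, 1)) -
    push (fun x => (x, 0)) - prism ∘ₗ bd) ?_) c
  intro n
  simp only [LinearMap.comp_apply, LinearMap.sub_apply]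
  induction n with
  | zero =>
    intro w
    simp only [prism_spx, prismSimp, push_spx, bd_spx_zero, map_zero]
    -- The empty simplex has the same image at both ends of the prism.
    rw [eq_comm, sub_zero, sub_eq_zero]
    exact congrArg spx (Subsingleton.elim _ _)
  | succ n ih =>
    intro w
    rw [spx_succ, prism_cone, map_sub, bd_cone, bd_cone, bd_cone, ih, bd_cone]
    simp only [map_sub, bd_push, prism_cone, push_cone]
    abel

theorem prism_push (f : E → F) (c : AffineChain E) :
    prism (push f c) = push (Prod.map f id) (prism c) := by
  refine LinearMap.congr_fun (hom_ext (f := prism ∘ₗ push f)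
    (g := push (Prod.map f id) ∘ₗ prism) ?_) c
  intro n
  simp only [LinearMap.comp_apply]
  induction n with
  | zero => intro w; simp [push_spx, prism_spx, prismSimp]
  | succ n ih =>
    intro w
    rw [spx_succ, push_cone, prism_cone, prism_cone, map_sub, push_cone, push_cone, push_cone,
      push_push, push_push, ih]
    rfl

/-! ### Affine chains supported in a set -/

/-- Affine chains of simplices with `m` vertices, all of them in `K`. -/
def chainsIn (m : ℕ) (K : Set E) : Submodule ℤ (AffineChain E) :=
  Finsupp.supported ℤ ℤ {s | s.1 = m ∧ ∀ i, s.2 i ∈ K}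

theorem spx_mem_chainsIn {n : ℕ} {K : Set E} {w : Fin n → E} (h : ∀ i, w i ∈ K) :
    spx w ∈ chainsIn n K :=
  Finsupp.single_mem_supported ℤ _ ⟨rfl, h⟩

theorem map_mem_of_mem_chainsIn {M : Type*} [AddCommGroup M] {m : ℕ} {K : Set E}
    {N : Submodule ℤ M} {f : AffineChain E →ₗ[ℤ] M}
    (h : ∀ w : Fin m → E, (∀ i, w i ∈ K) → f (spx w) ∈ N) {c : AffineChain E}
    (hc : c ∈ chainsIn m K) : f c ∈ N := by
  have hf : f = Finsupp.linearCombination ℤ fun s => f (spx s.2) :=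
    hom_ext fun n w => by simp [spx]
  rw [hf]
  refine Finsupp.linearCombination_mem_of_supported ?_ hc
  rintro ⟨n, w⟩ ⟨h1, h2⟩
  obtain rfl : n = m := h1
  exact h w h2

theorem cone_mem_chainsIn {m : ℕ} {K : Set E} {b : E} (hb : b ∈ K) {c : AffineChain E}
    (hc : c ∈ chainsIn m K) : cone b c ∈ chainsIn (m + 1) K := by
  refine map_mem_of_mem_chainsIn (fun w hw => ?_) hc
  rw [cone_spx]
  exact spx_mem_chainsIn fun i => Fin.cases hb hw i

theorem bd_mem_chainsIn {m : ℕ} {K : Set E} {c : AffineChain E}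
    (hc : c ∈ chainsIn (m + 1) K) : bd c ∈ chainsIn m K := by
  refine map_mem_of_mem_chainsIn (fun w hw => ?_) hc
  rw [bd_spx_succ]
  exact Submodule.sum_mem _ fun i _ => Submodule.smul_mem _ _ (spx_mem_chainsIn fun j => hw _)

theorem prism_mem_chainsIn {m : ℕ} {K : Set E} {c : AffineChain E}
    (hc : c ∈ chainsIn m K) : prism c ∈ chainsIn (m + 1) (K ×ˢ Icc (0 : ℝ) 1) := by
  refine map_mem_of_mem_chainsIn (fun w hw => ?_) hc
  rw [prism_spx]
  clear hc
  induction m with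
  | zero => exact Submodule.zero_mem _
  | succ m ih =>
    refine Submodule.sub_mem _ (spx_mem_chainsIn fun i => ?_)
      (cone_mem_chainsIn (by simp [hw]) (ih _ fun i => hw _))
    refine Fin.cases (by simp [hw]) (fun i => by simp [hw]) i

/-! ### Barycentric subdivision -/

section Subdivision

variable [AddCommGroup E] [Module ℝ E] [AddCommGroup F] [Module ℝ F]

/-- The barycenter of a sequence of points. -/
def bary {n : ℕ} (w : Fin n → E) : E := (n : ℝ)⁻¹ • ∑ i, w i

/-- The value on an affine simplex of the homotopy between the identity and the
barycentric subdivision. -/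
def subdivHtpySimp : ∀ n : ℕ, (Fin n → E) → AffineChain E
  | 0, _ => 0
  | n + 1, w => cone (bary w) (spx w -
      ∑ i : Fin (n + 1), (-1 : ℤ) ^ (i : ℕ) • subdivHtpySimp n (w ∘ i.succAbove))

/-- The chain homotopy between the identity and the barycentric subdivision. -/
def subdivHtpy : AffineChain E →ₗ[ℤ] AffineChain E :=
  Finsupp.linearCombination ℤ fun s => subdivHtpySimp s.1 s.2

theorem subdivHtpy_spx_zero (w : Fin 0 → E) : subdivHtpy (spx w) = 0 := by
  simp [subdivHtpy, spx, subdivHtpySimp]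

theorem subdivHtpy_spx_succ {n : ℕ} (w : Fin (n + 1) → E) :
    subdivHtpy (spx w) = cone (bary w) (spx w - subdivHtpy (bd (spx w))) := by
  rw [bd_spx_succ]
  simp [subdivHtpy, spx, subdivHtpySimp]

/-- Barycentric subdivision. -/
def sd : AffineChain E →ₗ[ℤ] AffineChain E :=
  LinearMap.id - bd ∘ₗ subdivHtpy - subdivHtpy ∘ₗ bd

theorem sd_apply (c : AffineChain E) : sd c = c - bd (subdivHtpy c) - subdivHtpy (bd c) := rfl

theorem sd_spx_zero (w : Fin 0 → E) : sd (spx w) = spx w := by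
  simp [sd_apply, subdivHtpy_spx_zero, bd_spx_zero]

/-- Since `sd` is defined through its homotopy, the homotopy formula is free and this usual
recursion is what has to be recovered. It is the form that controls the size of the pieces. -/
theorem sd_spx_succ {n : ℕ} (w : Fin (n + 1) → E) :
    sd (spx w) = cone (bary w) (sd (bd (spx w))) := by
  rw [sd_apply, sd_apply, subdivHtpy_spx_succ, bd_cone]
  simp only [map_sub, bd_bd, map_zero]
  abel

theorem bary_comp (L : E →ₗ[ℝ] F) {n : ℕ} (w : Fin n → E) : bary (L ∘ w) = L (bary w) := by
  simp [bary]

theorem bary_mem {K : Set E} (hK : Convex ℝ K) {n : ℕ} {w : Fin (n + 1) → E}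
    (hw : ∀ i, w i ∈ K) : bary w ∈ K := by
  rw [bary, Finset.smul_sum]
  refine hK.sum_mem (fun _ _ => by positivity) ?_ fun i _ => hw i
  rw [Finset.sum_const, Finset.card_univ, Fintype.card_fin, nsmul_eq_mul, mul_inv_cancel₀]
  positivity

/-- Linear maps preserve barycenters. This naturality is what allows the operator on singular
simplices to be defined from one tautological affine simplex. -/
theorem subdivHtpy_push (L : E →ₗ[ℝ] F) (c : AffineChain E) :
    subdivHtpy (push L c) = push L (subdivHtpy c) := by
  refine LinearMap.congr_fun (hom_ext (f := subdivHtpy ∘ₗ push L)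
    (g := push L ∘ₗ subdivHtpy) ?_) c
  intro n
  simp only [LinearMap.comp_apply]
  induction n with
  | zero => intro w; simp [push_spx, subdivHtpy_spx_zero]
  | succ n ih =>
    intro w
    rw [push_spx, subdivHtpy_spx_succ, subdivHtpy_spx_succ, push_cone, bary_comp,
      bd_spx_succ, bd_spx_succ]
    simp only [map_sub, map_sum, map_smul, ← ih, push_spx]
    rfl

theorem subdivHtpy_mem_chainsIn {m : ℕ} {K : Set E} (hK : Convex ℝ K) {c : AffineChain E}
    (hc : c ∈ chainsIn m K) : subdivHtpy c ∈ chainsIn (m + 1) K := by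
  refine map_mem_of_mem_chainsIn (fun w hw => ?_) hc
  clear hc
  induction m with
  | zero => rw [subdivHtpy_spx_zero]; exact Submodule.zero_mem _
  | succ m ih =>
    rw [subdivHtpy_spx_succ]
    refine cone_mem_chainsIn (bary_mem hK hw) (Submodule.sub_mem _ (spx_mem_chainsIn hw) ?_)
    exact map_mem_of_mem_chainsIn ih (bd_mem_chainsIn (spx_mem_chainsIn hw))

end Subdivision

/-! ### Shrinking of simplices under subdivision -/

section Mesh

variable [NormedAddCommGroup E]

/-- Affine chains of simplices with `m` vertices, all of them in `K` and with mutual distances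
at most `r`. -/
def smallChainsIn (m : ℕ) (K : Set E) (r : ℝ) : Submodule ℤ (AffineChain E) :=
  Finsupp.supported ℤ ℤ {s | s.1 = m ∧ (∀ i, s.2 i ∈ K) ∧ ∀ i j, dist (s.2 i) (s.2 j) ≤ r}

theorem spx_mem_smallChainsIn {n : ℕ} {K : Set E} {r : ℝ} {w : Fin n → E} (h : ∀ i, w i ∈ K)
    (h' : ∀ i j, dist (w i) (w j) ≤ r) : spx w ∈ smallChainsIn n K r :=
  Finsupp.single_mem_supported ℤ _ ⟨rfl, h, h'⟩

theorem smallChainsIn_mono {m : ℕ} {K K' : Set E} {r r' : ℝ} (hK : K ⊆ K') (hr : r ≤ r') :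
    smallChainsIn m K r ≤ smallChainsIn m K' r' :=
  Finsupp.supported_mono fun _ h => ⟨h.1, fun i => hK (h.2.1 i), fun i j => (h.2.2 i j).trans hr⟩

theorem map_mem_of_mem_smallChainsIn {M : Type*} [AddCommGroup M] {m : ℕ} {K : Set E} {r : ℝ}
    {N : Submodule ℤ M} {f : AffineChain E →ₗ[ℤ] M}
    (h : ∀ w : Fin m → E, (∀ i, w i ∈ K) → (∀ i j, dist (w i) (w j) ≤ r) → f (spx w) ∈ N)
    {c : AffineChain E} (hc : c ∈ smallChainsIn m K r) : f c ∈ N := by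
  have hf : f = Finsupp.linearCombination ℤ fun s => f (spx s.2) :=
    hom_ext fun n w => by simp [spx]
  rw [hf]
  refine Finsupp.linearCombination_mem_of_supported ?_ hc
  rintro ⟨n, w⟩ ⟨h1, h2, h3⟩
  obtain rfl : n = m := h1
  exact h w h2 h3

variable [NormedSpace ℝ E]

/-- Balls are convex, so it suffices to treat a vertex. Its difference from the barycenter is the
average of its n + 1 differences from the vertices, one of which is zero; this produces the factor
n/(n+1). -/
theorem dist_bary_le {n : ℕ} {w : Fin (n + 1) → E} {r : ℝ} (h : ∀ i j, dist (w i) (w j) ≤ r)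
    {x : E} (hx : x ∈ convexHull ℝ (range w)) :
    dist x (bary w) ≤ (n / (n + 1 : ℝ)) * r := by
  suffices hs : convexHull ℝ (range w) ⊆ closedBall (bary w) ((n / (n + 1 : ℝ)) * r) from hs hx
  refine convexHull_min ?_ (convex_closedBall _ _)
  rintro _ ⟨j, rfl⟩
  have hn : ((n : ℝ) + 1) ≠ 0 := by positivity
  have h1 : w j - bary w = ((n : ℝ) + 1)⁻¹ • ∑ i, (w j - w i) := by
    rw [Finset.sum_sub_distrib, smul_sub, bary]
    push_cast
    rw [Finset.sum_const, Finset.card_univ, Fintype.card_fin, ← Nat.cast_smul_eq_nsmul ℝ, smul_smul]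
    push_cast
    rw [inv_mul_cancel₀ hn, one_smul]
  rw [mem_closedBall, dist_eq_norm, h1, norm_smul, Fin.sum_univ_succAbove _ j, sub_self, zero_add]
  have h2 : ‖∑ i : Fin n, (w j - w (j.succAbove i))‖ ≤ n * r := by
    refine (norm_sum_le_of_le _ (f := fun i : Fin n => w j - w (j.succAbove i))
      (n := fun _ => r) fun i _ => ?_).trans ?_
    · rw [← dist_eq_norm]; exact h _ _
    · simp
  rw [norm_inv, Real.norm_of_nonneg (by positivity)]
  calc ((n : ℝ) + 1)⁻¹ * _ ≤ ((n : ℝ) + 1)⁻¹ * (n * r) := by gcongr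
    _ = _ := by field_simp

/-- A simplex of the subdivision is a cone from the barycenter over a simplex of a subdivided face.
New edges are bounded by `dist_bary_le`, old ones by induction. -/
theorem sd_spx_mem_smallChainsIn {n : ℕ} {w : Fin (n + 1) → E} {r : ℝ}
    (h : ∀ i j, dist (w i) (w j) ≤ r) :
    sd (spx w) ∈ smallChainsIn (n + 1) (convexHull ℝ (range w)) ((n / (n + 1 : ℝ)) * r) := by
  induction n with
  | zero =>
    rw [sd_spx_succ, bd_spx_succ]
    simp only [map_sum, map_smul, sd_spx_zero, cone_spx]
    refine Submodule.sum_mem _ fun i _ => Submodule.smul_mem _ _ (spx_mem_smallChainsIn ?_ ?_)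
    · refine fun i => Fin.cases ?_ (fun i => i.elim0) i
      exact bary_mem (convex_convexHull ℝ _) fun i => subset_convexHull ℝ _ ⟨i, rfl⟩
    · intro i j
      rw [show i = j from Subsingleton.elim (α := Fin 1) i j, dist_self]
      simp
  | succ n ih =>
    have hr : 0 ≤ r := dist_nonneg.trans (h 0 0)
    have hb : bary w ∈ convexHull ℝ (range w) :=
      bary_mem (convex_convexHull ℝ _) fun i => subset_convexHull ℝ _ ⟨i, rfl⟩
    rw [sd_spx_succ, bd_spx_succ]
    simp only [map_sum, map_smul]
    refine Submodule.sum_mem _ fun i _ => Submodule.smul_mem _ _ ?_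
    have h1 := ih (w := w ∘ i.succAbove) fun _ _ => h _ _
    -- A face has one vertex fewer and shrinks by n/(n+1), which is at most (n+1)/(n+2).
    have h2 := smallChainsIn_mono (r' := ((n + 1 : ℕ) / ((n + 1 : ℕ) + 1 : ℝ)) * r)
      (convexHull_mono (range_comp_subset_range i.succAbove w)) (by
        gcongr ?_ * r
        push_cast
        rw [div_le_div_iff₀ (by positivity) (by positivity)]
        nlinarith) h1
    refine map_mem_of_mem_smallChainsIn (fun v hv hv' => ?_) h2
    rw [cone_spx]
    refine spx_mem_smallChainsIn (fun i => Fin.cases hb hv i) fun i j => ?_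
    refine Fin.cases ?_ (fun i => ?_) i <;> refine Fin.cases ?_ (fun j => ?_) j
    · simp only [Fin.cons_zero, dist_self]
      positivity
    · simp only [Fin.cons_zero, Fin.cons_succ]
      rw [dist_comm]
      exact dist_bary_le h (hv j)
    · simp only [Fin.cons_zero, Fin.cons_succ]
      exact dist_bary_le h (hv i)
    · exact hv' i j

theorem sd_mem_smallChainsIn {n : ℕ} {K : Set E} (hK : Convex ℝ K) {r : ℝ} {c : AffineChain E}
    (hc : c ∈ smallChainsIn (n + 1) K r) :
    sd c ∈ smallChainsIn (n + 1) K ((n / (n + 1 : ℝ)) * r) := by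
  refine map_mem_of_mem_smallChainsIn (fun w hw hw' => ?_) hc
  refine smallChainsIn_mono (convexHull_min ?_ hK) le_rfl (sd_spx_mem_smallChainsIn hw')
  rintro _ ⟨i, rfl⟩
  exact hw i

theorem sd_iterate_mem_smallChainsIn {n : ℕ} {K : Set E} (hK : Convex ℝ K) {r : ℝ}
    {c : AffineChain E} (hc : c ∈ smallChainsIn (n + 1) K r) (m : ℕ) :
    sd^[m] c ∈ smallChainsIn (n + 1) K ((n / (n + 1 : ℝ)) ^ m * r) := by
  induction m with
  | zero => simpa using hc
  | succ m ih =>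
    rw [Function.iterate_succ_apply', pow_succ', mul_assoc]
    exact sd_mem_smallChainsIn hK ih

/-- The bound is required for all large `m`, so that a common number of subdivisions can later be
chosen for finitely many simplices. -/
theorem exists_sd_iterate_mem {n : ℕ} {K : Set E} (hK : Convex ℝ K) {r : ℝ}
    {c : AffineChain E} (hc : c ∈ smallChainsIn (n + 1) K r) {ε : ℝ} (hε : 0 < ε) :
    ∃ m₀, ∀ m ≥ m₀, sd^[m] c ∈ smallChainsIn (n + 1) K ε := by
  have ht : Filter.Tendsto (fun m : ℕ => (n / (n + 1 : ℝ)) ^ m * r) Filter.atTop (𝓝 (0 * r)) :=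
    (tendsto_pow_atTop_nhds_zero_of_lt_one (by positivity)
      ((div_lt_one (by positivity)).2 (by linarith))).mul_const r
  rw [zero_mul] at ht
  obtain ⟨m₀, hm⟩ := Filter.eventually_atTop.1 (ht.eventually_le_const hε)
  exact ⟨m₀, fun m h => smallChainsIn_mono subset_rfl (hm m h)
    (sd_iterate_mem_smallChainsIn hK hc m)⟩

end Mesh

end AffineChain

end

noncomputable section

/-! ### Singular chains -/

/-- The standard simplex of dimension `n`. -/
abbrev TopSimplex (n : ℕ) : Type := stdSimplex ℝ (Fin (n + 1))

/-- The free abelian group on all the functions, continuous or not, from standard simplices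
to `X`. -/
abbrev SingChain (X : Type*) := (Σ n : ℕ, (TopSimplex n → X)) →₀ ℤ

namespace SingChain

open AffineChain (spx chainsIn)

variable {X Y Z E F : Type*}

/-- A singular simplex as a chain. -/
abbrev of {n : ℕ} (s : TopSimplex n → X) : SingChain X := Finsupp.single ⟨n, s⟩ 1

theorem hom_ext {M : Type*} [AddCommGroup M] {f g : SingChain X →ₗ[ℤ] M}
    (h : ∀ n (s : TopSimplex n → X), f (of s) = g (of s)) : f = g := by
  apply Finsupp.lhom_ext'
  rintro ⟨n, s⟩
  exact LinearMap.ext_ring (h n s)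

/-- The boundary of a singular simplex. -/
def bdOf : (Σ n : ℕ, (TopSimplex n → X)) → SingChain X
  | ⟨0, _⟩ => 0
  | ⟨n + 1, s⟩ => ∑ i : Fin (n + 2), (-1 : ℤ) ^ (i : ℕ) • of (s ∘ stdSimplex.map i.succAbove)

/-- The boundary operator. -/
def bd : SingChain X →ₗ[ℤ] SingChain X := Finsupp.linearCombination ℤ bdOf

/-- The map of chains induced by a map of spaces. -/
def push (f : X → Y) : SingChain X →ₗ[ℤ] SingChain Y :=
  Finsupp.lmapDomain ℤ ℤ fun s => ⟨s.1, f ∘ s.2⟩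

theorem bd_of_zero (s : TopSimplex 0 → X) : bd (of s) = 0 := by simp [bd, bdOf]

theorem bd_of_succ {n : ℕ} (s : TopSimplex (n + 1) → X) : bd (of s) =
    ∑ i : Fin (n + 2), (-1 : ℤ) ^ (i : ℕ) • of (s ∘ stdSimplex.map i.succAbove) := by
  simp [bd, bdOf]

theorem push_of (f : X → Y) {n : ℕ} (s : TopSimplex n → X) : push f (of s) = of (f ∘ s) := by
  simp [push]

theorem bd_push (f : X → Y) (c : SingChain X) : bd (push f c) = push f (bd c) := by
  refine LinearMap.congr_fun (hom_ext (f := bd ∘ₗ push f) (g := push f ∘ₗ bd) ?_) c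
  intro n s
  simp only [LinearMap.comp_apply, push_of]
  cases n with
  | zero => simp [bd_of_zero]
  | succ n =>
    simp only [bd_of_succ, map_sum, map_smul, push_of]
    rfl

theorem push_push (f : X → Y) (g : Y → Z) (c : SingChain X) :
    push g (push f c) = push (g ∘ f) c := by
  refine LinearMap.congr_fun (hom_ext (f := push g ∘ₗ push f) (g := push (g ∘ f)) ?_) c
  intro n w
  simp only [LinearMap.comp_apply, push_of]
  rfl

theorem push_id (c : SingChain X) : push id c = c :=
  LinearMap.congr_fun (hom_ext (f := push id) (g := LinearMap.id) fun _ _ => push_of _ _) c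

/-! ### Realization of affine chains -/

section Realize

variable [AddCommGroup E] [Module ℝ E] [AddCommGroup F] [Module ℝ F]

/-- The point of an affine simplex with the given barycentric coordinates. -/
def combo {n : ℕ} (w : Fin (n + 1) → E) (t : TopSimplex n) : E := ∑ i, t i • w i

theorem combo_mem {K : Set E} (hK : Convex ℝ K) {n : ℕ} {w : Fin (n + 1) → E}
    (hw : ∀ i, w i ∈ K) (t : TopSimplex n) : combo w t ∈ K :=
  hK.sum_mem (fun i _ => t.2.1 i) t.2.2 fun i _ => hw i

/-- The i-th barycentric coordinate vanishes on the i-th face, so the i-th vertex drops out of the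
sum. -/
theorem combo_map {n : ℕ} (w : Fin (n + 2) → E) (i : Fin (n + 2)) (t : TopSimplex n) :
    combo w (stdSimplex.map i.succAbove t) = combo (w ∘ i.succAbove) t := by
  simp only [combo, stdSimplex.map_coe, FunOnFinite.linearMap_apply_apply]
  rw [Fin.sum_univ_succAbove _ i]
  simp [Fin.succAbove_ne, Finset.sum_filter]

/-- The singular simplex obtained from an affine simplex in `E` by a function on `E`. -/
def realizeSpx (G : E → X) : (Σ n : ℕ, (Fin n → E)) → SingChain X
  | ⟨0, _⟩ => 0
  | ⟨_ + 1, w⟩ => of (G ∘ combo w)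

/-- The singular chain obtained from an affine chain in `E` by a function on `E`. -/
def realize (G : E → X) : AffineChain E →ₗ[ℤ] SingChain X :=
  Finsupp.linearCombination ℤ (realizeSpx G)

theorem realize_spx_zero (G : E → X) (w : Fin 0 → E) : realize G (spx w) = 0 := by
  simp [realize, realizeSpx]

theorem realize_spx_succ (G : E → X) {n : ℕ} (w : Fin (n + 1) → E) :
    realize G (spx w) = of (G ∘ combo w) := by
  simp [realize, realizeSpx]

theorem bd_realize (G : E → X) (c : AffineChain E) :
    bd (realize G c) = realize G (AffineChain.bd c) := by
  refine LinearMap.congr_fun (AffineChain.hom_ext (f := bd ∘ₗ realize G)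
    (g := realize G ∘ₗ AffineChain.bd) ?_) c
  intro n w
  simp only [LinearMap.comp_apply]
  rcases n with _ | _ | n
  · simp [AffineChain.bd_spx_zero, realize_spx_zero]
  -- The boundary of a vertex is the empty simplex; `realize` kills it, which turns the augmented
  -- complex into the unaugmented one.
  · rw [AffineChain.bd_spx_succ, realize_spx_succ, bd_of_zero]
    simp [realize_spx_zero]
  · rw [AffineChain.bd_spx_succ, realize_spx_succ, bd_of_succ]
    simp only [map_sum, map_smul, realize_spx_succ]
    refine Finset.sum_congr rfl fun i _ => ?_
    congr 3
    funext t
    exact congrArg G (combo_map w i t)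

theorem realize_push {a : E → F} (ha : ∀ (n : ℕ) (w : Fin (n + 1) → E) (t : TopSimplex n),
    combo (a ∘ w) t = a (combo w t)) (G : F → X) (c : AffineChain E) :
    realize G (AffineChain.push a c) = realize (G ∘ a) c := by
  refine LinearMap.congr_fun (AffineChain.hom_ext (f := realize G ∘ₗ AffineChain.push a)
    (g := realize (G ∘ a)) ?_) c
  intro n w
  simp only [LinearMap.comp_apply, AffineChain.push_spx]
  cases n with
  | zero => simp [realize_spx_zero]
  | succ n =>
    simp only [realize_spx_succ]
    exact congrArg of (funext fun t => congrArg G (ha n w t))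

theorem combo_linearMap (L : E →ₗ[ℝ] F) {n : ℕ} (w : Fin (n + 1) → E) (t : TopSimplex n) :
    combo (L ∘ w) t = L (combo w t) := by
  simp [combo]

theorem push_realize (f : X → Y) (G : E → X) (c : AffineChain E) :
    push f (realize G c) = realize (f ∘ G) c := by
  refine LinearMap.congr_fun (AffineChain.hom_ext (f := push f ∘ₗ realize G)
    (g := realize (f ∘ G)) ?_) c
  intro n w
  cases n with
  | zero => simp [realize_spx_zero]
  | succ n => simp only [LinearMap.comp_apply, realize_spx_succ, push_of]; rfl

theorem realize_congr {K : Set E} (hK : Convex ℝ K) {G G' : E → X} (h : EqOn G G' K) {m : ℕ}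
    {c : AffineChain E} (hc : c ∈ chainsIn m K) : realize G c = realize G' c := by
  rw [← sub_eq_zero, ← LinearMap.sub_apply, ← Submodule.mem_bot ℤ]
  refine AffineChain.map_mem_of_mem_chainsIn (fun w hw => ?_) hc
  rw [Submodule.mem_bot, LinearMap.sub_apply, sub_eq_zero]
  cases m with
  | zero => simp [realize_spx_zero]
  | succ n =>
    rw [realize_spx_succ, realize_spx_succ]
    exact congrArg of (funext fun t => h (combo_mem hK hw t))

/-- The tautological affine simplex in the standard simplex. -/
def vertices (n : ℕ) : Fin (n + 1) → Fin (n + 1) → ℝ := fun i => Pi.single i 1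

theorem combo_vertices {n : ℕ} (t : TopSimplex n) : combo (vertices n) t = (t : Fin (n + 1) → ℝ) := by
  funext j
  simp [combo, vertices, Finset.sum_apply, Pi.single_apply]

open scoped Classical in
/-- A retraction to the standard simplex; it is not continuous. -/
def retr (n : ℕ) (x : Fin (n + 1) → ℝ) : TopSimplex n :=
  if h : x ∈ stdSimplex ℝ (Fin (n + 1)) then ⟨x, h⟩ else Classical.arbitrary _

theorem retr_of_mem {n : ℕ} {x : Fin (n + 1) → ℝ} (hx : x ∈ stdSimplex ℝ (Fin (n + 1))) :
    retr n x = ⟨x, hx⟩ := dif_pos hx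

theorem retr_coe {n : ℕ} (t : TopSimplex n) : retr n (t : Fin (n + 1) → ℝ) = t := dif_pos t.2

theorem vertices_mem (n : ℕ) (i : Fin (n + 1)) : vertices n i ∈ stdSimplex ℝ (Fin (n + 1)) :=
  single_mem_stdSimplex ℝ i

/-- Every singular simplex is the realization of the tautological affine simplex. Identities between
operators that commute with `realize` therefore follow from their affine counterparts. -/
theorem realize_vertices {n : ℕ} (s : TopSimplex n → X) :
    realize (s ∘ retr n) (spx (vertices n)) = of s := by
  rw [realize_spx_succ]
  refine congrArg of (funext fun t => ?_)
  simp only [Function.comp_apply, combo_vertices, retr_coe]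

theorem bd_bd (c : SingChain X) : bd (bd c) = 0 := by
  refine LinearMap.congr_fun (hom_ext (f := bd ∘ₗ bd) (g := 0) ?_) c
  intro n s
  rw [LinearMap.comp_apply, ← realize_vertices, bd_realize, bd_realize, AffineChain.bd_bd, map_zero,
    LinearMap.zero_apply]

/-- An affine simplex as a linear image of the standard simplex. -/
theorem push_vertices {n : ℕ} (w : Fin (n + 1) → E) :
    AffineChain.push (Fintype.linearCombination ℝ w) (spx (vertices n)) = spx w := by
  rw [AffineChain.push_spx]
  refine congrArg spx (funext fun i => ?_)
  simp [vertices, Fintype.linearCombination_apply_single]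

/-! ### Barycentric subdivision and prisms of singular chains -/

/-- The chain homotopy between the identity and the barycentric subdivision. -/
def subdivHtpy : SingChain X →ₗ[ℤ] SingChain X :=
  Finsupp.linearCombination ℤ fun s =>
    realize (s.2 ∘ retr s.1) (AffineChain.subdivHtpy (spx (vertices s.1)))

theorem subdivHtpy_of {n : ℕ} (s : TopSimplex n → X) : subdivHtpy (of s) =
    realize (s ∘ retr n) (AffineChain.subdivHtpy (spx (vertices n))) := by
  simp [subdivHtpy]

/-- An affine simplex is a linear image of the tautological one, and subdivision commutes with
linear maps. The discontinuity of `retr` is harmless because all vertices stay in the convex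
standard simplex. -/
theorem subdivHtpy_realize (G : E → X) (c : AffineChain E) :
    subdivHtpy (realize G c) = realize G (AffineChain.subdivHtpy c) := by
  refine LinearMap.congr_fun (AffineChain.hom_ext (f := subdivHtpy ∘ₗ realize G)
    (g := realize G ∘ₗ AffineChain.subdivHtpy) ?_) c
  intro n w
  simp only [LinearMap.comp_apply]
  cases n with
  | zero => simp [realize_spx_zero, AffineChain.subdivHtpy_spx_zero]
  | succ n =>
    rw [realize_spx_succ, subdivHtpy_of, ← push_vertices w, AffineChain.subdivHtpy_push,
      realize_push fun n w t => combo_linearMap _ w t]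
    refine realize_congr (convex_stdSimplex ℝ _) ?_ (AffineChain.subdivHtpy_mem_chainsIn
      (convex_stdSimplex ℝ _) (AffineChain.spx_mem_chainsIn (vertices_mem n)))
    intro x hx
    simp only [Function.comp_apply]
    rw [retr_of_mem hx]
    rfl

/-- Barycentric subdivision of singular chains. -/
def sd : SingChain X →ₗ[ℤ] SingChain X := LinearMap.id - bd ∘ₗ subdivHtpy - subdivHtpy ∘ₗ bd

theorem sd_apply (c : SingChain X) : sd c = c - bd (subdivHtpy c) - subdivHtpy (bd c) := rfl

theorem sd_realize (G : E → X) (c : AffineChain E) :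
    sd (realize G c) = realize G (AffineChain.sd c) := by
  rw [sd_apply, AffineChain.sd_apply, subdivHtpy_realize, bd_realize, bd_realize,
    subdivHtpy_realize, map_sub, map_sub]

theorem sd_iterate_realize (G : E → X) (c : AffineChain E) (m : ℕ) :
    sd^[m] (realize G c) = realize G (AffineChain.sd^[m] c) := by
  induction m with
  | zero => rfl
  | succ m ih => rw [Function.iterate_succ_apply', ih, sd_realize, Function.iterate_succ_apply']

theorem bd_sd (c : SingChain X) : bd (sd c) = sd (bd c) := by
  simp only [sd_apply, map_sub, bd_bd, map_zero]
  abel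

/-- The prism operator of a homotopy. -/
def prism (H : X → ℝ → Y) : SingChain X →ₗ[ℤ] SingChain Y :=
  Finsupp.linearCombination ℤ fun s =>
    realize (fun p : (Fin (s.1 + 1) → ℝ) × ℝ => H (s.2 (retr s.1 p.1)) p.2)
      (AffineChain.prism (spx (vertices s.1)))

theorem prism_of (H : X → ℝ → Y) {n : ℕ} (s : TopSimplex n → X) : prism H (of s) =
    realize (fun p => H (s (retr n p.1)) p.2) (AffineChain.prism (spx (vertices n))) := by
  simp [prism]

theorem prism_realize (H : X → ℝ → Y) (G : E → X) (c : AffineChain E) :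
    prism H (realize G c) = realize (fun p : E × ℝ => H (G p.1) p.2) (AffineChain.prism c) := by
  refine LinearMap.congr_fun (AffineChain.hom_ext (f := prism H ∘ₗ realize G)
    (g := realize (fun p : E × ℝ => H (G p.1) p.2) ∘ₗ AffineChain.prism) ?_) c
  intro n w
  simp only [LinearMap.comp_apply]
  cases n with
  | zero => simp [realize_spx_zero, AffineChain.prism_spx, AffineChain.prismSimp]
  | succ n =>
    have h : ∀ (m : ℕ) (v : Fin (m + 1) → (Fin (n + 1) → ℝ) × ℝ) (t : TopSimplex m),
        combo (Prod.map (Fintype.linearCombination ℝ w) id ∘ v) t =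
          Prod.map (Fintype.linearCombination ℝ w) id (combo v t) := fun m v t =>
      Prod.ext (by simp [combo, Prod.fst_sum]) (by simp [combo, Prod.snd_sum])
    rw [realize_spx_succ, prism_of, ← push_vertices w, AffineChain.prism_push, realize_push h]
    refine realize_congr ((convex_stdSimplex ℝ _).prod (convex_Icc (0 : ℝ) 1)) ?_
      (AffineChain.prism_mem_chainsIn (AffineChain.spx_mem_chainsIn (vertices_mem n)))
    rintro ⟨x, r⟩ ⟨hx, -⟩
    simp only [Function.comp_apply]
    rw [retr_of_mem hx]
    rfl

theorem bd_prism (H : X → ℝ → Y) (c : SingChain X) : bd (prism H c) =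
    push (H · 1) c - push (H · 0) c - prism H (bd c) := by
  refine LinearMap.congr_fun (hom_ext (f := bd ∘ₗ prism H)
    (g := push (H · 1) - push (H · 0) - prism H ∘ₗ bd) ?_) c
  intro n s
  simp only [LinearMap.comp_apply, LinearMap.sub_apply]
  rw [← realize_vertices s, prism_realize, bd_realize, AffineChain.bd_prism, bd_realize,
    prism_realize, push_realize, push_realize, map_sub, map_sub, realize_push, realize_push]
  · rfl
  -- The two end inclusions of the prism respect `combo` because barycentric coordinates sum to one.
  all_goals
    intro n w t
    simp only [combo, Function.comp_apply]
    ext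
    · simp [Prod.fst_sum]
    · simp [Prod.snd_sum]

end Realize

end SingChain

end

noncomputable section

namespace SingChain

open AffineChain (spx chainsIn smallChainsIn)

variable {X Y Z : Type*} [TopologicalSpace X] [TopologicalSpace Y] [TopologicalSpace Z]

/-! ### Singular chains of subspaces -/

/-- The singular chains of the subspace `A`. -/
def chains (A : Set X) : Submodule ℤ (SingChain X) :=
  Finsupp.supported ℤ ℤ {s | Continuous s.2 ∧ ∀ t, s.2 t ∈ A}

/-- The singular chains of dimension `n` of the subspace `A`. -/
def nchains (n : ℕ) (A : Set X) : Submodule ℤ (SingChain X) :=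
  Finsupp.supported ℤ ℤ {s | s.1 = n ∧ Continuous s.2 ∧ ∀ t, s.2 t ∈ A}

theorem nchains_le_chains (n : ℕ) (A : Set X) : nchains n A ≤ chains A :=
  Finsupp.supported_mono fun _ h => h.2

theorem chains_mono {A B : Set X} (h : A ⊆ B) : chains A ≤ chains B :=
  Finsupp.supported_mono fun _ hs => ⟨hs.1, fun t => h (hs.2 t)⟩

theorem nchains_mono (n : ℕ) {A B : Set X} (h : A ⊆ B) : nchains n A ≤ nchains n B :=
  Finsupp.supported_mono fun _ hs => ⟨hs.1, hs.2.1, fun t => h (hs.2.2 t)⟩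

theorem mem_chains_inter {A B : Set X} {c : SingChain X} (hA : c ∈ chains A)
    (hB : c ∈ chains B) : c ∈ chains (A ∩ B) :=
  fun _ hs => ⟨(hA hs).1, fun t => ⟨(hA hs).2 t, (hB hs).2 t⟩⟩

theorem mem_nchains_of_mem_chains {n : ℕ} {A B : Set X} {c : SingChain X} (hA : c ∈ nchains n A)
    (hB : c ∈ chains B) : c ∈ nchains n B :=
  fun _ hs => ⟨(hA hs).1, hB hs⟩

theorem chains_empty : chains (∅ : Set X) = ⊥ := by
  rw [chains, ← Finsupp.supported_empty (α := Σ n : ℕ, (TopSimplex n → X)) (M := ℤ) (R := ℤ)]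
  congr 1
  ext s
  exact ⟨fun h => h.2 (Classical.arbitrary _), fun h => h.elim⟩

theorem nchains_empty (n : ℕ) : nchains n (∅ : Set X) = ⊥ :=
  le_bot_iff.1 (chains_empty (X := X) ▸ nchains_le_chains n ∅)

theorem of_mem_nchains {n : ℕ} {A : Set X} {s : TopSimplex n → X} (hs : Continuous s)
    (h : ∀ t, s t ∈ A) : of s ∈ nchains n A :=
  Finsupp.single_mem_supported ℤ _ ⟨rfl, hs, h⟩

theorem map_mem_of_mem_chains {M : Type*} [AddCommGroup M] {A : Set X} {N : Submodule ℤ M}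
    {f : SingChain X →ₗ[ℤ] M}
    (h : ∀ n (s : TopSimplex n → X), Continuous s → (∀ t, s t ∈ A) → f (of s) ∈ N)
    {c : SingChain X} (hc : c ∈ chains A) : f c ∈ N := by
  have hf : f = Finsupp.linearCombination ℤ fun s => f (of s.2) :=
    hom_ext fun n w => by simp
  rw [hf]
  exact Finsupp.linearCombination_mem_of_supported (fun s hs => h s.1 s.2 hs.1 hs.2) hc

theorem map_mem_of_mem_nchains {M : Type*} [AddCommGroup M] {n : ℕ} {A : Set X}
    {N : Submodule ℤ M} {f : SingChain X →ₗ[ℤ] M}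
    (h : ∀ s : TopSimplex n → X, Continuous s → (∀ t, s t ∈ A) → f (of s) ∈ N)
    {c : SingChain X} (hc : c ∈ nchains n A) : f c ∈ N := by
  have hf : f = Finsupp.linearCombination ℤ fun s => f (of s.2) :=
    hom_ext fun n w => by simp
  rw [hf]
  refine Finsupp.linearCombination_mem_of_supported ?_ hc
  rintro ⟨m, s⟩ ⟨h1, h2, h3⟩
  obtain rfl : m = n := h1
  exact h s h2 h3

theorem bd_mem_nchains {n : ℕ} {A : Set X} {c : SingChain X} (hc : c ∈ nchains (n + 1) A) :
    bd c ∈ nchains n A := by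
  refine map_mem_of_mem_nchains (fun s hs hA => ?_) hc
  rw [bd_of_succ]
  exact Submodule.sum_mem _ fun i _ => Submodule.smul_mem _ _
    (of_mem_nchains (hs.comp (stdSimplex.continuous_map _)) fun t => hA _)

theorem bd_eq_zero {A : Set X} {c : SingChain X} (hc : c ∈ nchains 0 A) : bd c = 0 := by
  rw [← Submodule.mem_bot ℤ]
  exact map_mem_of_mem_nchains (fun s _ _ => (Submodule.mem_bot ℤ).2 (bd_of_zero s)) hc

theorem bd_mem_chains {A : Set X} {c : SingChain X} (hc : c ∈ chains A) : bd c ∈ chains A := by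
  refine map_mem_of_mem_chains (fun n s hs hA => ?_) hc
  cases n with
  | zero => rw [bd_of_zero]; exact Submodule.zero_mem _
  | succ n => exact nchains_le_chains n A (bd_mem_nchains (of_mem_nchains hs hA))

theorem push_mem_nchains {f : X → Y} {A : Set X} {B : Set Y} (hf : ContinuousOn f A)
    (hAB : MapsTo f A B) {n : ℕ} {c : SingChain X} (hc : c ∈ nchains n A) :
    push f c ∈ nchains n B := by
  refine map_mem_of_mem_nchains (fun s hs hA => ?_) hc
  rw [push_of]
  exact of_mem_nchains (hf.comp_continuous hs hA) fun t => hAB (hA t)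

theorem push_mem_chains {f : X → Y} {A : Set X} {B : Set Y} (hf : ContinuousOn f A)
    (hAB : MapsTo f A B) {c : SingChain X} (hc : c ∈ chains A) : push f c ∈ chains B := by
  refine map_mem_of_mem_chains (fun n s hs hA => ?_) hc
  exact nchains_le_chains n B (push_mem_nchains hf hAB (of_mem_nchains hs hA))

theorem push_congr {f g : X → Y} {A : Set X} (h : EqOn f g A) {c : SingChain X}
    (hc : c ∈ chains A) : push f c = push g c := by
  rw [← sub_eq_zero, ← LinearMap.sub_apply, ← Submodule.mem_bot ℤ]
  refine map_mem_of_mem_chains (fun n s _ hA => ?_) hc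
  rw [Submodule.mem_bot, LinearMap.sub_apply, sub_eq_zero, push_of, push_of]
  exact congrArg of (funext fun t => h (hA t))

theorem continuous_combo {E : Type*} [AddCommGroup E] [Module ℝ E] [TopologicalSpace E]
    [ContinuousAdd E] [ContinuousSMul ℝ E] {n : ℕ} (w : Fin (n + 1) → E) :
    Continuous (combo w) := by
  unfold combo
  refine continuous_finsetSum _ fun i _ => Continuous.smul ?_ continuous_const
  exact (continuous_apply i).comp continuous_subtype_val

theorem realize_mem_nchains {E : Type*} [AddCommGroup E] [Module ℝ E] [TopologicalSpace E]
    [ContinuousAdd E] [ContinuousSMul ℝ E] {K : Set E} (hK : Convex ℝ K) {G : E → X}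
    (hG : ContinuousOn G K) {A : Set X} (hA : MapsTo G K A) {n : ℕ} {c : AffineChain E}
    (hc : c ∈ chainsIn (n + 1) K) : realize G c ∈ nchains n A := by
  refine AffineChain.map_mem_of_mem_chainsIn (fun w hw => ?_) hc
  rw [realize_spx_succ]
  exact of_mem_nchains (hG.comp_continuous (continuous_combo w) fun t => combo_mem hK hw t)
    fun t => hA (combo_mem hK hw t)

theorem continuousOn_retr (n : ℕ) : ContinuousOn (retr n) (stdSimplex ℝ (Fin (n + 1))) := by
  rw [continuousOn_iff_continuous_domRestrict]
  convert continuous_id (X := TopSimplex n) using 1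
  funext t
  exact retr_coe t

theorem subdivHtpy_mem_nchains {n : ℕ} {A : Set X} {c : SingChain X} (hc : c ∈ nchains n A) :
    subdivHtpy c ∈ nchains (n + 1) A := by
  refine map_mem_of_mem_nchains (fun s hs hA => ?_) hc
  rw [subdivHtpy_of]
  exact realize_mem_nchains (convex_stdSimplex ℝ _)
    (hs.comp_continuousOn (continuousOn_retr n)) (fun t _ => hA _)
    (AffineChain.subdivHtpy_mem_chainsIn (convex_stdSimplex ℝ _)
      (AffineChain.spx_mem_chainsIn (vertices_mem n)))

theorem subdivHtpy_mem_chains {A : Set X} {c : SingChain X} (hc : c ∈ chains A) :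
    subdivHtpy c ∈ chains A :=
  map_mem_of_mem_chains (fun n _ hs hA =>
    nchains_le_chains (n + 1) A (subdivHtpy_mem_nchains (of_mem_nchains hs hA))) hc

theorem subdivHtpy_bd_mem_nchains {n : ℕ} {A : Set X} {c : SingChain X} (hc : c ∈ nchains n A) :
    subdivHtpy (bd c) ∈ nchains n A := by
  cases n with
  | zero => rw [bd_eq_zero hc, map_zero]; exact Submodule.zero_mem _
  | succ n => exact subdivHtpy_mem_nchains (bd_mem_nchains hc)

theorem sd_mem_nchains {n : ℕ} {A : Set X} {c : SingChain X} (hc : c ∈ nchains n A) :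
    sd c ∈ nchains n A :=
  Submodule.sub_mem _ (Submodule.sub_mem _ hc (bd_mem_nchains (subdivHtpy_mem_nchains hc)))
    (subdivHtpy_bd_mem_nchains hc)

theorem sd_mem_chains {A : Set X} {c : SingChain X} (hc : c ∈ chains A) : sd c ∈ chains A :=
  Submodule.sub_mem _ (Submodule.sub_mem _ hc (bd_mem_chains (subdivHtpy_mem_chains hc)))
    (subdivHtpy_mem_chains (bd_mem_chains hc))

theorem prism_mem_nchains {H : X → ℝ → Y} {A : Set X} {B : Set Y}
    (hH : ContinuousOn (fun p : X × ℝ => H p.1 p.2) (A ×ˢ Icc 0 1))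
    (hAB : ∀ x ∈ A, ∀ r ∈ Icc (0 : ℝ) 1, H x r ∈ B) {n : ℕ} {c : SingChain X}
    (hc : c ∈ nchains n A) : prism H c ∈ nchains (n + 1) B := by
  refine map_mem_of_mem_nchains (fun s hs hA => ?_) hc
  rw [prism_of]
  refine realize_mem_nchains ((convex_stdSimplex ℝ _).prod (convex_Icc (0 : ℝ) 1)) ?_
    (fun p hp => hAB _ (hA _) _ hp.2)
    (AffineChain.prism_mem_chainsIn (AffineChain.spx_mem_chainsIn (vertices_mem n)))
  refine hH.comp (f := fun p : (Fin (n + 1) → ℝ) × ℝ => (s (retr n p.1), p.2)) ?_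
    fun p hp => ⟨hA _, hp.2⟩
  exact ((hs.comp_continuousOn (continuousOn_retr n)).comp continuousOn_fst
    fun p hp => hp.1).prodMk continuousOn_snd

theorem prism_bd_mem_nchains {H : X → ℝ → Y} {A : Set X} {B : Set Y}
    (hH : ContinuousOn (fun p : X × ℝ => H p.1 p.2) (A ×ˢ Icc 0 1))
    (hAB : ∀ x ∈ A, ∀ r ∈ Icc (0 : ℝ) 1, H x r ∈ B) {n : ℕ} {A' : Set X} {c : SingChain X}
    (hc : c ∈ nchains n A') (hbc : bd c ∈ chains A) : prism H (bd c) ∈ nchains n B := by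
  cases n with
  | zero => rw [bd_eq_zero hc, map_zero]; exact Submodule.zero_mem _
  | succ n => exact prism_mem_nchains hH hAB (mem_nchains_of_mem_chains (bd_mem_nchains hc) hbc)

/-! ### Small chains -/

/-- Pull the cover back to the standard simplex and take a Lebesgue number: pieces of smaller
diameter are sent into one of the two open sets. -/
theorem exists_sd_pow_of_mem {n : ℕ} {A U V : Set X} (hU : IsOpen U) (hV : IsOpen V)
    (hA : A ⊆ U ∪ V) {s : TopSimplex n → X} (hs : Continuous s) (hsA : ∀ t, s t ∈ A) :
    ∃ m₀, ∀ m ≥ m₀, sd^[m] (of s) ∈ nchains n (A ∩ U) ⊔ nchains n (A ∩ V) := by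
  obtain ⟨δ, hδ, hball⟩ := lebesgue_number_lemma_of_metric (s := (univ : Set (TopSimplex n)))
    (c := fun b : Bool => s ⁻¹' (cond b U V)) isCompact_univ
    (fun b => by cases b; exacts [hV.preimage hs, hU.preimage hs])
    (fun t _ => mem_iUnion.2 (by
      rcases hA (hsA t) with h | h
      exacts [⟨true, h⟩, ⟨false, h⟩]))
  have hK := convex_stdSimplex ℝ (Fin (n + 1))
  have hv : spx (vertices n) ∈ smallChainsIn (n + 1) (stdSimplex ℝ (Fin (n + 1)))
      (Metric.diam (stdSimplex ℝ (Fin (n + 1)))) :=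
    AffineChain.spx_mem_smallChainsIn (vertices_mem n) fun i j =>
      Metric.dist_le_diam_of_mem (bounded_stdSimplex _) (vertices_mem n i) (vertices_mem n j)
  obtain ⟨m₀, hm₀⟩ := AffineChain.exists_sd_iterate_mem hK hv (half_pos hδ)
  refine ⟨m₀, fun m hm => ?_⟩
  rw [← realize_vertices s, sd_iterate_realize]
  refine AffineChain.map_mem_of_mem_smallChainsIn (fun w hw hw' => ?_) (hm₀ m hm)
  -- The closed ball of radius δ/2 about a vertex is convex, contains the whole small simplex and
  -- lies in the open ball of radius δ given by the Lebesgue lemma.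
  set K : Set (Fin (n + 1) → ℝ) := stdSimplex ℝ (Fin (n + 1)) ∩ closedBall (w 0) (δ / 2) with hKdef
  have hKc : Convex ℝ K := hK.inter (convex_closedBall _ _)
  have hwK : spx w ∈ chainsIn (n + 1) K :=
    AffineChain.spx_mem_chainsIn fun i => ⟨hw i, hw' i 0⟩
  obtain ⟨b, hb⟩ := hball ⟨w 0, hw 0⟩ (mem_univ _)
  have hmaps : MapsTo (s ∘ retr n) K (A ∩ cond b U V) := by
    rintro x ⟨hx, hxb⟩
    refine ⟨hsA _, hb ?_⟩
    rw [retr_of_mem hx, mem_ball, Subtype.dist_eq]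
    exact lt_of_le_of_lt (mem_closedBall.1 hxb) (half_lt_self hδ)
  have hmem := realize_mem_nchains hKc
    ((hs.comp_continuousOn (continuousOn_retr n)).mono inter_subset_left) hmaps hwK
  cases b with
  | true => exact Submodule.mem_sup_left hmem
  | false => exact Submodule.mem_sup_right hmem

theorem sd_iterate_eq (m : ℕ) (c : SingChain X) :
    sd^[m] c = ((sd : Module.End ℤ (SingChain X)) ^ m) c :=
  (Module.End.pow_apply _ _ _).symm

theorem exists_sd_pow_mem {n : ℕ} {A U V : Set X} (hU : IsOpen U) (hV : IsOpen V)
    (hA : A ⊆ U ∪ V) {c : SingChain X} (hc : c ∈ nchains n A) :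
    ∃ m₀, ∀ m ≥ m₀, sd^[m] c ∈ nchains n (A ∩ U) ⊔ nchains n (A ∩ V) := by
  rw [nchains, Finsupp.supported_eq_span_single] at hc
  induction hc using Submodule.span_induction with
  | mem x hx =>
    obtain ⟨⟨k, s⟩, ⟨h1, h2, h3⟩, rfl⟩ := hx
    obtain rfl : k = n := h1
    exact exists_sd_pow_of_mem hU hV hA h2 h3
  | zero => exact ⟨0, fun m _ => by rw [sd_iterate_eq, map_zero]; exact Submodule.zero_mem _⟩
  | add x y _ _ hx hy =>
    obtain ⟨a, ha⟩ := hx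
    obtain ⟨b, hb⟩ := hy
    refine ⟨max a b, fun m hm => ?_⟩
    rw [sd_iterate_eq, map_add, ← sd_iterate_eq, ← sd_iterate_eq]
    exact Submodule.add_mem _ (ha m (le_of_max_le_left hm)) (hb m (le_of_max_le_right hm))
  | smul z x _ hx =>
    obtain ⟨a, ha⟩ := hx
    refine ⟨a, fun m hm => ?_⟩
    rw [sd_iterate_eq, map_smul, ← sd_iterate_eq]
    exact Submodule.smul_mem _ _ (ha m hm)

/-! ### Relative homology -/

/-- The relative cycles of the pair `(A, B)`. -/
def cycles (n : ℕ) (A B : Set X) : Submodule ℤ (SingChain X) :=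
  nchains n A ⊓ (chains B).comap bd

/-- The relative boundaries of the pair `(A, B)`. -/
def bounds (n : ℕ) (A B : Set X) : Submodule ℤ (SingChain X) :=
  (nchains (n + 1) A).map bd ⊔ nchains n B

theorem mem_bounds {n : ℕ} {A B : Set X} {c : SingChain X} :
    c ∈ bounds n A B ↔ ∃ y ∈ nchains (n + 1) A, ∃ b ∈ nchains n B, bd y + b = c := by
  simp [bounds, Submodule.mem_sup]

theorem bd_mem_bounds {n : ℕ} {A : Set X} (B : Set X) {y : SingChain X}
    (hy : y ∈ nchains (n + 1) A) : bd y ∈ bounds n A B :=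
  Submodule.mem_sup_left ⟨y, hy, rfl⟩

theorem mem_bounds_of_mem {n : ℕ} (A : Set X) {B : Set X} {b : SingChain X}
    (hb : b ∈ nchains n B) : b ∈ bounds n A B :=
  Submodule.mem_sup_right hb

theorem cycles_zero (A B : Set X) : cycles 0 A B = nchains 0 A :=
  le_antisymm inf_le_left fun c hc => ⟨hc, by
    rw [SetLike.mem_coe, Submodule.mem_comap, bd_eq_zero hc]; exact Submodule.zero_mem _⟩

end SingChain

open SingChain

section RelHomology

variable {X Y Z : Type*} [TopologicalSpace X] [TopologicalSpace Y] [TopologicalSpace Z]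

/-- The relative singular homology of the pair `(A, B)` of subspaces of `X`. -/
def RelH (n : ℕ) (A B : Set X) : Type _ :=
  cycles n A B ⧸ (bounds n A B).submoduleOf (cycles n A B)

instance (n : ℕ) (A B : Set X) : AddCommGroup (RelH n A B) :=
  inferInstanceAs (AddCommGroup (cycles n A B ⧸ (bounds n A B).submoduleOf (cycles n A B)))

namespace RelH

/-- The homology class of a cycle. -/
def mk {n : ℕ} {A B : Set X} (z : SingChain X) (hz : z ∈ cycles n A B) : RelH n A B :=
  Submodule.Quotient.mk (p := (bounds n A B).submoduleOf (cycles n A B)) ⟨z, hz⟩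

theorem mk_eq_mk {n : ℕ} {A B : Set X} {z w : SingChain X} {hz : z ∈ cycles n A B}
    {hw : w ∈ cycles n A B} : mk z hz = mk w hw ↔ z - w ∈ bounds n A B :=
  Submodule.Quotient.eq (p := (bounds n A B).submoduleOf (cycles n A B)) (x := ⟨z, hz⟩)

theorem mk_eq_zero {n : ℕ} {A B : Set X} {z : SingChain X} {hz : z ∈ cycles n A B} :
    mk z hz = 0 ↔ z ∈ bounds n A B :=
  (mk_eq_mk (hw := Submodule.zero_mem _)).trans (by rw [sub_zero])

theorem exists_mk {n : ℕ} {A B : Set X} (x : RelH n A B) : ∃ z hz, x = mk z hz := by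
  obtain ⟨⟨z, hz⟩, rfl⟩ := Submodule.Quotient.mk_surjective _ x
  exact ⟨z, hz, rfl⟩

/-- The map in homology induced by a linear map of chains. -/
def hmap (g : SingChain X →ₗ[ℤ] SingChain Y) {n m : ℕ} {A B : Set X} {A' B' : Set Y}
    (hZ : ∀ z ∈ cycles n A B, g z ∈ cycles m A' B')
    (hB : ∀ z ∈ bounds n A B, g z ∈ bounds m A' B') : RelH n A B →ₗ[ℤ] RelH m A' B' :=
  Submodule.mapQ ((bounds n A B).submoduleOf (cycles n A B))
    ((bounds m A' B').submoduleOf (cycles m A' B')) (g.restrict hZ) fun z hz => hB z.1 hz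

end RelH

/-- A function that restricts to a continuous map of pairs from `(A, B)` to `(A', B')`. -/
structure PairMap (f : X → Y) (A B : Set X) (A' B' : Set Y) : Prop where
  continuousOn_left : ContinuousOn f A
  continuousOn_right : ContinuousOn f B
  mapsTo_left : MapsTo f A A'
  mapsTo_right : MapsTo f B B'

theorem PairMap.incl {A B A' B' : Set X} (hA : A ⊆ A') (hB : B ⊆ B') : PairMap id A B A' B' :=
  ⟨continuousOn_id, continuousOn_id, hA, hB⟩

theorem PairMap.comp {f : X → Y} {g : Y → Z} {A B : Set X} {A' B' : Set Y} {A'' B'' : Set Z}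
    (hg : PairMap g A' B' A'' B'') (hf : PairMap f A B A' B') : PairMap (g ∘ f) A B A'' B'' :=
  ⟨hg.1.comp hf.1 hf.3, hg.2.comp hf.2 hf.4, hg.3.comp hf.3, hg.4.comp hf.4⟩

namespace RelH

/-- The map in relative homology induced by a continuous map of pairs. -/
def map {f : X → Y} {A B : Set X} {A' B' : Set Y} (hf : PairMap f A B A' B') (n : ℕ) :
    RelH n A B →ₗ[ℤ] RelH n A' B' :=
  hmap (push f)
    (fun z hz => ⟨push_mem_nchains hf.1 hf.3 hz.1, by
      rw [SetLike.mem_coe, Submodule.mem_comap, bd_push]; exact push_mem_chains hf.2 hf.4 hz.2⟩)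
    (by
      intro z hz
      obtain ⟨y, hy, b, hb, rfl⟩ := mem_bounds.1 hz
      rw [map_add, ← bd_push]
      exact Submodule.add_mem _ (bd_mem_bounds _ (push_mem_nchains hf.1 hf.3 hy))
        (mem_bounds_of_mem _ (push_mem_nchains hf.2 hf.4 hb)))

theorem map_mem_cycles {f : X → Y} {A B : Set X} {A' B' : Set Y} (hf : PairMap f A B A' B')
    {n : ℕ} {z : SingChain X} (hz : z ∈ cycles n A B) : push f z ∈ cycles n A' B' :=
  ⟨push_mem_nchains hf.1 hf.3 hz.1, by
    rw [SetLike.mem_coe, Submodule.mem_comap, bd_push]; exact push_mem_chains hf.2 hf.4 hz.2⟩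

theorem map_mk {f : X → Y} {A B : Set X} {A' B' : Set Y} (hf : PairMap f A B A' B')
    {n : ℕ} {z : SingChain X} (hz : z ∈ cycles n A B) :
    map hf n (mk z hz) = mk (push f z) (map_mem_cycles hf hz) := rfl

theorem map_map {f : X → Y} {g : Y → Z} {A B : Set X} {A' B' : Set Y} {A'' B'' : Set Z}
    (hg : PairMap g A' B' A'' B'') (hf : PairMap f A B A' B') {n : ℕ} (x : RelH n A B) :
    map hg n (map hf n x) = map (hg.comp hf) n x := by
  obtain ⟨z, hz, rfl⟩ := exists_mk x
  simp only [map_mk, push_push]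

theorem map_congr {f g : X → Y} {A B : Set X} {A' B' : Set Y} (hf : PairMap f A B A' B')
    (hg : PairMap g A B A' B') (h : EqOn f g A) {n : ℕ} (x : RelH n A B) :
    map hf n x = map hg n x := by
  obtain ⟨z, hz, rfl⟩ := exists_mk x
  simp only [map_mk, push_congr h (nchains_le_chains n A hz.1)]

theorem map_id_apply {A B : Set X} (h : PairMap id A B A B) {n : ℕ} (x : RelH n A B) :
    map h n x = x := by
  obtain ⟨z, hz, rfl⟩ := exists_mk x
  simp only [map_mk, push_id]

/-- On a relative cycle the prism formula leaves the boundary of a prism plus the prism of the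
boundary. The latter lies in `B'` because the homotopy carries `B` into `B'`. -/
theorem map_eq_of_homotopy {f g : X → Y} {A B : Set X} {A' B' : Set Y}
    (hf : PairMap f A B A' B') (hg : PairMap g A B A' B') (hBA : B ⊆ A) (H : X → ℝ → Y)
    (hH : ContinuousOn (fun p : X × ℝ => H p.1 p.2) (A ×ˢ Icc 0 1))
    (hA : ∀ x ∈ A, ∀ r ∈ Icc (0 : ℝ) 1, H x r ∈ A')
    (hB : ∀ x ∈ B, ∀ r ∈ Icc (0 : ℝ) 1, H x r ∈ B')
    (h0 : ∀ x ∈ A, H x 0 = f x) (h1 : ∀ x ∈ A, H x 1 = g x) {n : ℕ} (x : RelH n A B) :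
    map hf n x = map hg n x := by
  obtain ⟨z, hz, rfl⟩ := exists_mk x
  have hzA := nchains_le_chains n A hz.1
  rw [eq_comm, map_mk, map_mk, mk_eq_mk, ← push_congr (f := (H · 0)) h0 hzA,
    ← push_congr (f := (H · 1)) h1 hzA]
  have h := bd_prism H z
  rw [eq_sub_iff_add_eq] at h
  rw [← h]
  exact Submodule.add_mem _ (bd_mem_bounds _ (prism_mem_nchains hH hA hz.1))
    (mem_bounds_of_mem _ (prism_bd_mem_nchains (hH.mono (prod_mono hBA subset_rfl)) hB hz.1 hz.2))

/-- A pair that can be deformed into its subspace has trivial homology. -/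
theorem subsingleton_of_homotopy {A B : Set X} (hBA : B ⊆ A) (H : X → ℝ → X)
    (hH : ContinuousOn (fun p : X × ℝ => H p.1 p.2) (A ×ˢ Icc 0 1))
    (hA : ∀ x ∈ A, ∀ r ∈ Icc (0 : ℝ) 1, H x r ∈ A)
    (hB : ∀ x ∈ B, ∀ r ∈ Icc (0 : ℝ) 1, H x r ∈ B)
    (h0 : ∀ x ∈ A, H x 0 = x) (h1 : ∀ x ∈ A, H x 1 ∈ B) (n : ℕ) : Subsingleton (RelH n A B) := by
  refine subsingleton_of_forall_eq 0 fun x => ?_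
  have hI : (1 : ℝ) ∈ Icc (0 : ℝ) 1 := ⟨zero_le_one, le_rfl⟩
  have hc : ContinuousOn (H · 1) A :=
    hH.comp (f := fun x => (x, (1 : ℝ))) (by fun_prop) fun x hx => ⟨hx, hI⟩
  have hg : PairMap (H · 1) A B A B :=
    ⟨hc, hc.mono hBA, fun x hx => hA x hx 1 hI, fun x hx => hB x hx 1 hI⟩
  rw [← map_id_apply (PairMap.incl subset_rfl subset_rfl) x,
    map_eq_of_homotopy (PairMap.incl subset_rfl subset_rfl) hg hBA H hH hA hB h0 fun _ _ => rfl]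
  obtain ⟨z, hz, rfl⟩ := exists_mk x
  rw [map_mk, mk_eq_zero]
  exact mem_bounds_of_mem _ (push_mem_nchains hc h1 hz.1)

/-! ### The long exact sequence of a triple -/

/-- The connecting homomorphism of a triple. -/
def δ (A : Set X) {B C : Set X} (n : ℕ) : RelH (n + 1) A B →ₗ[ℤ] RelH n B C :=
  hmap bd
    (fun z hz => ⟨mem_nchains_of_mem_chains (bd_mem_nchains hz.1) hz.2, by
      rw [SetLike.mem_coe, Submodule.mem_comap, bd_bd]; exact Submodule.zero_mem _⟩)
    (by
      intro z hz
      obtain ⟨y, hy, b, hb, rfl⟩ := mem_bounds.1 hz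
      rw [map_add, bd_bd, zero_add]
      exact bd_mem_bounds _ hb)

theorem bd_mem_cycles {A B C : Set X} {n : ℕ} {z : SingChain X} (hz : z ∈ cycles (n + 1) A B) :
    bd z ∈ cycles n B C :=
  ⟨mem_nchains_of_mem_chains (bd_mem_nchains hz.1) hz.2, by
      rw [SetLike.mem_coe, Submodule.mem_comap, bd_bd]; exact Submodule.zero_mem _⟩

theorem δ_mk {A B C : Set X} {n : ℕ} {z : SingChain X} (hz : z ∈ cycles (n + 1) A B) :
    δ A (C := C) n (mk z hz) = mk (bd z) (bd_mem_cycles hz) := rfl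

/-- If z = ∂y + b with b in `B`, then b has the same boundary as z, so it is a cycle relative to
`C`, and it represents the class of z. -/
theorem exact_incl_incl {A B C : Set X} (hBA : B ⊆ A) (hCB : C ⊆ B) (n : ℕ) :
    Function.Exact (map (PairMap.incl hBA (subset_rfl : C ⊆ C)) n)
      (map (PairMap.incl (subset_rfl : A ⊆ A) hCB) n) := by
  intro x
  constructor
  · intro hx
    obtain ⟨z, hz, rfl⟩ := exists_mk x
    rw [map_mk, mk_eq_zero, push_id] at hx
    obtain ⟨y, hy, b, hb, hyb⟩ := mem_bounds.1 hx
    have hb' : b ∈ cycles n B C := ⟨hb, by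
      have : bd b = bd z := by rw [← hyb, map_add, bd_bd, zero_add]
      rw [SetLike.mem_coe, Submodule.mem_comap, this]
      exact hz.2⟩
    refine ⟨mk b hb', ?_⟩
    rw [map_mk, mk_eq_mk, push_id, ← hyb, sub_add_cancel_right]
    exact Submodule.neg_mem _ (bd_mem_bounds _ hy)
  · rintro ⟨y, rfl⟩
    obtain ⟨z, hz, rfl⟩ := exists_mk y
    rw [map_mk, map_mk, mk_eq_zero, push_id, push_id]
    exact mem_bounds_of_mem _ hz.1

/-- If ∂z equals ∂y + b with y in `B` and b in `C`, then z - y is a cycle relative to `C` that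
agrees with z modulo `B`. -/
theorem exact_incl_δ {A B C : Set X} (hBA : B ⊆ A) (hCB : C ⊆ B) (n : ℕ) :
    Function.Exact (map (PairMap.incl (subset_rfl : A ⊆ A) hCB) (n + 1)) (δ A (C := C) n) := by
  intro x
  constructor
  · intro hx
    obtain ⟨z, hz, rfl⟩ := exists_mk x
    rw [δ_mk, mk_eq_zero] at hx
    obtain ⟨y, hy, b, hb, hyb⟩ := mem_bounds.1 hx
    have hzy : z - y ∈ cycles (n + 1) A C :=
      ⟨Submodule.sub_mem _ hz.1 (nchains_mono _ hBA hy), by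
        rw [SetLike.mem_coe, Submodule.mem_comap, map_sub, ← hyb, add_sub_cancel_left]
        exact nchains_le_chains _ _ hb⟩
    refine ⟨mk (z - y) hzy, ?_⟩
    rw [map_mk, mk_eq_mk, push_id, sub_sub_cancel_left]
    exact Submodule.neg_mem _ (mem_bounds_of_mem _ hy)
  · rintro ⟨y, rfl⟩
    obtain ⟨z, hz, rfl⟩ := exists_mk y
    rw [map_mk, δ_mk, mk_eq_zero, push_id]
    exact mem_bounds_of_mem _ (mem_nchains_of_mem_chains (bd_mem_nchains hz.1) hz.2)

theorem exact_δ_incl {A B C : Set X} (hBA : B ⊆ A) (hCB : C ⊆ B) (n : ℕ) :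
    Function.Exact (δ A (C := C) n) (map (PairMap.incl hBA (subset_rfl : C ⊆ C)) n) := by
  intro x
  constructor
  · intro hx
    obtain ⟨z, hz, rfl⟩ := exists_mk x
    rw [map_mk, mk_eq_zero, push_id] at hx
    obtain ⟨y, hy, b, hb, hyb⟩ := mem_bounds.1 hx
    have hy' : y ∈ cycles (n + 1) A B := ⟨hy, by
      rw [SetLike.mem_coe, Submodule.mem_comap, eq_sub_of_add_eq hyb]
      exact Submodule.sub_mem _ (nchains_le_chains _ _ hz.1)
        (chains_mono hCB (nchains_le_chains _ _ hb))⟩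
    refine ⟨mk y hy', ?_⟩
    rw [δ_mk, mk_eq_mk, ← hyb, sub_add_cancel_left]
    exact Submodule.neg_mem _ (mem_bounds_of_mem _ hb)
  · rintro ⟨y, rfl⟩
    obtain ⟨z, hz, rfl⟩ := exists_mk y
    rw [δ_mk, map_mk, mk_eq_zero, push_id]
    exact bd_mem_bounds _ hz.1

theorem surjective_incl_zero {A B C : Set X} (hCB : C ⊆ B) :
    Function.Surjective (map (PairMap.incl (subset_rfl : A ⊆ A) hCB) 0) := by
  intro x
  obtain ⟨z, hz, rfl⟩ := exists_mk x
  have hz' : z ∈ cycles 0 A C := by rw [cycles_zero]; exact hz.1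
  exact ⟨mk z hz', by simp only [map_mk, push_id]⟩

theorem δ_map {f : X → Y} {A B C : Set X} {A' B' C' : Set Y} (hf : PairMap f A B A' B')
    (hf' : PairMap f B C B' C') {n : ℕ} (x : RelH (n + 1) A B) :
    δ A' n (map hf (n + 1) x) = map hf' n (δ A n x) := by
  obtain ⟨z, hz, rfl⟩ := exists_mk x
  simp only [map_mk, δ_mk, bd_push]

/-! ### Excision -/

theorem sub_sd_mem_bounds {n : ℕ} {A B : Set X} {z : SingChain X} (hz : z ∈ cycles n A B) :
    z - sd z ∈ bounds n A B := by
  have h : z - sd z = bd (subdivHtpy z) + subdivHtpy (bd z) := by rw [sd_apply]; abel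
  rw [h]
  exact Submodule.add_mem _ (bd_mem_bounds _ (subdivHtpy_mem_nchains hz.1))
    (mem_bounds_of_mem _ (mem_nchains_of_mem_chains (subdivHtpy_bd_mem_nchains hz.1)
      (subdivHtpy_mem_chains hz.2)))

theorem sd_mem_cycles {n : ℕ} {A B : Set X} {z : SingChain X} (hz : z ∈ cycles n A B) :
    sd z ∈ cycles n A B :=
  ⟨sd_mem_nchains hz.1, by rw [SetLike.mem_coe, Submodule.mem_comap, bd_sd]; exact sd_mem_chains hz.2⟩

theorem sd_iterate_mem_cycles {n : ℕ} {A B : Set X} {z : SingChain X} (hz : z ∈ cycles n A B)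
    (m : ℕ) : sd^[m] z ∈ cycles n A B := by
  induction m with
  | zero => exact hz
  | succ m ih => rw [Function.iterate_succ_apply']; exact sd_mem_cycles ih

theorem sub_sd_iterate_mem_bounds {n : ℕ} {A B : Set X} {z : SingChain X}
    (hz : z ∈ cycles n A B) (m : ℕ) : z - sd^[m] z ∈ bounds n A B := by
  induction m with
  | zero => rw [Function.iterate_zero_apply, sub_self]; exact Submodule.zero_mem _
  | succ m ih =>
    rw [Function.iterate_succ_apply']
    have h := Submodule.add_mem _ ih (sub_sd_mem_bounds (sd_iterate_mem_cycles hz m))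
    rwa [sub_add_sub_cancel] at h

theorem bd_sd_iterate (m : ℕ) (c : SingChain X) : bd (sd^[m] c) = sd^[m] (bd c) := by
  induction m with
  | zero => rfl
  | succ m ih => rw [Function.iterate_succ_apply', bd_sd, ih, Function.iterate_succ_apply']

theorem sd_iterate_mem_nchains {n : ℕ} {A : Set X} {c : SingChain X} (hc : c ∈ nchains n A)
    (m : ℕ) : sd^[m] c ∈ nchains n A := by
  induction m with
  | zero => exact hc
  | succ m ih => rw [Function.iterate_succ_apply']; exact sd_mem_nchains ih

/-- After enough subdivisions a chain splits into a part in `U` and a part in `V`. For surjectivity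
a cycle is split and its `U`-part discarded; for injectivity the bounding chain is split. -/
theorem excision {A U V : Set X} (hU : IsOpen U) (hV : IsOpen V) (hA : A ⊆ U ∪ V) (n : ℕ) :
    Function.Bijective (map (PairMap.incl (inter_subset_left : A ∩ V ⊆ A)
      (inter_subset_right : (A ∩ V) ∩ (A ∩ U) ⊆ A ∩ U)) n) := by
  constructor
  · rw [injective_iff_map_eq_zero]
    intro x hx
    obtain ⟨v, hv, rfl⟩ := exists_mk x
    rw [map_mk, mk_eq_zero, push_id] at hx
    obtain ⟨y, hy, u, hu, hyu⟩ := mem_bounds.1 hx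
    obtain ⟨m, hm⟩ := exists_sd_pow_mem hU hV hA hy
    obtain ⟨yU, hyU, yV, hyV, hyy⟩ := Submodule.mem_sup.1 (hm m le_rfl)
    -- This makes the left side minus ∂yV a chain both of `A ∩ V` and of `A ∩ U`, hence of the
    -- intersection.
    have h1 : sd^[m] v = bd yV + (bd yU + sd^[m] u) := by
      rw [← hyu, sd_iterate_eq, map_add, ← sd_iterate_eq, ← sd_iterate_eq, ← bd_sd_iterate, ← hyy,
        map_add]
      abel
    have h2 : sd^[m] v - bd yV ∈ nchains n ((A ∩ V) ∩ (A ∩ U)) := by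
      have hV' : sd^[m] v - bd yV ∈ nchains n (A ∩ V) :=
        Submodule.sub_mem _ (sd_iterate_mem_nchains hv.1 m) (bd_mem_nchains hyV)
      refine mem_nchains_of_mem_chains hV' (mem_chains_inter (nchains_le_chains _ _ hV') ?_)
      rw [h1, add_sub_cancel_left]
      exact nchains_le_chains n _ (Submodule.add_mem _ (bd_mem_nchains hyU)
        (sd_iterate_mem_nchains hu m))
    rw [mk_eq_zero]
    have h3 := Submodule.add_mem _ (sub_sd_iterate_mem_bounds hv m)
      (Submodule.add_mem _ (mem_bounds_of_mem (A ∩ V) h2) (bd_mem_bounds _ hyV))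
    rwa [sub_add_cancel, sub_add_cancel] at h3
  · intro x
    obtain ⟨z, hz, rfl⟩ := exists_mk x
    obtain ⟨m, hm⟩ := exists_sd_pow_mem hU hV hA hz.1
    obtain ⟨u, hu, v, hv, huv⟩ := Submodule.mem_sup.1 (hm m le_rfl)
    have hv' : v ∈ cycles n (A ∩ V) ((A ∩ V) ∩ (A ∩ U)) := by
      refine ⟨hv, mem_chains_inter (bd_mem_chains (nchains_le_chains _ _ hv)) ?_⟩
      rw [eq_sub_of_add_eq' huv, map_sub]
      exact Submodule.sub_mem _ (sd_iterate_mem_cycles hz m).2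
        (bd_mem_chains (nchains_le_chains _ _ hu))
    refine ⟨mk v hv', ?_⟩
    rw [map_mk, eq_comm, mk_eq_mk, push_id]
    have h := Submodule.add_mem _ (sub_sd_iterate_mem_bounds hz m) (mem_bounds_of_mem A hu)
    rwa [← huv, ← sub_sub, sub_right_comm, sub_add_cancel] at h

/-! ### The homology of a point -/

theorem nchains_singleton (n : ℕ) (x : X) : nchains n {x} =
    Submodule.span ℤ {of fun _ : TopSimplex n => x} := by
  apply le_antisymm
  · intro c hc
    refine map_mem_of_mem_nchains (f := LinearMap.id) (fun s _ hs => ?_) hc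
    obtain rfl : s = fun _ => x := funext hs
    exact Submodule.mem_span_singleton_self _
  · rw [Submodule.span_singleton_le_iff_mem]
    exact of_mem_nchains continuous_const fun _ => rfl

/-- The n + 2 faces coincide and carry alternating signs, so they cancel exactly when n is even. -/
theorem bd_of_const (n : ℕ) (x : X) : bd (of fun _ : TopSimplex (n + 1) => x) =
    if Even n then 0 else of fun _ : TopSimplex n => x := by
  rw [bd_of_succ]
  simp only [Function.comp_def]
  rw [← Finset.sum_smul, Fin.sum_neg_one_pow]
  have : Even (n + 2) ↔ Even n := by simp [parity_simps]
  simp only [this]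
  split_ifs <;> simp

theorem subsingleton_singleton (n : ℕ) (x : X) :
    Subsingleton (RelH (n + 1) ({x} : Set X) ∅) := by
  refine subsingleton_of_forall_eq 0 fun h => ?_
  obtain ⟨z, hz, rfl⟩ := exists_mk h
  rw [mk_eq_zero]
  have hz1 : z ∈ nchains (n + 1) {x} := hz.1
  have hz2 : bd z ∈ chains ∅ := hz.2
  rw [nchains_singleton, Submodule.mem_span_singleton] at hz1
  rw [chains_empty, Submodule.mem_bot] at hz2
  obtain ⟨a, rfl⟩ := hz1
  by_cases hn : Even n
  · have h1 := bd_of_const (n + 1) x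
    rw [if_neg (by simpa [parity_simps] using hn)] at h1
    rw [← h1, ← map_smul]
    exact bd_mem_bounds _ (Submodule.smul_mem _ _ (of_mem_nchains continuous_const fun _ => rfl))
  · rw [map_smul, bd_of_const, if_neg hn, Finsupp.smul_single, Finsupp.single_eq_zero] at hz2
    rw [show a = 0 by simpa using hz2, zero_smul]
    exact Submodule.zero_mem _

theorem nonempty_equiv_singleton (x : X) : Nonempty (RelH 0 ({x} : Set X) ∅ ≃ₗ[ℤ] ℤ) := by
  have hx : (of fun _ : TopSimplex 0 => x) ∈ cycles 0 {x} ∅ := by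
    rw [cycles_zero]
    exact of_mem_nchains continuous_const fun _ => rfl
  refine ⟨(LinearEquiv.ofBijective (LinearMap.toSpanSingleton ℤ (RelH 0 ({x} : Set X) ∅)
    (mk _ hx)) ⟨?_, ?_⟩).symm⟩
  · rw [injective_iff_map_eq_zero]
    intro a ha
    change mk (a • of fun _ : TopSimplex 0 => x) (Submodule.smul_mem _ a hx) = 0 at ha
    rw [mk_eq_zero, mem_bounds] at ha
    obtain ⟨y, hy, b, hb, h⟩ := ha
    rw [nchains_singleton, Submodule.mem_span_singleton] at hy
    rw [nchains_empty, Submodule.mem_bot] at hb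
    obtain ⟨e, rfl⟩ := hy
    rw [map_smul, bd_of_const, hb, if_pos Even.zero, smul_zero, add_zero, Finsupp.smul_single] at h
    simpa using (Finsupp.single_eq_zero.1 h.symm)
  · intro h
    obtain ⟨z, hz, rfl⟩ := exists_mk h
    have hz1 : z ∈ nchains 0 {x} := hz.1
    rw [nchains_singleton, Submodule.mem_span_singleton] at hz1
    obtain ⟨a, rfl⟩ := hz1
    exact ⟨a, rfl⟩

end RelH

end RelHomology

end

noncomputable section

/-! ### Comparison with the singular homology of Mathlib -/

section Comparison

open CategoryTheory Limits SingChain Simplicial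

/-- The singular simplicial chain complex, with integer coefficients. -/
abbrev singComplex (A : TopCat.{u}) : ChainComplex (ModuleCat.{u} ℤ) ℕ :=
  (TopCat.toSSet.obj A).chainComplex (ModuleCat.of ℤ (ULift.{u} ℤ))

/-- The function on the standard simplex given by a simplex of the singular simplicial set. -/
def simplexFun {A : TopCat.{u}} {n : ℕ} (x : (TopCat.toSSet.obj A) _⦋n⦌) : TopSimplex n → A :=
  TopCat.toSSetObjEquiv A (.op ⦋n⦌) x

theorem continuous_simplexFun {A : TopCat.{u}} {n : ℕ} (x : (TopCat.toSSet.obj A) _⦋n⦌) :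
    Continuous (simplexFun x) := (TopCat.toSSetObjEquiv A (.op ⦋n⦌) x).continuous

theorem simplexFun_injective {A : TopCat.{u}} {n : ℕ} :
    Function.Injective (simplexFun (A := A) (n := n)) := fun _ _ h =>
  (TopCat.toSSetObjEquiv A (.op ⦋n⦌)).injective (DFunLike.coe_injective h)

theorem exists_simplexFun_eq {A : TopCat.{u}} {n : ℕ} {s : TopSimplex n → A} (hs : Continuous s) :
    ∃ x : (TopCat.toSSet.obj A) _⦋n⦌, simplexFun x = s :=
  ⟨(TopCat.toSSetObjEquiv A (.op ⦋n⦌)).symm ⟨s, hs⟩, by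
    rw [simplexFun, Equiv.apply_symm_apply]; rfl⟩

theorem simplexFun_δ {A : TopCat.{u}} {n : ℕ} (x : (TopCat.toSSet.obj A) _⦋n + 1⦌)
    (i : Fin (n + 2)) : simplexFun ((TopCat.toSSet.obj A).δ i x) =
      simplexFun x ∘ stdSimplex.map i.succAbove := rfl

theorem simplexFun_map {A B : TopCat.{u}} (f : A ⟶ B) {n : ℕ}
    (x : (TopCat.toSSet.obj A) _⦋n⦌) :
    simplexFun ((TopCat.toSSet.map f).app _ x) = f ∘ simplexFun x := rfl

/-- The comparison map from abstract to concrete singular chains. -/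
def toSingChain (A : TopCat.{u}) (n : ℕ) :
    (singComplex A).X n ⟶ ModuleCat.of ℤ (SingChain A) :=
  Cofan.IsColimit.desc ((TopCat.toSSet.obj A).isColimitChainComplexXCofan _ n) fun x =>
    ModuleCat.ofHom ((LinearMap.toSpanSingleton ℤ (SingChain A) (of (simplexFun x))) ∘ₗ
      (ULift.moduleEquiv : ULift.{u} ℤ ≃ₗ[ℤ] ℤ).toLinearMap)

theorem ι_toSingChain (A : TopCat.{u}) (n : ℕ) (x : (TopCat.toSSet.obj A) _⦋n⦌) :
    SSet.ιChainComplex _ x ≫ toSingChain A n = ModuleCat.ofHom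
      ((LinearMap.toSpanSingleton ℤ (SingChain A) (of (simplexFun x))) ∘ₗ
        (ULift.moduleEquiv : ULift.{u} ℤ ≃ₗ[ℤ] ℤ).toLinearMap) :=
  Cofan.IsColimit.fac ((TopCat.toSSet.obj A).isColimitChainComplexXCofan _ n) _ x

/-- The generator of the abstract singular chains given by a singular simplex. -/
def singGen {A : TopCat.{u}} {n : ℕ} (x : (TopCat.toSSet.obj A) _⦋n⦌) : (singComplex A).X n :=
  ((TopCat.toSSet.obj A).ιChainComplex (R := ModuleCat.of ℤ (ULift.{u} ℤ)) x).hom (ULift.up 1)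

theorem toSingChain_singGen {A : TopCat.{u}} {n : ℕ} (x : (TopCat.toSSet.obj A) _⦋n⦌) :
    (toSingChain A n).hom (singGen x) = of (simplexFun x) := by
  refine (congrArg (fun f => f.hom (ULift.up 1)) (ι_toSingChain A n x)).trans ?_
  simp

/-- The chain group is a coproduct of copies of the coefficients indexed by the simplices, so maps
out of it are determined on the generators `singGen`. -/
theorem singComplex_hom_ext {A : TopCat.{u}} {n : ℕ} {T : ModuleCat.{u} ℤ}
    {f g : (singComplex A).X n ⟶ T} (h : ∀ x, f.hom (singGen x) = g.hom (singGen x)) : f = g := by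
  apply SSet.chainComplex_hom_ext
  intro x
  refine ModuleCat.hom_ext (LinearMap.ext fun a => ?_)
  let e : ℤ →ₗ[ℤ] ULift.{u} ℤ := (ULift.moduleEquiv : ULift.{u} ℤ ≃ₗ[ℤ] ℤ).symm.toLinearMap
  let F : ULift.{u} ℤ →ₗ[ℤ] T := (SSet.ιChainComplex _ x ≫ f).hom
  let G : ULift.{u} ℤ →ₗ[ℤ] T := (SSet.ιChainComplex _ x ≫ g).hom
  have h' : F ∘ₗ e = G ∘ₗ e := LinearMap.ext_ring (h x)
  exact LinearMap.congr_fun h' a.down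

theorem d_singGen {A : TopCat.{u}} {n : ℕ} (x : (TopCat.toSSet.obj A) _⦋n + 1⦌) :
    ((singComplex A).d (n + 1) n).hom (singGen x) =
      ∑ i : Fin (n + 2), (-1 : ℤ) ^ (i : ℕ) • singGen ((TopCat.toSSet.obj A).δ i x) := by
  have h := congrArg (fun f => f.hom (ULift.up.{u} (1 : ℤ)))
    (SSet.ιChainComplex_d (TopCat.toSSet.obj A) (R := ModuleCat.of ℤ (ULift.{u} ℤ)) x)
  refine h.trans ?_
  rw [ModuleCat.hom_sum, LinearMap.sum_apply]
  rfl

theorem toSingChain_d {A : TopCat.{u}} {n : ℕ} (c : (singComplex A).X (n + 1)) :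
    (toSingChain A n).hom (((singComplex A).d (n + 1) n).hom c) =
      bd ((toSingChain A (n + 1)).hom c) := by
  have h : (singComplex A).d (n + 1) n ≫ toSingChain A n =
      toSingChain A (n + 1) ≫ ModuleCat.ofHom bd := by
    apply singComplex_hom_ext
    intro x
    rw [ModuleCat.hom_comp, ModuleCat.hom_comp, LinearMap.comp_apply, LinearMap.comp_apply,
      toSingChain_singGen, ModuleCat.hom_ofHom, bd_of_succ, d_singGen, map_sum]
    refine Finset.sum_congr rfl fun i _ => ?_
    rw [map_zsmul, toSingChain_singGen, simplexFun_δ]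
  exact congrArg (fun f => f.hom c) h

theorem toSingChain_map {A B : TopCat.{u}} (f : A ⟶ B) {n : ℕ} (c : (singComplex A).X n) :
    (toSingChain B n).hom (((SSet.chainComplexMap (TopCat.toSSet.map f)
      (ModuleCat.of ℤ (ULift.{u} ℤ))).f n).hom c) = push f ((toSingChain A n).hom c) := by
  have h : (SSet.chainComplexMap (TopCat.toSSet.map f) (ModuleCat.of ℤ (ULift.{u} ℤ))).f n ≫
      toSingChain B n = toSingChain A n ≫ ModuleCat.ofHom (push f) := by
    apply singComplex_hom_ext
    intro x
    have h1 := congrArg (fun f => f.hom (ULift.up.{u} (1 : ℤ)))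
      (SSet.ι_chainComplexMap_f _ _ (TopCat.toSSet.map f) (R := ModuleCat.of ℤ (ULift.{u} ℤ)) x)
    have h2 : ((SSet.chainComplexMap (TopCat.toSSet.map f) (ModuleCat.of ℤ (ULift.{u} ℤ))).f n).hom
      (singGen x) = singGen ((TopCat.toSSet.map f).app _ x) := h1
    rw [ModuleCat.hom_comp, ModuleCat.hom_comp, LinearMap.comp_apply, LinearMap.comp_apply, h2,
      toSingChain_singGen, toSingChain_singGen, ModuleCat.hom_ofHom, push_of, simplexFun_map]
  exact congrArg (fun f => f.hom c) h

/-- A one-sided inverse of the comparison map. -/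
def ofSingChain (A : TopCat.{u}) (n : ℕ) : SingChain A →ₗ[ℤ] (singComplex A).X n :=
  Finsupp.linearCombination ℤ (Function.extend
    (fun x : (TopCat.toSSet.obj A) _⦋n⦌ => (⟨n, simplexFun x⟩ : Σ n, (TopSimplex n → A))) singGen 0)

theorem ofSingChain_toSingChain {A : TopCat.{u}} {n : ℕ} (c : (singComplex A).X n) :
    ofSingChain A n ((toSingChain A n).hom c) = c := by
  have h : toSingChain A n ≫ ModuleCat.ofHom (ofSingChain A n) = 𝟙 _ := by
    apply singComplex_hom_ext
    intro x
    have hinj : Function.Injective (fun x : (TopCat.toSSet.obj A) _⦋n⦌ =>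
        (⟨n, simplexFun x⟩ : Σ n, (TopSimplex n → A))) := fun x y h =>
      simplexFun_injective (by simpa using h)
    rw [ModuleCat.hom_comp, LinearMap.comp_apply, toSingChain_singGen, ModuleCat.hom_ofHom]
    simp only [ofSingChain, Finsupp.linearCombination_single]
    exact (@one_smul ℤ _ _ ((singComplex A).X n).isModule.toMulAction _).trans (hinj.extend_apply _ _ _)
  exact congrArg (fun f => f.hom c) h

theorem toSingChain_mem {A : TopCat.{u}} {n : ℕ} (c : (singComplex A).X n) :
    (toSingChain A n).hom c ∈ nchains n (univ : Set A) := by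
  have h : toSingChain A n ≫ ModuleCat.ofHom (nchains n (univ : Set A)).mkQ = 0 := by
    apply singComplex_hom_ext
    intro x
    rw [ModuleCat.hom_comp, LinearMap.comp_apply, toSingChain_singGen, ModuleCat.hom_ofHom,
      ModuleCat.hom_zero, LinearMap.zero_apply, Submodule.mkQ_apply, Submodule.Quotient.mk_eq_zero]
    exact of_mem_nchains (continuous_simplexFun x) fun _ => mem_univ _
  have h' := congrArg (fun f => f.hom c) h
  exact (Submodule.Quotient.mk_eq_zero _).1 h'

theorem exists_toSingChain_eq {A : TopCat.{u}} {n : ℕ} {c : SingChain A}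
    (hc : c ∈ nchains n (univ : Set A)) : ∃ d, (toSingChain A n).hom d = c := by
  refine map_mem_of_mem_nchains (f := LinearMap.id) (N := LinearMap.range (toSingChain A n).hom)
    (fun s hs _ => ?_) hc
  obtain ⟨x, rfl⟩ := exists_simplexFun_eq hs
  exact ⟨singGen x, toSingChain_singGen x⟩

theorem d_eq_zero_iff {A : TopCat.{u}} {n : ℕ} (c : (singComplex A).X n) :
    ((singComplex A).d n ((ComplexShape.down ℕ).next n)).hom c = 0 ↔
      (toSingChain A n).hom c ∈ cycles n (univ : Set A) ∅ := by
  have h0 : (toSingChain A n).hom c ∈ cycles n (univ : Set A) ∅ ↔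
      bd ((toSingChain A n).hom c) = 0 := by
    rw [← Submodule.mem_bot ℤ, ← chains_empty]
    exact ⟨fun h => h.2, fun h => ⟨toSingChain_mem c, h⟩⟩
  rw [h0]
  cases n with
  | zero =>
    rw [bd_eq_zero (toSingChain_mem c), HomologicalComplex.shape]
    · simp
    · simp
  | succ n =>
    rw [ChainComplex.next_nat_succ, ← toSingChain_d]
    constructor
    · intro h
      rw [h, map_zero]
    · intro h
      rw [← ofSingChain_toSingChain (((singComplex A).d (n + 1) n).hom c), h, map_zero]

/-- The homomorphism from the integers given by an element. -/
def elemHom {M : ModuleCat.{u} ℤ} (c : M) : ModuleCat.of ℤ (ULift.{u} ℤ) ⟶ M :=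
  ModuleCat.ofHom ((LinearMap.toSpanSingleton ℤ M c) ∘ₗ
    (ULift.moduleEquiv : ULift.{u} ℤ ≃ₗ[ℤ] ℤ).toLinearMap)

theorem elemHom_one {M : ModuleCat.{u} ℤ} (c : M) : (elemHom c).hom (ULift.up 1) = c := by
  simp only [elemHom, ModuleCat.hom_ofHom]
  exact @one_smul ℤ _ _ M.isModule.toMulAction c

theorem elemHom_comp {M N : ModuleCat.{u} ℤ} {f : M ⟶ N} {c : M} (h : f.hom c = 0) :
    elemHom c ≫ f = 0 := by
  refine ModuleCat.hom_ext (LinearMap.ext fun a => ?_)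
  simp [elemHom, h]

/-- The comparison map on cycles. -/
def cyclesToRelH (A : TopCat.{u}) (n : ℕ) :
    (singComplex A).cycles n ⟶ ModuleCat.of ℤ (RelH n (univ : Set A) ∅) :=
  ModuleCat.ofHom (((bounds n (univ : Set A) ∅).submoduleOf (cycles n univ ∅)).mkQ ∘ₗ
    (((toSingChain A n).hom ∘ₗ ((singComplex A).iCycles n).hom).codRestrict
      (cycles n (univ : Set A) ∅) fun z => (d_eq_zero_iff _).1 (by
        have := congrArg (fun f => f.hom z)
          ((singComplex A).iCycles_d n ((ComplexShape.down ℕ).next n))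
        exact this)))

theorem cyclesToRelH_apply (A : TopCat.{u}) (n : ℕ) (z : (singComplex A).cycles n) :
    ∃ h, (cyclesToRelH A n).hom z =
      RelH.mk ((toSingChain A n).hom (((singComplex A).iCycles n).hom z)) h :=
  ⟨(d_eq_zero_iff _).1 (by
        have := congrArg (fun f => f.hom z)
          ((singComplex A).iCycles_d n ((ComplexShape.down ℕ).next n))
        exact this), rfl⟩

/-- One direction lets the comparison map descend to homology, the other makes the descended map
injective. -/
theorem cyclesToRelH_eq_zero (A : TopCat.{u}) (n : ℕ) (z : (singComplex A).cycles n) :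
    (cyclesToRelH A n).hom z = 0 ↔ ∃ y, ((singComplex A).toCycles (n + 1) n).hom y = z := by
  have hd : ∀ y, ((singComplex A).iCycles n).hom (((singComplex A).toCycles (n + 1) n).hom y) =
      ((singComplex A).d (n + 1) n).hom y := fun y =>
    congrArg (fun f => f.hom y) ((singComplex A).toCycles_i (n + 1) n)
  obtain ⟨h, hz⟩ := cyclesToRelH_apply A n z
  rw [hz, RelH.mk_eq_zero, mem_bounds]
  constructor
  · rintro ⟨y, hy, b, hb, hyb⟩
    rw [nchains_empty, Submodule.mem_bot] at hb
    obtain ⟨y, rfl⟩ := exists_toSingChain_eq hy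
    refine ⟨y, ?_⟩
    have hinj : Function.Injective ((singComplex A).iCycles n).hom :=
      (ModuleCat.mono_iff_injective _).1 inferInstance
    apply hinj
    rw [hd, ← ofSingChain_toSingChain (((singComplex A).iCycles n).hom z), ← hyb, hb, add_zero,
      ← toSingChain_d, ofSingChain_toSingChain]
  · rintro ⟨y, rfl⟩
    refine ⟨_, toSingChain_mem y, 0, Submodule.zero_mem _, ?_⟩
    rw [hd, toSingChain_d, add_zero]

/-- The comparison map in homology. -/
def homologyToRelH (A : TopCat.{u}) (n : ℕ) :
    (singComplex A).homology n ⟶ ModuleCat.of ℤ (RelH n (univ : Set A) ∅) :=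
  (((singComplex A).homologyIsCokernel (n + 1) n (by simp)).desc
    (CokernelCofork.ofπ (cyclesToRelH A n) (by
      ext y
      exact (cyclesToRelH_eq_zero A n _).2 ⟨y, rfl⟩)))

theorem homologyToRelH_π (A : TopCat.{u}) (n : ℕ) (z : (singComplex A).cycles n) :
    (homologyToRelH A n).hom (((singComplex A).homologyπ n).hom z) = (cyclesToRelH A n).hom z :=
  have h : (singComplex A).homologyπ n ≫ homologyToRelH A n = cyclesToRelH A n :=
    Cofork.IsColimit.π_desc ((singComplex A).homologyIsCokernel (n + 1) n (by simp))
  congrArg (fun f => f.hom z) h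

theorem homologyπ_surjective (A : TopCat.{u}) (n : ℕ) :
    Function.Surjective ((singComplex A).homologyπ n).hom :=
  (ModuleCat.epi_iff_surjective _).1 inferInstance

theorem homologyToRelH_bijective (A : TopCat.{u}) (n : ℕ) :
    Function.Bijective (homologyToRelH A n).hom := by
  constructor
  · rw [injective_iff_map_eq_zero]
    intro x hx
    obtain ⟨z, rfl⟩ := homologyπ_surjective A n x
    rw [homologyToRelH_π, cyclesToRelH_eq_zero] at hx
    obtain ⟨y, rfl⟩ := hx
    exact congrArg (fun f => f.hom y) ((singComplex A).toCycles_comp_homologyπ (n + 1) n)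
  · intro x
    obtain ⟨z, hz, rfl⟩ := RelH.exists_mk x
    obtain ⟨c, rfl⟩ := exists_toSingChain_eq hz.1
    have hc := (d_eq_zero_iff c).2 hz
    have hk := elemHom_comp hc
    -- A cycle is regarded as a morphism from the integers, so that the universal property of the
    -- cycle object lifts it.
    let l := (singComplex A).liftCycles (elemHom c) _ rfl hk
    have hl : ((singComplex A).iCycles n).hom (l.hom (ULift.up 1)) = c := by
      refine (congrArg (fun f => f.hom (ULift.up.{u} (1 : ℤ)))
        ((singComplex A).liftCycles_i (elemHom c) _ rfl hk)).trans ?_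
      exact elemHom_one c
    refine ⟨((singComplex A).homologyπ n).hom (l.hom (ULift.up 1)), ?_⟩
    rw [homologyToRelH_π]
    obtain ⟨h, hz'⟩ := cyclesToRelH_apply A n (l.hom (ULift.up 1))
    rw [hz']
    congr 1
    rw [hl]

theorem homologyToRelH_map {A B : TopCat.{u}} (f : A ⟶ B) (n : ℕ)
    (hf : PairMap f (univ : Set A) ∅ (univ : Set B) ∅) (x : (singComplex A).homology n) :
    (homologyToRelH B n).hom ((HomologicalComplex.homologyMap (SSet.chainComplexMap
      (TopCat.toSSet.map f) (ModuleCat.of ℤ (ULift.{u} ℤ))) n).hom x) =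
      RelH.map hf n ((homologyToRelH A n).hom x) := by
  obtain ⟨z, rfl⟩ := homologyπ_surjective A n x
  set φ := SSet.chainComplexMap (TopCat.toSSet.map f) (ModuleCat.of ℤ (ULift.{u} ℤ))
  have h1 : (HomologicalComplex.homologyMap φ n).hom (((singComplex A).homologyπ n).hom z) =
      ((singComplex B).homologyπ n).hom ((HomologicalComplex.cyclesMap φ n).hom z) :=
    congrArg (fun f => f.hom z) (HomologicalComplex.homologyπ_naturality φ n)
  have h2 : ((singComplex B).iCycles n).hom ((HomologicalComplex.cyclesMap φ n).hom z) =
      (φ.f n).hom (((singComplex A).iCycles n).hom z) :=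
    congrArg (fun f => f.hom z) (HomologicalComplex.cyclesMap_i φ n)
  rw [h1, homologyToRelH_π, homologyToRelH_π]
  obtain ⟨h, hz⟩ := cyclesToRelH_apply A n z
  obtain ⟨h', hz'⟩ := cyclesToRelH_apply B n ((HomologicalComplex.cyclesMap φ n).hom z)
  rw [hz, hz', RelH.map_mk]
  congr 1
  rw [h2]
  exact toSingChain_map f _

/-! ### Homology of a subspace computed in the ambient space -/

variable {X : Type u} [TopologicalSpace X]

theorem pairMap_val (A : Set X) : PairMap (Subtype.val : A → X) univ ∅ A ∅ :=
  ⟨continuous_subtype_val.continuousOn, continuousOn_empty _, fun x _ => x.2, mapsTo_empty _ _⟩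

/-- Already on chains, composition with the inclusion identifies the chains of the subspace with
those chains of the ambient space that are supported in it. -/
theorem RelH.bijective_map_val (n : ℕ) (A : Set X) : Function.Bijective
    (RelH.map (pairMap_val A) n) := by
  have hlift : ∀ {m : ℕ} {c : SingChain X}, c ∈ nchains m A →
      ∃ d ∈ nchains m (univ : Set A), push Subtype.val d = c := by
    intro m c hc
    refine map_mem_of_mem_nchains (f := LinearMap.id)
      (N := (nchains m (univ : Set A)).map (push Subtype.val)) (fun s hs hA => ?_) hc
    exact ⟨of fun t => ⟨s t, hA t⟩, of_mem_nchains (hs.subtype_mk _) fun _ => mem_univ _,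
      push_of _ _⟩
  have hinj : Function.Injective (push (Subtype.val : A → X)) := by
    refine Finsupp.mapDomain_injective ?_
    rintro ⟨n, s⟩ ⟨m, t⟩ h
    rw [Sigma.mk.injEq] at h
    obtain ⟨rfl, h⟩ := h
    rw [heq_eq_eq] at h
    congr 1
    funext x
    exact Subtype.ext (congrFun h x)
  constructor
  · rw [injective_iff_map_eq_zero]
    intro x hx
    obtain ⟨z, hz, rfl⟩ := RelH.exists_mk x
    rw [RelH.map_mk, RelH.mk_eq_zero, mem_bounds] at hx
    obtain ⟨y, hy, b, hb, h⟩ := hx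
    obtain ⟨y, hy', rfl⟩ := hlift hy
    rw [nchains_empty, Submodule.mem_bot] at hb
    rw [hb, add_zero, bd_push] at h
    rw [RelH.mk_eq_zero, ← hinj h]
    exact bd_mem_bounds _ hy'
  · intro x
    obtain ⟨z, hz, rfl⟩ := RelH.exists_mk x
    obtain ⟨w, hw, rfl⟩ := hlift hz.1
    refine ⟨RelH.mk w ⟨hw, ?_⟩, rfl⟩
    have h2 : bd (push Subtype.val w) ∈ chains (∅ : Set X) := hz.2
    rw [chains_empty, Submodule.mem_bot, bd_push] at h2
    have h3 := hinj (h2.trans (map_zero _).symm)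
    rw [SetLike.mem_coe, Submodule.mem_comap, h3]
    exact Submodule.zero_mem _

/-- The singular homology of a subspace is the concrete one. -/
def singHEquiv (n : ℕ) (A : Set X) : singH n A ≃ₗ[ℤ] RelH n A ∅ :=
  (LinearEquiv.ofBijective (homologyToRelH (TopCat.of A) n).hom
    (homologyToRelH_bijective (TopCat.of A) n)).trans
    (LinearEquiv.ofBijective _ (RelH.bijective_map_val n A))

/-- The constant map to a one-point space. -/
theorem pairMap_toPoint (A : Set X) :
    PairMap (fun _ : X => PUnit.unit.{u + 1}) A ∅ univ ∅ :=
  ⟨continuousOn_const, continuousOn_const, fun _ _ => mem_univ _, mapsTo_empty _ _⟩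

/-- Naturality of the comparison with respect to the map to a point carries reduced classes to the
concrete model. -/
theorem mem_redSingH_iff (n : ℕ) (A : Set X) (x : singH n A) :
    x ∈ redSingH n A ↔ RelH.map (pairMap_toPoint A) n (singHEquiv n A x) = 0 := by
  have h := homologyToRelH_map (A := TopCat.of A) (B := TopCat.of PUnit.{u + 1})
    (TopCat.ofHom (ContinuousMap.const A PUnit.unit)) n
    ⟨continuousOn_const, continuousOn_const, fun _ _ => mem_univ _, mapsTo_empty _ _⟩ x
  have h' : RelH.map (pairMap_toPoint A) n (singHEquiv n A x) =
      (homologyToRelH (TopCat.of PUnit.{u + 1}) n).hom ((singHToPoint n A).hom x) :=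
    (RelH.map_map _ (pairMap_val A) _).trans h.symm
  rw [h', redSingH, LinearMap.mem_ker]
  exact ((homologyToRelH_bijective (TopCat.of PUnit.{u + 1}) n).1.eq_iff' (map_zero _)).symm

end Comparison

end

noncomputable section

/-! ### Local homology of Euclidean space -/

namespace RelH

variable {X Y Z : Type*} [TopologicalSpace X] [TopologicalSpace Y] [TopologicalSpace Z]

theorem bijective_of_inverse {f : X → Y} {g : Y → X} {A B : Set X} {A' B' : Set Y}
    (hf : PairMap f A B A' B') (hg : PairMap g A' B' A B) {n : ℕ}
    (h₁ : ∀ x, map (hg.comp hf) n x = x) (h₂ : ∀ y, map (hf.comp hg) n y = y) :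
    Function.Bijective (map hf n) :=
  Function.bijective_iff_has_inverse.2 ⟨map hg n, fun x => by rw [map_map, h₁],
    fun y => by rw [map_map, h₂]⟩

/-- The homology of the pair `(A, B)` is infinite cyclic in degree `n` and zero otherwise. -/
def Concentrated (n : ℕ) (A B : Set X) : Prop :=
  (∀ j, j ≠ n → Subsingleton (RelH j A B)) ∧ Nonempty (RelH n A B ≃ₗ[ℤ] ℤ)

theorem Concentrated.of_equiv {n : ℕ} {A B : Set X} {A' B' : Set Y} (h : Concentrated n A B)
    (e : ∀ j, Nonempty (RelH j A B ≃ₗ[ℤ] RelH j A' B')) : Concentrated n A' B' := by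
  refine ⟨fun j hj => ?_, ?_⟩
  · have := h.1 j hj
    exact (e j).some.symm.toEquiv.subsingleton
  · exact ⟨(e n).some.symm.trans h.2.some⟩

theorem nonempty_equiv {f : X → Y} {A B : Set X} {A' B' : Set Y}
    {hf : PairMap f A B A' B'} {n : ℕ} (h : Function.Bijective (map hf n)) :
    Nonempty (RelH n A B ≃ₗ[ℤ] RelH n A' B') := ⟨LinearEquiv.ofBijective _ h⟩

/-- In the long exact sequence of the triple, every third group vanishes. -/
theorem bijective_δ {A B C : Set X} (hBA : B ⊆ A) (hCB : C ⊆ B)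
    (h : ∀ n, Subsingleton (RelH n A C)) (n : ℕ) : Function.Bijective (δ A (B := B) (C := C) n) := by
  constructor
  · rw [injective_iff_map_eq_zero]
    intro x hx
    obtain ⟨y, rfl⟩ := (exact_incl_δ hBA hCB n x).1 hx
    rw [Subsingleton.elim y 0, map_zero]
  · exact fun y => (exact_δ_incl hBA hCB n y).1 (Subsingleton.elim _ _)

theorem bijective_incl_of_subsingleton {A B C : Set X} (hBA : B ⊆ A) (hCB : C ⊆ B)
    (h : ∀ n, Subsingleton (RelH n B C)) (n : ℕ) :
    Function.Bijective (map (PairMap.incl (subset_rfl : A ⊆ A) hCB) n) := by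
  constructor
  · rw [injective_iff_map_eq_zero]
    intro x hx
    obtain ⟨y, rfl⟩ := (exact_incl_incl hBA hCB n x).1 hx
    rw [Subsingleton.elim y 0, map_zero]
  · cases n with
    | zero => exact surjective_incl_zero hCB
    | succ n => exact fun y => (exact_incl_δ hBA hCB n y).1 (Subsingleton.elim _ _)

/-- Let `U` and `V` be the complements of the closed rays along the negative and the positive first
axis. Then H_{j+1}(ℝⁿ⁺¹, P) ≅ H_j(P, U), as the pair (ℝⁿ⁺¹, U) is acyclic; excision replaces this by
H_j(V, V ∩ U), and forgetting the first coordinate by H_j(ℝⁿ, ℝⁿ ∖ 0). -/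
theorem concentrated_succ {n : ℕ} (h : Concentrated n (univ : Set (Fin n → ℝ)) {0}ᶜ) :
    Concentrated (n + 1) (univ : Set (Fin (n + 1) → ℝ)) {0}ᶜ := by
  set P : Set (Fin (n + 1) → ℝ) := {0}ᶜ with hP
  set U : Set (Fin (n + 1) → ℝ) := {x | 0 < x 0} ∪ {x | Fin.tail x ≠ 0} with hU
  set V : Set (Fin (n + 1) → ℝ) := {x | x 0 < 0} ∪ {x | Fin.tail x ≠ 0} with hV
  have htail : Continuous (Fin.tail : (Fin (n + 1) → ℝ) → Fin n → ℝ) :=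
    continuous_pi fun i => continuous_apply i.succ
  have ht : IsOpen {x : Fin (n + 1) → ℝ | Fin.tail x ≠ 0} := isOpen_ne.preimage htail
  have hUo : IsOpen U := (isOpen_lt continuous_const (continuous_apply 0)).union ht
  have hVo : IsOpen V := (isOpen_lt (continuous_apply 0) continuous_const).union ht
  have hUP : U ⊆ P := by
    rintro x (hx | hx) rfl
    · exact lt_irrefl (0 : ℝ) hx
    · exact hx rfl
  have hVP : V ⊆ P := by
    rintro x (hx | hx) rfl
    · exact lt_irrefl (0 : ℝ) hx
    · exact hx rfl
  have hPUV : P ⊆ U ∪ V := by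
    intro x hx
    by_cases h1 : Fin.tail x = 0
    · have h0 : x 0 ≠ 0 := by
        intro h0
        apply hx
        rw [mem_singleton_iff, ← Fin.cons_self_tail x, h1, h0]
        exact funext fun i => Fin.cases rfl (fun _ => rfl) i
      rcases lt_or_gt_of_ne h0 with h0 | h0
      · exact Or.inr (Or.inl h0)
      · exact Or.inl (Or.inl h0)
    · exact Or.inl (Or.inr h1)
  have hUU : ∀ j, Subsingleton (RelH j (univ : Set (Fin (n + 1) → ℝ)) U) := by
    -- `U` is star-shaped about the point (1, 0), so straight lines contract both spaces at once.
    refine fun j => subsingleton_of_homotopy (subset_univ U)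
      (fun x t => (1 - t) • x + t • (Fin.cons 1 0 : Fin (n + 1) → ℝ)) (by fun_prop)
      (fun _ _ _ _ => mem_univ _) ?_
      (fun x _ => by simp) (fun x _ => Or.inl (by simp)) j
    rintro x hx t ⟨h0, h1⟩
    rcases hx with hx | hx
    · refine Or.inl ?_
      have hx' : 0 < x 0 := hx
      simp only [mem_ofPred_eq, Pi.add_apply, Pi.smul_apply, smul_eq_mul, Fin.cons_zero, mul_one]
      rcases h0.eq_or_lt with rfl | h0
      · simpa using hx'
      · nlinarith
    · rcases h1.lt_or_eq with h1 | rfl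
      · refine Or.inr ?_
        have : Fin.tail ((1 - t) • x + t • (Fin.cons 1 0 : Fin (n + 1) → ℝ)) =
            (1 - t) • Fin.tail x := by
          ext i
          simp [Fin.tail]
        rw [mem_ofPred_eq, this, Ne, smul_eq_zero, not_or]
        exact ⟨by linarith, hx⟩
      · exact Or.inl (by simp)
  have hex : ∀ j, Nonempty (RelH j V (V ∩ U) ≃ₗ[ℤ] RelH j P U) := by
    intro j
    have := nonempty_equiv (excision hUo hVo hPUV j)
    rwa [inter_eq_self_of_subset_right hVP, inter_eq_self_of_subset_right hUP] at this
  have htl : ∀ x ∈ V ∩ U, Fin.tail x ≠ 0 := by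
    rintro x ⟨hx | hx, hx' | hx'⟩
    · exact absurd (show x 0 < 0 from hx) (lt_asymm (show 0 < x 0 from hx'))
    all_goals assumption
  have hpt : PairMap Fin.tail V (V ∩ U) (univ : Set (Fin n → ℝ)) {0}ᶜ :=
    ⟨htail.continuousOn, htail.continuousOn, fun _ _ => mem_univ _, htl⟩
  have hps : PairMap (fun x => Fin.cons (-1) x) (univ : Set (Fin n → ℝ)) {0}ᶜ V (V ∩ U) := by
    have : Continuous fun x : Fin n → ℝ => (Fin.cons (-1) x : Fin (n + 1) → ℝ) := by fun_prop
    exact ⟨this.continuousOn, this.continuousOn, fun x _ => Or.inl (by simp),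
      fun x hx => ⟨Or.inr hx, Or.inr hx⟩⟩
  -- Sliding the first coordinate linearly to -1 retracts `V` onto a copy of ℝⁿ; the intersection
  -- with `U` is where the tail is nonzero, which the slide preserves.
  have hbij : ∀ j, Function.Bijective (map hpt j) := by
    refine fun j => bijective_of_inverse hpt hps (fun x => ?_) (fun y => ?_)
    · rw [← map_eq_of_homotopy (PairMap.incl subset_rfl subset_rfl) (hps.comp hpt)
        inter_subset_left (fun x t => Fin.cons ((1 - t) * x 0 - t) (Fin.tail x)) ?_ ?_ ?_ ?_ ?_ x,
        map_id_apply]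
      · refine Continuous.continuousOn ?_
        have := htail.comp (continuous_fst (X := Fin (n + 1) → ℝ) (Y := ℝ))
        exact Continuous.finCons (by fun_prop) this
      · rintro x (hx | hx) t ⟨h0, h1⟩
        · refine Or.inl ?_
          have hx' : x 0 < 0 := hx
          simp only [mem_ofPred_eq, Fin.cons_zero]
          rcases h0.eq_or_lt with rfl | h0
          · simpa using hx'
          · nlinarith
        · exact Or.inr hx
      · exact fun x hx t _ => ⟨Or.inr (htl x hx), Or.inr (htl x hx)⟩
      · intro x _
        simp
      · intro x _
        simp
    · rw [map_congr (hpt.comp hps) (PairMap.incl subset_rfl subset_rfl) (fun x _ => rfl), map_id_apply]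
  have hPU : Concentrated n P U :=
    h.of_equiv fun j => ⟨(nonempty_equiv (hbij j)).some.symm.trans (hex j).some⟩
  have hδ := bijective_δ (subset_univ P) hUP hUU
  refine ⟨fun j hj => ?_, ?_⟩
  · cases j with
    | zero =>
      have := hUU 0
      exact (surjective_incl_zero (A := univ) hUP).subsingleton
    | succ j =>
      have := hPU.1 j (by lia)
      exact (hδ j).1.subsingleton
  · exact ⟨(LinearEquiv.ofBijective _ (hδ n)).trans hPU.2.some⟩

/-- The local homology of Euclidean space. -/
theorem concentrated_euclidean (n : ℕ) : Concentrated n (univ : Set (Fin n → ℝ)) {0}ᶜ := by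
  induction n with
  | zero =>
    have h1 : (univ : Set (Fin 0 → ℝ)) = {0} := eq_singleton_iff_unique_mem.2 ⟨mem_univ _, fun _ _ => Subsingleton.elim _ _⟩
    rw [h1, ← h1, compl_univ, h1]
    refine ⟨fun j hj => ?_, nonempty_equiv_singleton _⟩
    obtain ⟨j, rfl⟩ := Nat.exists_eq_succ_of_ne_zero hj
    exact subsingleton_singleton j _
  | succ n ih => exact concentrated_succ ih

end RelH

end

noncomputable section

/-! ### Attaching a cell -/

section Attaching

variable {X Y Z : Type*} [TopologicalSpace X] [TopologicalSpace Y] [TopologicalSpace Z]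

/-- A continuous map from a compact set to a Hausdorff space is closed, so it is a quotient map onto
its image and continuity may be tested upstairs. -/
theorem continuousOn_image_of_isCompact [T2Space X] {φ : Z → X} {K : Set Z} (hK : IsCompact K)
    (hφ : ContinuousOn φ K) {S : Set X} {f : X → Y} (hf : ContinuousOn (f ∘ φ) (K ∩ φ ⁻¹' S)) :
    ContinuousOn f (φ '' K ∩ S) := by
  rw [continuousOn_iff_isClosed] at hf ⊢
  intro F hF
  obtain ⟨G, hG, hGF⟩ := hf F hF
  refine ⟨φ '' (K ∩ G),
    ((hK.inter_right hG).image_of_continuousOn (hφ.mono inter_subset_left)).isClosed, ?_⟩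
  ext x
  constructor
  · rintro ⟨hx, ⟨w, hw, rfl⟩, hS⟩
    have : w ∈ G ∩ (K ∩ φ ⁻¹' S) := hGF ▸ ⟨hx, hw, hS⟩
    exact ⟨⟨w, ⟨hw, this.1⟩, rfl⟩, ⟨w, hw, rfl⟩, hS⟩
  · rintro ⟨⟨w, ⟨hw, hwG⟩, rfl⟩, hx⟩
    have : w ∈ (f ∘ φ) ⁻¹' F ∩ (K ∩ φ ⁻¹' S) := hGF ▸ ⟨hwG, hw, hx.2⟩
    exact ⟨this.1, hx⟩

theorem continuousOn_of_isClosed_cover {f : X → Y} {A S T : Set X} (hS : IsClosed S)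
    (hT : IsClosed T) (hA : A ⊆ S ∪ T) (hfS : ContinuousOn f (A ∩ S))
    (hfT : ContinuousOn f (A ∩ T)) : ContinuousOn f A := by
  have key : ∀ {S : Set X}, IsClosed S → ContinuousOn f (A ∩ S) → ∀ x ∈ A,
      ContinuousWithinAt f (A ∩ S) x := by
    intro S hS hf x hx
    by_cases h : x ∈ S
    · exact hf x ⟨hx, h⟩
    · exact continuousWithinAt_of_notMem_closure fun h' =>
        h (hS.closure_subset (closure_mono inter_subset_right h'))
  intro x hx
  refine ((key hS hfS x hx).union (key hT hfT x hx)).mono ?_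
  rw [← inter_union_distrib_left]
  exact subset_inter subset_rfl hA

/-- `φ` is the characteristic map of an `n`-cell whose attachment to `L` yields `L'`. -/
structure Attaches (n : ℕ) (φ : (Fin n → ℝ) → X) (L' L : Set X) : Prop where
  isClosed : IsClosed L
  continuousOn : ContinuousOn φ (closedBall 0 1)
  injOn : InjOn φ (ball 0 1)
  mapsTo_sphere : MapsTo φ (sphere 0 1) L
  disjoint : ∀ x ∈ ball (0 : Fin n → ℝ) 1, φ x ∉ L
  eq_union : L' = L ∪ φ '' closedBall 0 1

theorem RelH.map_comp_map {f : X → Y} {g : Y → Z} {A B : Set X} {A' B' : Set Y} {A'' B'' : Set Z}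
    (hg : PairMap g A' B' A'' B'') (hf : PairMap f A B A' B') (n : ℕ) :
    ⇑(RelH.map hg n) ∘ ⇑(RelH.map hf n) = ⇑(RelH.map (hg.comp hf) n) :=
  funext (RelH.map_map hg hf)

namespace Attaches

open RelH

variable {n : ℕ} {φ : (Fin n → ℝ) → X} {L' L : Set X}

theorem subset (h : Attaches n φ L' L) : L ⊆ L' := h.eq_union ▸ subset_union_left

theorem mem_ball_of_notMem (h : Attaches n φ L' L) {x : Fin n → ℝ} (hx : x ∈ closedBall 0 1)
    (hxL : φ x ∉ L) : x ∈ ball 0 1 := by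
  rw [← ball_union_sphere] at hx
  exact hx.resolve_right fun hx => hxL (h.mapsTo_sphere hx)

theorem ne_center (h : Attaches n φ L' L) {x : Fin n → ℝ} (hx : x ∈ closedBall 0 1) (h0 : x ≠ 0) :
    φ x ≠ φ 0 := by
  intro hx0
  have hc : (0 : Fin n → ℝ) ∈ ball (0 : Fin n → ℝ) 1 := mem_ball_self one_pos
  have := h.mem_ball_of_notMem hx (hx0 ▸ h.disjoint 0 hc)
  exact h0 (h.injOn this hc hx0)

theorem center_notMem (h : Attaches n φ L' L) : φ 0 ∉ L := h.disjoint 0 (mem_ball_self one_pos)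

theorem subset_punctured (h : Attaches n φ L' L) : L ⊆ L' \ {φ 0} :=
  subset_sdiff_singleton h.subset h.center_notMem

/-- The complement of the center of an attached cell deforms radially into `L`. -/
theorem subsingleton_punctured [T2Space X] (h : Attaches n φ L' L) (j : ℕ) :
    Subsingleton (RelH j (L' \ {φ 0}) L) := by
  classical
  -- Radial motion towards the sphere: at time t the norm is (1 - t)‖x‖ + t.
  set r : (Fin n → ℝ) → ℝ → (Fin n → ℝ) := fun x t => ((1 - t) + t * ‖x‖⁻¹) • x with hr
  have hr_norm : ∀ x ≠ 0, ∀ t ∈ Icc (0 : ℝ) 1, ‖r x t‖ = (1 - t) * ‖x‖ + t := by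
    rintro x hx t ⟨h0, h1⟩
    have : ‖x‖ ≠ 0 := norm_ne_zero_iff.2 hx
    have h2 : 0 ≤ (1 - t) + t * ‖x‖⁻¹ :=
      add_nonneg (by linarith) (mul_nonneg h0 (inv_nonneg.2 (norm_nonneg _)))
    rw [hr, norm_smul, Real.norm_of_nonneg h2]
    field_simp
  have hr_mem : ∀ x ∈ closedBall (0 : Fin n → ℝ) 1, x ≠ 0 → ∀ t ∈ Icc (0 : ℝ) 1,
      r x t ∈ closedBall 0 1 ∧ r x t ≠ 0 := by
    rintro x hx hx0 t ht
    rw [mem_closedBall_zero_iff] at hx ⊢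
    have h1 := norm_pos_iff.2 hx0
    rw [← norm_pos_iff, hr_norm x hx0 t ht]
    obtain ⟨h2, h3⟩ := ht
    constructor
    · nlinarith
    · rcases h2.eq_or_lt with rfl | h2
      · simpa using hx0
      · nlinarith
  set H : X → ℝ → X := fun y t =>
    if y ∈ L then y else φ (r (Function.invFunOn φ (ball 0 1) y) t) with hH
  have hHL : ∀ y ∈ L, ∀ t, H y t = y := fun y hy t => if_pos hy
  -- This formula also holds on the sphere, where the radial motion is stationary, so the two
  -- clauses of `H` fit together.
  have hHφ : ∀ x ∈ closedBall (0 : Fin n → ℝ) 1, ∀ t, H (φ x) t = φ (r x t) := by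
    intro x hx t
    by_cases hxL : φ x ∈ L
    · have hxs : ‖x‖ = 1 := by
        rw [← ball_union_sphere] at hx
        rcases hx with hx | hx
        · exact absurd hxL (h.disjoint x hx)
        · simpa using hx
      simp [hHL _ hxL, hr, hxs]
    · rw [hH]
      simp only [if_neg hxL]
      rw [h.injOn.leftInvOn_invFunOn (h.mem_ball_of_notMem hx hxL)]
  have hA : ∀ y ∈ L' \ {φ 0}, y ∈ L ∨ ∃ x ∈ closedBall (0 : Fin n → ℝ) 1, x ≠ 0 ∧ φ x = y := by
    rintro y ⟨hy, hy0⟩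
    rw [h.eq_union] at hy
    rcases hy with hy | ⟨x, hx, rfl⟩
    · exact Or.inl hy
    · exact Or.inr ⟨x, hx, by rintro rfl; exact hy0 rfl, rfl⟩
  refine subsingleton_of_homotopy h.subset_punctured H ?_ ?_ ?_ ?_ ?_ j
  · refine continuousOn_of_isClosed_cover (S := L ×ˢ univ)
      (T := (fun p : (Fin n → ℝ) × ℝ => (φ p.1, p.2)) '' (closedBall 0 1 ×ˢ Icc 0 1))
      (h.isClosed.prod isClosed_univ) ?_ ?_ ?_ ?_
    · refine (((isCompact_closedBall _ _).prod isCompact_Icc).image_of_continuousOn ?_).isClosed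
      exact (h.continuousOn.comp continuousOn_fst fun p hp => hp.1).prodMk continuousOn_snd
    · rintro ⟨y, t⟩ ⟨hy, ht⟩
      rcases hA y hy with hy | ⟨x, hx, -, rfl⟩
      · exact Or.inl ⟨hy, mem_univ _⟩
      · exact Or.inr ⟨(x, t), ⟨hx, ht⟩, rfl⟩
    · refine continuousOn_fst.congr ?_
      rintro ⟨y, t⟩ ⟨-, hy, -⟩
      exact hHL y hy t
    · rw [inter_comm]
      refine continuousOn_image_of_isCompact ((isCompact_closedBall _ _).prod isCompact_Icc) ?_ ?_
      · exact (h.continuousOn.comp continuousOn_fst fun p hp => hp.1).prodMk continuousOn_snd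
      · have hne : ∀ p ∈ (closedBall (0 : Fin n → ℝ) 1 ×ˢ Icc (0 : ℝ) 1) ∩
            (fun p : (Fin n → ℝ) × ℝ => (φ p.1, p.2)) ⁻¹' ((L' \ {φ 0}) ×ˢ Icc 0 1), p.1 ≠ 0 := by
          rintro ⟨x, t⟩ ⟨-, hx, -⟩ rfl
          exact hx.2 rfl
        refine (h.continuousOn.comp (f := fun p : (Fin n → ℝ) × ℝ => r p.1 p.2) ?_ ?_).congr ?_
        · have h1 := continuousOn_fst.norm.inv₀ fun p hp => norm_ne_zero_iff.2 (hne p hp)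
          exact ((continuousOn_const.sub continuousOn_snd).add (continuousOn_snd.mul h1)).smul
            continuousOn_fst
        · exact fun p hp => (hr_mem p.1 hp.1.1 (hne p hp) p.2 hp.1.2).1
        · exact fun p hp => hHφ p.1 hp.1.1 p.2
  · intro y hy t ht
    rcases hA y hy with hyL | ⟨x, hx, hx0, rfl⟩
    · rwa [hHL y hyL]
    · obtain ⟨h1, h2⟩ := hr_mem x hx hx0 t ht
      rw [hHφ x hx]
      exact ⟨h.eq_union ▸ Or.inr ⟨_, h1, rfl⟩, h.ne_center h1 h2⟩
  · intro y hy t _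
    rwa [hHL y hy]
  · intro y hy
    rcases hA y hy with hyL | ⟨x, hx, hx0, rfl⟩
    · exact hHL y hyL 0
    · simp [hHφ x hx, hr]
  · intro y hy
    rcases hA y hy with hyL | ⟨x, hx, hx0, rfl⟩
    · rwa [hHL y hyL]
    · rw [hHφ x hx]
      refine h.mapsTo_sphere ?_
      rw [mem_sphere_zero_iff_norm, hr_norm x hx0 1 ⟨zero_le_one, le_rfl⟩]
      simp

theorem bijective_incl [T2Space X] (h : Attaches n φ L' L) (j : ℕ) : Function.Bijective
    (RelH.map (PairMap.incl (subset_rfl : L' ⊆ L') h.subset_punctured) j) :=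
  bijective_incl_of_subsingleton sdiff_subset h.subset_punctured h.subsingleton_punctured j

/-- The parametrization of an open cell by Euclidean space. -/
def param {W : Type*} (φ : (Fin n → ℝ) → W) (x : Fin n → ℝ) : W := φ (Homeomorph.unitBall x)

theorem unitBall_zero_val : ((Homeomorph.unitBall (0 : Fin n → ℝ) : ball (0 : Fin n → ℝ) 1) : Fin n → ℝ) = 0 := by
  simp

theorem param_zero {W : Type*} (φ : (Fin n → ℝ) → W) : param φ 0 = φ 0 := by
  rw [param, unitBall_zero_val]

theorem continuous_param (h : Attaches n φ L' L) : Continuous (param φ) := by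
  rw [← continuousOn_univ]
  exact h.continuousOn.comp (by fun_prop) fun x _ => ball_subset_closedBall (Subtype.coe_prop _)

theorem param_injective (h : Attaches n φ L' L) : Function.Injective (param φ) := fun _ _ hxy =>
  Homeomorph.unitBall.injective
    (Subtype.ext (h.injOn (Subtype.coe_prop _) (Subtype.coe_prop _) hxy))

theorem param_mem (h : Attaches n φ L' L) (x : Fin n → ℝ) : param φ x ∈ L' ∩ Lᶜ :=
  ⟨h.eq_union ▸ Or.inr ⟨_, ball_subset_closedBall (Subtype.coe_prop _), rfl⟩,
    h.disjoint _ (Subtype.coe_prop _)⟩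

theorem exists_param_eq (h : Attaches n φ L' L) {y : X} (hy : y ∈ L' ∩ Lᶜ) :
    ∃ x, param φ x = y := by
  obtain ⟨hy, hyL⟩ := hy
  rw [h.eq_union] at hy
  obtain ⟨x, hx, rfl⟩ := hy.resolve_left hyL
  have hx := h.mem_ball_of_notMem hx hyL
  exact ⟨Homeomorph.unitBall.symm ⟨x, hx⟩, by simp [param]⟩

theorem pairMap_param (h : Attaches n φ L' L) :
    PairMap (param φ) univ {0}ᶜ L' (L' \ {φ 0}) :=
  ⟨h.continuous_param.continuousOn, h.continuous_param.continuousOn, fun x _ => (h.param_mem x).1,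
    fun x hx => ⟨(h.param_mem x).1, fun hx' => hx (h.param_injective (hx'.trans (param_zero φ).symm))⟩⟩

theorem pairMap_param_cell (h : Attaches n φ L' L) : PairMap (param φ) univ {0}ᶜ
    (L' ∩ Lᶜ) ((L' ∩ Lᶜ) ∩ (L' ∩ {φ 0}ᶜ)) :=
  ⟨h.continuous_param.continuousOn, h.continuous_param.continuousOn, fun x _ => h.param_mem x,
    fun x hx => ⟨h.param_mem x, h.pairMap_param.4 hx⟩⟩

theorem continuousOn_invFun_param [T2Space X] (h : Attaches n φ L' L) :
    ContinuousOn (Function.invFun (param φ)) (L' ∩ Lᶜ) := by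
  have h1 : L' ∩ Lᶜ ⊆ φ '' closedBall 0 1 ∩ Lᶜ := by
    rintro y ⟨hy, hyL⟩
    rw [h.eq_union] at hy
    exact ⟨hy.resolve_left hyL, hyL⟩
  refine (continuousOn_image_of_isCompact (isCompact_closedBall _ _) h.continuousOn ?_).mono h1
  rw [continuousOn_iff_continuous_domRestrict]
  refine (Homeomorph.unitBall.symm.continuous.comp (f := fun x : ↑(closedBall (0 : Fin n → ℝ) 1 ∩
    φ ⁻¹' Lᶜ) => (⟨x, h.mem_ball_of_notMem x.2.1 x.2.2⟩ : ball (0 : Fin n → ℝ) 1))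
    (by fun_prop)).congr ?_
  intro x
  rw [Function.comp_apply, domRestrict_apply, Function.comp_apply]
  apply h.param_injective
  exact (Eq.trans (by simp [param]) (Function.invFun_eq (f := param φ) (b := φ x)
    ⟨Homeomorph.unitBall.symm ⟨x, h.mem_ball_of_notMem x.2.1 x.2.2⟩, by simp [param]⟩).symm)

/-- Excising `L` from the punctured pair leaves the open cell and its complement of the center,
which `param` identifies with Euclidean space and its punctured version. -/
theorem bijective_param [T2Space X] (h : Attaches n φ L' L) (j : ℕ) :
    Function.Bijective (RelH.map h.pairMap_param j) := by
  have hA : L' ⊆ {φ 0}ᶜ ∪ Lᶜ := by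
    intro x _
    by_cases hx : x ∈ L
    · exact Or.inl fun hx' => h.center_notMem (hx' ▸ hx)
    · exact Or.inr hx
  have hex := excision isOpen_compl_singleton h.isClosed.isOpen_compl hA j
  have hinv : ∀ y ∈ L' ∩ Lᶜ, param φ (Function.invFun (param φ) y) = y := fun y hy =>
    Function.invFun_eq (h.exists_param_eq hy)
  have hg : PairMap (Function.invFun (param φ)) (L' ∩ Lᶜ) ((L' ∩ Lᶜ) ∩ (L' ∩ {φ 0}ᶜ))
      univ {0}ᶜ := by
    refine ⟨h.continuousOn_invFun_param, h.continuousOn_invFun_param.mono inter_subset_left,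
      fun _ _ => mem_univ _, fun y hy h0 => hy.2.2 ?_⟩
    rw [mem_singleton_iff] at h0 ⊢
    rw [← hinv y hy.1, h0, param_zero]
  have hb : Function.Bijective (RelH.map h.pairMap_param_cell j) := by
    refine bijective_of_inverse _ hg (fun x => ?_) (fun y => ?_)
    · rw [map_congr _ (PairMap.incl subset_rfl subset_rfl)
        (fun x _ => Function.leftInverse_invFun h.param_injective x), map_id_apply]
    · rw [map_congr _ (PairMap.incl subset_rfl subset_rfl) (fun y hy => hinv y hy), map_id_apply]
  have := hex.comp hb
  rwa [map_comp_map] at this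

theorem concentrated [T2Space X] (h : Attaches n φ L' L) : Concentrated n L' L :=
  (concentrated_euclidean n).of_equiv fun j =>
    ⟨(nonempty_equiv (h.bijective_param j)).some.trans (nonempty_equiv (h.bijective_incl j)).some.symm⟩

/-- A map of pairs that maps a cell homeomorphically to a cell induces an isomorphism in
relative homology. -/
theorem bijective_map [T2Space X] [T2Space Y] (h : Attaches n φ L' L) {f : X → Y} {M' M : Set Y}
    (hf : PairMap f L' L M' M) (h' : Attaches n (f ∘ φ) M' M) (j : ℕ) :
    Function.Bijective (RelH.map hf j) := by
  have hp : PairMap f L' (L' \ {φ 0}) M' (M' \ {(f ∘ φ) 0}) := by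
    refine ⟨hf.1, hf.1.mono sdiff_subset, hf.3, ?_⟩
    rintro y ⟨hy, hy0⟩
    refine ⟨hf.3 hy, ?_⟩
    rw [h.eq_union] at hy
    rcases hy with hy | ⟨x, hx, rfl⟩
    · exact fun hy' => h'.center_notMem (hy' ▸ hf.4 hy)
    · exact h'.ne_center hx (by rintro rfl; exact hy0 rfl)
  -- Two out of three: `f` composed with the parametrization of the cell is the parametrization of
  -- the image cell.
  have h1 : Function.Bijective (RelH.map hp j) := by
    rw [← Function.Bijective.of_comp_iff _ (h.bijective_param j)]
    rw [map_comp_map]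
    exact h'.bijective_param j
  rw [← Function.Bijective.of_comp_iff' (h'.bijective_incl j)]
  have h2 := h1.comp (h.bijective_incl j)
  rw [map_comp_map] at h2
  rwa [map_comp_map]

end Attaches

end Attaching

end

noncomputable section

/-! ### Abelian groups up to torsion -/

section Torsion

theorem finrank_range_add_finrank_ker {M N : Type*} [AddCommGroup M] [AddCommGroup N]
    [Module.Finite ℤ M] (f : M →ₗ[ℤ] N) :
    Module.finrank ℤ (LinearMap.range f) + Module.finrank ℤ (LinearMap.ker f) =
      Module.finrank ℤ M := by
  rw [← Submodule.finrank_quotient_add_finrank (LinearMap.ker f),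
    LinearEquiv.finrank_eq f.quotKerEquivRange]

theorem finite_of_exact {M N P : Type*} [AddCommGroup M] [AddCommGroup N] [AddCommGroup P]
    [Module.Finite ℤ M] [Module.Finite ℤ P] {f : M →ₗ[ℤ] N} {g : N →ₗ[ℤ] P}
    (h : Function.Exact f g) : Module.Finite ℤ N := by
  have := isNoetherian_of_range_eq_ker f g (LinearMap.exact_iff.1 h).symm
  infer_instance

/-- The kernel of `f` is a torsion group. -/
def TorsionKer {M N : Type*} [AddCommGroup M] [AddCommGroup N] (f : M →ₗ[ℤ] N) : Prop :=
  ∀ x, f x = 0 → ∃ m : ℤ, m ≠ 0 ∧ m • x = 0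

/-- The cokernel of `f` is a torsion group. -/
def TorsionCoker {M N : Type*} [AddCommGroup M] [AddCommGroup N] (f : M →ₗ[ℤ] N) : Prop :=
  ∀ y, ∃ m : ℤ, m ≠ 0 ∧ ∃ x, f x = m • y

/-- Torsion groups have rank zero, so both groups have the rank of the common quotient and image.
This is a rational isomorphism expressed without tensoring. -/
theorem finrank_eq_of_torsion {M N : Type*} [AddCommGroup M] [AddCommGroup N] {f : M →ₗ[ℤ] N}
    (h₁ : TorsionKer f) (h₂ : TorsionCoker f) : Module.finrank ℤ M = Module.finrank ℤ N := by
  have hk : Module.rank ℤ (LinearMap.ker f) = 0 := by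
    rw [rank_eq_zero_iff]
    rintro ⟨x, hx⟩
    obtain ⟨m, hm, hmx⟩ := h₁ x hx
    exact ⟨m, hm, Subtype.ext hmx⟩
  have hc : Module.rank ℤ (N ⧸ LinearMap.range f) = 0 := by
    rw [rank_eq_zero_iff]
    intro y
    obtain ⟨y, rfl⟩ := Submodule.Quotient.mk_surjective _ y
    obtain ⟨m, hm, x, hx⟩ := h₂ y
    refine ⟨m, hm, ?_⟩
    rw [← Submodule.Quotient.mk_smul, Submodule.Quotient.mk_eq_zero]
    exact ⟨x, hx⟩
  have h3 := Submodule.rank_quotient_add_rank (LinearMap.ker f)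
  have h4 := Submodule.rank_quotient_add_rank (LinearMap.range f)
  rw [hk, add_zero] at h3
  rw [hc, zero_add] at h4
  rw [Module.finrank, ← h3, Module.finrank, ← h4, ← Module.finrank, ← Module.finrank]
  exact LinearEquiv.finrank_eq f.quotKerEquivRange

/-! ### Four lemmas modulo torsion -/

section FiveLemma

variable {A B C D A' B' C' D' : Type*} [AddCommGroup A] [AddCommGroup B] [AddCommGroup C]
  [AddCommGroup D] [AddCommGroup A'] [AddCommGroup B'] [AddCommGroup C'] [AddCommGroup D']
  {f : A →ₗ[ℤ] B} {g : B →ₗ[ℤ] C} {h : C →ₗ[ℤ] D} {f' : A' →ₗ[ℤ] B'} {g' : B' →ₗ[ℤ] C'}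
  {h' : C' →ₗ[ℤ] D'} {a : A →ₗ[ℤ] A'} {b : B →ₗ[ℤ] B'} {c : C →ₗ[ℤ] C'} {d : D →ₗ[ℤ] D'}

theorem TorsionKer.four_lemma (hgf : ∀ x, g (f x) = 0) (hgh : Function.Exact g h)
    (hfg' : Function.Exact f' g') (haf : ∀ x, b (f x) = f' (a x)) (hbg : ∀ x, c (g x) = g' (b x))
    (hch : ∀ x, d (h x) = h' (c x)) (ha : Function.Surjective a) (hb : TorsionKer b)
    (hd : Function.Injective d) : TorsionKer c := by
  intro x hx
  have h1 : h x = 0 := hd (by rw [hch, hx, map_zero, map_zero])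
  obtain ⟨y, rfl⟩ := (hgh x).1 h1
  rw [hbg] at hx
  obtain ⟨z, hz⟩ := (hfg' _).1 hx
  obtain ⟨w, rfl⟩ := ha z
  -- The correction of the usual chase lands only in the kernel of `b`, so it vanishes after
  -- multiplication by a nonzero integer.
  obtain ⟨m, hm, hmy⟩ := hb (y - f w) (by rw [map_sub, haf, hz, sub_self])
  refine ⟨m, hm, ?_⟩
  rw [← map_zsmul]
  rw [smul_sub, sub_eq_zero] at hmy
  rw [hmy, map_zsmul, hgf, smul_zero]

theorem TorsionCoker.four_lemma (hgh : Function.Exact g h)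
    (hfg' : Function.Exact f' g') (hgh' : Function.Exact g' h')
    (haf : ∀ x, b (f x) = f' (a x)) (hbg : ∀ x, c (g x) = g' (b x))
    (hch : ∀ x, d (h x) = h' (c x)) (ha : TorsionCoker a) (hc : Function.Bijective c)
    (hd : TorsionKer d) : TorsionCoker b := by
  intro y
  obtain ⟨x, hx⟩ := hc.2 (g' y)
  obtain ⟨m, hm, hmx⟩ := hd (h x) (by rw [hch, hx, hgh'.apply_apply_eq_zero])
  rw [← map_zsmul] at hmx
  obtain ⟨w, hw⟩ := (hgh _).1 hmx
  have h1 : g' (b w - m • y) = 0 := by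
    rw [map_sub, ← hbg, hw, map_zsmul, map_zsmul, hx, sub_self]
  obtain ⟨z, hz⟩ := (hfg' _).1 h1
  obtain ⟨m', hm', v, hv⟩ := ha z
  -- One factor makes the lift possible despite the torsion kernel of `d`, the other despite the
  -- torsion cokernel of `a`.
  refine ⟨m' * m, mul_ne_zero hm' hm, m' • w - f v, ?_⟩
  rw [map_sub, map_zsmul, haf, hv, map_zsmul, hz, smul_sub, sub_sub_cancel, mul_smul]

end FiveLemma

end Torsion

/-! ### Betti numbers under the attachment of a cell -/

section AttachBetti

open RelH

variable {X Y : Type*} [TopologicalSpace X] [TopologicalSpace Y]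

/-- The rank of the homology of `A`. -/
def bettiRel (n : ℕ) (A : Set X) : ℕ := Module.finrank ℤ (RelH n A ∅)

/-- The map from the homology of `A` to the homology of the pair `(A, B)`. -/
def toRel (A B : Set X) (n : ℕ) : RelH n A ∅ →ₗ[ℤ] RelH n A B :=
  RelH.map (PairMap.incl (subset_rfl : A ⊆ A) (empty_subset B)) n

/-- The map in homology induced by an inclusion. -/
def inclH {A B : Set X} (h : B ⊆ A) (n : ℕ) : RelH n B ∅ →ₗ[ℤ] RelH n A ∅ :=
  RelH.map (PairMap.incl h (subset_rfl : (∅ : Set X) ⊆ ∅)) n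

theorem exact_inclH_toRel {A B : Set X} (h : B ⊆ A) (n : ℕ) :
    Function.Exact (inclH h n) (toRel A B n) := exact_incl_incl h (empty_subset B) n

theorem exact_toRel_δ {A B : Set X} (h : B ⊆ A) (n : ℕ) :
    Function.Exact (toRel A B (n + 1)) (δ A (B := B) (C := ∅) n) :=
  exact_incl_δ h (empty_subset B) n

theorem exact_δ_inclH {A B : Set X} (h : B ⊆ A) (n : ℕ) :
    Function.Exact (δ A (B := B) (C := ∅) n) (inclH h n) := exact_δ_incl h (empty_subset B) n

namespace Attaches

variable {n : ℕ} {φ : (Fin n → ℝ) → X} {L' L : Set X} [T2Space X]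

theorem finite_relH (h : Attaches n φ L' L) (j : ℕ) : Module.Finite ℤ (RelH j L' L) := by
  obtain ⟨h1, ⟨e⟩⟩ := h.concentrated
  by_cases hj : j = n
  · subst hj
    exact Module.Finite.equiv e.symm
  · have := h1 j hj
    infer_instance

theorem finite (h : Attaches n φ L' L) {j : ℕ} (hL : Module.Finite ℤ (RelH j L ∅)) :
    Module.Finite ℤ (RelH j L' ∅) := by
  have := h.finite_relH j
  exact finite_of_exact (exact_inclH_toRel h.subset j)

theorem subsingleton (h : Attaches n φ L' L) {j : ℕ} (hj : j ≠ n)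
    (hL : Subsingleton (RelH j L ∅)) : Subsingleton (RelH j L' ∅) := by
  have := h.concentrated.1 j hj
  refine subsingleton_of_forall_eq 0 fun x => ?_
  obtain ⟨y, rfl⟩ := (exact_inclH_toRel h.subset j x).1 (Subsingleton.elim _ _)
  rw [Subsingleton.elim y 0, map_zero]

theorem surjective_inclH (h : Attaches n φ L' L) {j : ℕ} (hj : j ≠ n) :
    Function.Surjective (inclH h.subset j) := by
  have := h.concentrated.1 j hj
  exact fun x => (exact_inclH_toRel h.subset j x).1 (Subsingleton.elim _ _)

theorem injective_inclH (h : Attaches n φ L' L) {j : ℕ} (hj : j + 1 ≠ n) :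
    Function.Injective (inclH h.subset j) := by
  have := h.concentrated.1 (j + 1) hj
  rw [injective_iff_map_eq_zero]
  intro x hx
  obtain ⟨y, rfl⟩ := (exact_δ_inclH h.subset j x).1 hx
  rw [Subsingleton.elim y 0, map_zero]

theorem isTorsionFree_relH (h : Attaches n φ L' L) {x : RelH n L' L} {m : ℤ} (hm : m ≠ 0)
    (hx : m • x = 0) : x = 0 := by
  obtain ⟨-, ⟨e⟩⟩ := h.concentrated
  have h1 : m • e x = 0 := by rw [← map_zsmul, hx, map_zero]
  exact e.map_eq_zero_iff.1 ((smul_eq_zero.1 h1).resolve_left hm)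

/-- The long exact sequence reduces to 0 → H_{n+1}(L) → H_{n+1}(L') → ℤ → H_n(L) → H_n(L') → 0, and
the ranks are counted on both sides of the image in ℤ. -/
theorem bettiRel_add {φ : (Fin (n + 1) → ℝ) → X} (h : Attaches (n + 1) φ L' L) (hf : ∀ j, Module.Finite ℤ (RelH j L ∅)) :
    bettiRel (n + 1) L' =
      bettiRel (n + 1) L + Module.finrank ℤ (LinearMap.range (toRel L' L (n + 1))) ∧
    Module.finrank ℤ (LinearMap.range (toRel L' L (n + 1))) + bettiRel n L =
      1 + bettiRel n L' := by
  have hf' : ∀ j, Module.Finite ℤ (RelH j L' ∅) := fun j => h.finite (hf j)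
  have hfr := h.finite_relH (n + 1)
  obtain ⟨-, ⟨e⟩⟩ := h.concentrated
  have h1 := finrank_range_add_finrank_ker (toRel L' L (n + 1))
  have h2 := finrank_range_add_finrank_ker (δ L' (B := L) (C := ∅) n)
  have h3 := finrank_range_add_finrank_ker (inclH h.subset n)
  rw [(LinearMap.exact_iff.1 (exact_inclH_toRel h.subset (n + 1))),
    LinearMap.finrank_range_of_inj (h.injective_inclH (by lia))] at h1
  rw [(LinearMap.exact_iff.1 (exact_toRel_δ h.subset n)), e.finrank_eq, Module.finrank_self] at h2
  rw [(LinearMap.exact_iff.1 (exact_δ_inclH h.subset n)),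
    LinearMap.range_eq_top.2 (h.surjective_inclH (by lia)), finrank_top] at h3
  unfold bettiRel
  lia

/-- If no cycle runs over the new cell, then the attachment kills a cycle. -/
theorem bettiRel_of_eq_zero {φ : (Fin (n + 1) → ℝ) → X} (h : Attaches (n + 1) φ L' L)
    (hf : ∀ j, Module.Finite ℤ (RelH j L ∅)) (h0 : toRel L' L (n + 1) = 0) :
    bettiRel (n + 1) L' = bettiRel (n + 1) L ∧ bettiRel n L = bettiRel n L' + 1 := by
  obtain ⟨h1, h2⟩ := h.bettiRel_add hf
  rw [h0, LinearMap.range_zero, finrank_bot] at h1 h2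
  lia

/-- If a cycle runs over the new cell, then the attachment creates a cycle. -/
theorem bettiRel_of_ne_zero {φ : (Fin (n + 1) → ℝ) → X} (h : Attaches (n + 1) φ L' L)
    (hf : ∀ j, Module.Finite ℤ (RelH j L ∅)) (h0 : toRel L' L (n + 1) ≠ 0) :
    bettiRel (n + 1) L' = bettiRel (n + 1) L + 1 ∧ bettiRel n L' = bettiRel n L := by
  obtain ⟨h1, h2⟩ := h.bettiRel_add hf
  have hf' : ∀ j, Module.Finite ℤ (RelH j L' ∅) := fun j => h.finite (hf j)
  have hfr := h.finite_relH (n + 1)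
  obtain ⟨-, ⟨e⟩⟩ := h.concentrated
  -- A nonzero subgroup of an infinite cyclic group has positive rank, hence rank one.
  have h3 : Module.finrank ℤ (LinearMap.range (toRel L' L (n + 1))) ≠ 0 := by
    rw [Ne, Module.finrank_eq_zero_iff]
    intro h3
    apply h0
    ext x
    obtain ⟨m, hm, hmx⟩ := h3 ⟨toRel L' L (n + 1) x, x, rfl⟩
    exact h.isTorsionFree_relH hm (Subtype.ext_iff.1 hmx)
  have h4 := Submodule.finrank_le (LinearMap.range (toRel L' L (n + 1)))
  rw [e.finrank_eq, Module.finrank_self] at h4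
  lia

/-- The same cell is attached to both complexes, so H(K', K) → H(L', L) is an isomorphism, and by
naturality a cycle of `K'` over the cell would give one of `L'`. Loops and bridges are both handled
by this. -/
theorem toRel_eq_zero_of_subset {K' K : Set X} (h : Attaches n φ L' L) (hK : Attaches n φ K' K)
    (hKL : K ⊆ L) {j : ℕ} (h0 : toRel L' L j = 0) : toRel K' K j = 0 := by
  have hKL' : K' ⊆ L' := by
    rw [hK.eq_union, h.eq_union]
    exact union_subset_union_left _ hKL
  ext x
  apply (hK.bijective_map (f := id) (PairMap.incl hKL' hKL) h j).1
  have := LinearMap.congr_fun h0 (inclH hKL' j x)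
  rw [toRel, inclH, map_map] at this
  rw [toRel, map_map, LinearMap.zero_apply, map_zero]
  exact this

/-- The comparison of homology along a map that is injective on the attached cell. -/
theorem torsionKer_map [T2Space Y] (h : Attaches n φ L' L) {f : X → Y} {M' M : Set Y}
    (hf' : PairMap f L' ∅ M' ∅) (hf : PairMap f L ∅ M ∅)
    (h' : Attaches n (f ∘ φ) M' M) {j : ℕ} (hT : TorsionKer (RelH.map hf j)) :
    TorsionKer (RelH.map hf' j) := by
  have hr : PairMap f L' L M' M := ⟨hf'.1, hf.1, hf'.3, hf.3⟩
  refine TorsionKer.four_lemma (f := δ L' (B := L) (C := ∅) j) (g := inclH h.subset j)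
    (h := toRel L' L j) (f' := δ M' (B := M) (C := ∅) j) (g' := inclH h'.subset j)
    (h' := toRel M' M j) (a := RelH.map hr (j + 1)) (d := RelH.map hr j)
    (exact_δ_inclH h.subset j).apply_apply_eq_zero (exact_inclH_toRel h.subset j)
    (exact_δ_inclH h'.subset j) (fun x => (δ_map hr hf x).symm)
    (fun x => ?_) (fun x => ?_) (h.bijective_map hr h' _).2 hT (h.bijective_map hr h' _).1
  · rw [inclH, inclH, map_map, map_map]
  · rw [toRel, toRel, map_map, map_map]

/-- This is the ladder of `torsionKer_map` shifted by one place. The square after the relative terms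
lives one degree lower, which is why control of the kernel in degree `j` is needed. -/
theorem torsionCoker_map [T2Space Y] (h : Attaches n φ L' L) {f : X → Y} {M' M : Set Y}
    (hf' : PairMap f L' ∅ M' ∅) (hf : PairMap f L ∅ M ∅)
    (h' : Attaches n (f ∘ φ) M' M) {j : ℕ} (hT : TorsionCoker (RelH.map hf (j + 1)))
    (hK : TorsionKer (RelH.map hf j)) : TorsionCoker (RelH.map hf' (j + 1)) := by
  have hr : PairMap f L' L M' M := ⟨hf'.1, hf.1, hf'.3, hf.3⟩
  refine TorsionCoker.four_lemma (f := inclH h.subset (j + 1)) (g := toRel L' L (j + 1))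
    (h := δ L' (B := L) (C := ∅) j) (f' := inclH h'.subset (j + 1)) (g' := toRel M' M (j + 1))
    (h' := δ M' (B := M) (C := ∅) j) (c := RelH.map hr (j + 1)) (d := RelH.map hf j)
    (exact_toRel_δ h.subset j) (exact_inclH_toRel h'.subset _)
    (exact_toRel_δ h'.subset j) (fun x => ?_) (fun x => ?_) (fun x => (δ_map hr hf x).symm)
    hT (h.bijective_map hr h' _) hK
  · rw [inclH, inclH, map_map, map_map]
  · rw [toRel, toRel, map_map, map_map]

/-- If `L` has no cycles, then a cycle that runs over the new cell generates a free group. -/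
theorem nonempty_equiv_int (h : Attaches n φ L' L) (hL : Subsingleton (RelH n L ∅))
    (h0 : toRel L' L n ≠ 0) : Nonempty (RelH n L' ∅ ≃ₗ[ℤ] ℤ) := by
  obtain ⟨-, ⟨e⟩⟩ := h.concentrated
  have hinj : Function.Injective (toRel L' L n) := by
    rw [injective_iff_map_eq_zero]
    intro x hx
    obtain ⟨y, rfl⟩ := (exact_inclH_toRel h.subset n x).1 hx
    rw [Subsingleton.elim y 0, map_zero]
  let f : RelH n L' ∅ →ₗ[ℤ] ℤ := e.toLinearMap ∘ₗ toRel L' L n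
  have hf : Function.Injective f := e.injective.comp hinj
  -- The image in ℤ is a nonzero ideal, hence free on its generator.
  have hne : Ideal.span {Submodule.IsPrincipal.generator (LinearMap.range f)} ≠ ⊥ := by
    rw [Ideal.span_singleton_generator, Ne, LinearMap.range_eq_bot]
    intro hf0
    apply h0
    ext x
    exact e.map_eq_zero_iff.1 (LinearMap.congr_fun hf0 x)
  rw [Ne, Ideal.span_singleton_eq_bot] at hne
  refine ⟨(LinearEquiv.ofInjective f hf).trans
    ((LinearEquiv.ofEq _ _ (Ideal.span_singleton_generator (LinearMap.range f)).symm).trans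
      (LinearEquiv.toSpanNonzeroSingleton ℤ ℤ _ hne).symm)⟩

end Attaches

end AttachBetti

end

noncomputable section

theorem subsingleton_relH_empty {Y : Type*} [TopologicalSpace Y] (n : ℕ) (B : Set Y) :
    Subsingleton (RelH n (∅ : Set Y) B) := by
  refine subsingleton_of_forall_eq 0 fun x => ?_
  obtain ⟨z, hz, rfl⟩ := RelH.exists_mk x
  have h : z = 0 := by
    have := hz.1
    rwa [SingChain.nchains_empty] at this
  subst h
  exact RelH.mk_eq_zero.2 (Submodule.zero_mem _)

/-! ### Families of cells that are closed under taking boundaries -/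

section Families

variable {X : Type u} [TopologicalSpace X] {C : Set X} [CWComplex C]

/-- The union of a family of open cells. -/
def cellUnion (T : Set (Σ n, cell C n)) : Set X := ⋃ p ∈ T, openCell p.1 p.2

/-- The family contains all cells that meet the closure of one of its members. -/
def IsClosedFamily (T : Set (Σ n, cell C n)) : Prop :=
  ∀ p ∈ T, closedCell p.1 p.2 ⊆ cellUnion T

theorem mem_cellUnion {T : Set (Σ n, cell C n)} {x : X} :
    x ∈ cellUnion T ↔ ∃ p ∈ T, x ∈ openCell p.1 p.2 := by
  simp only [cellUnion, mem_iUnion, exists_prop]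

theorem openCell_subset_cellUnion {T : Set (Σ n, cell C n)} {p : Σ n, cell C n} (hp : p ∈ T) :
    openCell p.1 p.2 ⊆ cellUnion T := fun _ hx => mem_cellUnion.2 ⟨p, hp, hx⟩

theorem cellUnion_mono {S T : Set (Σ n, cell C n)} (h : S ⊆ T) : cellUnion S ⊆ cellUnion T :=
  biUnion_subset_biUnion_left h

theorem cellUnion_insert (p : Σ n, cell C n) (T : Set (Σ n, cell C n)) :
    cellUnion (insert p T) = openCell p.1 p.2 ∪ cellUnion T := biUnion_insert _ _ _

theorem eq_of_mem_openCell {p q : Σ n, cell C n} {x : X} (hp : x ∈ openCell p.1 p.2)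
    (hq : x ∈ openCell q.1 q.2) : p = q := by
  by_contra h
  exact (CWComplex.disjoint_openCell_of_ne (C := C) h).notMem_of_mem_left hp hq

theorem disjoint_openCell_cellUnion {T : Set (Σ n, cell C n)} {p : Σ n, cell C n} (hp : p ∉ T) :
    Disjoint (openCell p.1 p.2) (cellUnion T) := by
  rw [Set.disjoint_left]
  intro x hx hxT
  obtain ⟨q, hq, hxq⟩ := mem_cellUnion.1 hxT
  exact hp ((eq_of_mem_openCell hx hxq).symm ▸ hq)

theorem mem_of_openCell_subset {T : Set (Σ n, cell C n)} {p : Σ n, cell C n}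
    (hp : openCell p.1 p.2 ⊆ cellUnion T) : p ∈ T := by
  by_contra h
  obtain ⟨x, hx⟩ := RelCWComplex.openCell_nonempty (C := C) p.1 p.2
  exact (disjoint_openCell_cellUnion h).notMem_of_mem_left hx (hp hx)

theorem cellUnion_injective : Function.Injective (cellUnion (C := C)) := by
  intro S T h
  ext p
  exact ⟨fun hp => mem_of_openCell_subset (h ▸ openCell_subset_cellUnion hp),
    fun hp => mem_of_openCell_subset (h ▸ openCell_subset_cellUnion hp)⟩

theorem cellUnion_univ : cellUnion (univ : Set (Σ n, cell C n)) = C := by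
  refine Eq.trans ?_ (CWComplex.iUnion_openCell_eq_complex (C := C))
  ext x
  simp [mem_cellUnion]

theorem isClosedFamily_empty : IsClosedFamily (∅ : Set (Σ n, cell C n)) := fun _ h => h.elim

theorem cellUnion_empty : cellUnion (∅ : Set (Σ n, cell C n)) = ∅ := biUnion_empty _

theorem IsClosedFamily.eq_iUnion {T : Set (Σ n, cell C n)} (h : IsClosedFamily T) :
    cellUnion T = ⋃ p ∈ T, closedCell p.1 p.2 :=
  subset_antisymm (iUnion₂_mono fun p _ => CWComplex.openCell_subset_closedCell p.1 p.2)
    (iUnion₂_subset h)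

theorem cellFrontier_subset_cellUnion (p : Σ n, cell C n) :
    cellFrontier p.1 p.2 ⊆ cellUnion {q : Σ n, cell C n | q.1 < p.1} := by
  intro x hx
  obtain ⟨I, hI⟩ := CWComplex.cellFrontier_subset_finite_openCell p.1 p.2
  have h := hI hx
  simp only [mem_iUnion] at h
  obtain ⟨m, hm, j, _, hj⟩ := h
  exact mem_cellUnion.2 ⟨⟨m, j⟩, hm, hj⟩

/-- The frontier of `q` meets only cells of dimension smaller than that of `q`, so it cannot meet
`p`. -/
theorem closedCell_subset_erase {T : Set (Σ n, cell C n)} {p q : Σ n, cell C n}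
    (hq : closedCell q.1 q.2 ⊆ cellUnion T) (hqp : q ≠ p) (hle : q.1 ≤ p.1) :
    closedCell q.1 q.2 ⊆ cellUnion (T \ {p}) := by
  intro x hx
  obtain ⟨r, hr, hxr⟩ := mem_cellUnion.1 (hq hx)
  refine mem_cellUnion.2 ⟨r, ⟨hr, ?_⟩, hxr⟩
  rintro rfl
  rw [← CWComplex.cellFrontier_union_openCell_eq_closedCell] at hx
  rcases hx with hx | hx
  · obtain ⟨s, hs, hxs⟩ := mem_cellUnion.1 (cellFrontier_subset_cellUnion q hx)
    have := eq_of_mem_openCell hxr hxs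
    subst this
    exact absurd hle (not_le.2 hs)
  · exact hqp (eq_of_mem_openCell hx hxr)

theorem isClosedFamily_of_le {T : Set (Σ n, cell C n)} {k : ℕ}
    (h1 : ∀ p : Σ n, cell C n, p.1 < k → p ∈ T) (h2 : ∀ p ∈ T, p.1 ≤ k) : IsClosedFamily T := by
  intro p hp
  rw [← CWComplex.cellFrontier_union_openCell_eq_closedCell]
  refine union_subset ((cellFrontier_subset_cellUnion p).trans (cellUnion_mono fun q hq => ?_))
    (openCell_subset_cellUnion hp)
  exact h1 q (lt_of_lt_of_le hq (h2 p hp))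

theorem IsClosedFamily.cellFrontier_subset {T : Set (Σ n, cell C n)} {p : Σ n, cell C n}
    (h : IsClosedFamily (insert p T)) : cellFrontier p.1 p.2 ⊆ cellUnion T := by
  intro x hx
  have h1 := h p (mem_insert _ _) (CWComplex.cellFrontier_subset_closedCell p.1 p.2 hx)
  rw [cellUnion_insert] at h1
  refine h1.resolve_left fun hxp => ?_
  obtain ⟨q, hq, hxq⟩ := mem_cellUnion.1 (cellFrontier_subset_cellUnion p hx)
  exact lt_irrefl p.1 (eq_of_mem_openCell hxp hxq ▸ hq)

theorem cellUnion_subset_complex (T : Set (Σ n, cell C n)) : cellUnion T ⊆ C :=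
  iUnion₂_subset fun p _ => CWComplex.openCell_subset_complex p.1 p.2

/-- The cells of a subcomplex. -/
def cellsOf (E : Subcomplex C) : Set (Σ n, cell C n) := {p | p.2 ∈ E.I p.1}

theorem cellUnion_cellsOf (E : Subcomplex C) : cellUnion (cellsOf E) = (E : Set X) := by
  rw [← CWComplex.Subcomplex.union (E := E)]
  ext x
  simp [mem_cellUnion, cellsOf]

theorem IsClosedFamily.isCompact [CWComplex.Finite C] {T : Set (Σ n, cell C n)} (h : IsClosedFamily T) :
    IsCompact (cellUnion T) := by
  have : Finite (Σ n, cell C n) := CWComplex.finite_cells_of_finite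
  rw [h.eq_iUnion]
  exact T.toFinite.isCompact_biUnion fun p _ => CWComplex.isCompact_closedCell

/-- Closed families are built up from `T₀` one cell at a time. Read backwards, a cell of maximal
dimension outside `T₀` is on the boundary of no other remaining cell and can be removed. -/
theorem IsClosedFamily.induction [CWComplex.Finite C] {T₀ : Set (Σ n, cell C n)} (h₀ : IsClosedFamily T₀)
    {P : Set (Σ n, cell C n) → Prop} (base : P T₀)
    (step : ∀ T p, T₀ ⊆ T → IsClosedFamily T → p ∉ T → IsClosedFamily (insert p T) → P T →
      P (insert p T)) {T : Set (Σ n, cell C n)} (hT : IsClosedFamily T) (h : T₀ ⊆ T) : P T := by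
  have : Finite (Σ n, cell C n) := CWComplex.finite_cells_of_finite
  obtain ⟨N, hN⟩ : ∃ N, (T \ T₀).ncard = N := ⟨_, rfl⟩
  induction N generalizing T with
  | zero =>
    rw [Set.ncard_eq_zero, sdiff_eq_empty] at hN
    rwa [← subset_antisymm h hN]
  | succ N ih =>
    have hne : (T \ T₀).Nonempty := by
      rw [← Set.ncard_pos]
      lia
    obtain ⟨p, ⟨hpT, hp0⟩, hmax⟩ := Set.exists_max_image (T \ T₀) Sigma.fst (Set.toFinite _) hne
    have hins : insert p (T \ {p}) = T := insert_sdiff_self_of_mem hpT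
    have hsub : T₀ ⊆ T \ {p} := subset_sdiff_singleton h hp0
    have hcl : IsClosedFamily (T \ {p}) := by
      intro q hq
      by_cases hq0 : q ∈ T₀
      · exact (h₀ q hq0).trans (cellUnion_mono hsub)
      · exact closedCell_subset_erase (hT q hq.1) hq.2 (hmax q ⟨hq.1, hq0⟩)
    have hN' : ((T \ {p}) \ T₀).ncard = N := by
      have h1 : (T \ {p}) \ T₀ = (T \ T₀) \ {p} := by
        ext q
        simp only [mem_sdiff, mem_singleton_iff]
        tauto
      rw [h1, Set.ncard_sdiff_singleton_of_mem (show p ∈ T \ T₀ from ⟨hpT, hp0⟩), hN]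
      rfl
    have := step _ p hsub hcl (fun h => h.2 rfl) (hins.symm ▸ hT) (ih hcl hsub hN')
    rwa [hins] at this

/-! ### Closed families in finite complexes -/

section Finite

variable [T2Space X]

theorem isClosedFamily_cellsOf (E : Subcomplex C) : IsClosedFamily (cellsOf E) := by
  intro p hp
  rw [cellUnion_cellsOf]
  exact CWComplex.Subcomplex.closedCell_subset_of_mem E hp

/-- The subcomplex whose cells are a given closed family. -/
def ofFamily (T : Set (Σ n, cell C n)) (h : IsClosedFamily T) : Subcomplex C :=
  CWComplex.Subcomplex.mk' C (cellUnion T) (fun n => {i | (⟨n, i⟩ : Σ n, cell C n) ∈ T})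
    (fun n i => h ⟨n, i⟩ i.2) (by
      ext x
      simp [mem_cellUnion])

theorem coe_ofFamily (T : Set (Σ n, cell C n)) (h : IsClosedFamily T) :
    (ofFamily T h : Set X) = cellUnion T := rfl

variable [CWComplex.Finite C]

theorem IsClosedFamily.attaches {T : Set (Σ n, cell C n)} {p : Σ n, cell C n}
    (hT : IsClosedFamily T) (hp : p ∉ T) (hpT : IsClosedFamily (insert p T)) :
    Attaches p.1 (map p.1 p.2) (cellUnion (insert p T)) (cellUnion T) where
  isClosed := hT.isCompact.isClosed
  continuousOn := RelCWComplex.continuousOn p.1 p.2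
  injOn := by
    rw [← RelCWComplex.source_eq (C := C) p.1 p.2]
    exact (map p.1 p.2).injOn
  mapsTo_sphere := fun x hx => hpT.cellFrontier_subset ⟨x, hx, rfl⟩
  disjoint := fun x hx => (disjoint_openCell_cellUnion hp).notMem_of_mem_left ⟨x, hx, rfl⟩
  eq_union := by
    refine subset_antisymm ?_ ?_
    · rw [cellUnion_insert, union_comm]
      exact union_subset_union_right _ (CWComplex.openCell_subset_closedCell p.1 p.2)
    · exact union_subset (cellUnion_mono (subset_insert _ _)) (hpT p (mem_insert _ _))

theorem IsClosedFamily.finite_relH {T : Set (Σ n, cell C n)} (h : IsClosedFamily T) (j : ℕ) :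
    Module.Finite ℤ (RelH j (cellUnion T) ∅) := by
  refine isClosedFamily_empty.induction
    (P := fun T => Module.Finite ℤ (RelH j (cellUnion T) ∅)) ?_ ?_ h (empty_subset _)
  · rw [cellUnion_empty]
    have := subsingleton_relH_empty j (∅ : Set X)
    infer_instance
  · exact fun T p _ hT hp hpT ih => (hT.attaches hp hpT).finite ih

theorem IsClosedFamily.subsingleton_relH {T : Set (Σ n, cell C n)} (h : IsClosedFamily T) {j : ℕ}
    (hj : ∀ p ∈ T, p.1 < j) : Subsingleton (RelH j (cellUnion T) ∅) := by
  refine isClosedFamily_empty.induction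
    (P := fun T => (∀ p ∈ T, p.1 < j) → Subsingleton (RelH j (cellUnion T) ∅)) ?_ ?_ h
    (empty_subset _) hj
  · intro _
    rw [cellUnion_empty]
    exact subsingleton_relH_empty j ∅
  · exact fun T p _ hT hp hpT ih hj => (hT.attaches hp hpT).subsingleton
      (hj p (mem_insert _ _)).ne' (ih fun q hq => hj q (mem_insert_of_mem _ hq))

end Finite

end Families

/-! ### Betti numbers of a quotient complex -/

section Quotient

variable {X : Type u} [TopologicalSpace X] {C : Set X} [CWComplex C]

theorem pairMap_proj (E : Subcomplex C) (hE : (E : Set X).Nonempty) {A : Set X} (hA : A ⊆ C) :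
    PairMap (Collapse.proj E hE) A ∅ (Collapse.proj E hE '' A) ∅ :=
  ⟨(Collapse.continuousOn_proj E hE).mono hA, continuousOn_empty _, mapsTo_image _ _,
    mapsTo_empty _ _⟩

variable [T2Space X] [CWComplex.Finite C]

/-- The new cell lies off `E`, where the quotient map is injective, so its image is attached by the
composed characteristic map. -/
theorem IsClosedFamily.attaches_proj (E : Subcomplex C) (hE : (E : Set X).Nonempty)
    {T : Set (Σ n, cell C n)} {p : Σ n, cell C n} (hET : cellsOf E ⊆ T)
    (hT : IsClosedFamily T) (hp : p ∉ T) (hpT : IsClosedFamily (insert p T)) :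
    Attaches p.1 (Collapse.proj E hE ∘ map p.1 p.2)
      (Collapse.proj E hE '' cellUnion (insert p T)) (Collapse.proj E hE '' cellUnion T) := by
  have h := hT.attaches hp hpT
  have hbC : ∀ x ∈ ball 0 1, map p.1 p.2 x ∈ C := fun x hx =>
    CWComplex.openCell_subset_complex p.1 p.2 ⟨x, hx, rfl⟩
  have hbE : ∀ x ∈ ball 0 1, map p.1 p.2 x ∉ (E : Set X) := fun x hx hxE => by
    rw [← cellUnion_cellsOf] at hxE
    exact h.disjoint x hx (cellUnion_mono hET hxE)
  constructor
  · exact (hT.isCompact.image_of_continuousOn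
      ((Collapse.continuousOn_proj E hE).mono (cellUnion_subset_complex _))).isClosed
  · exact (Collapse.continuousOn_proj E hE).comp h.continuousOn fun x hx =>
      CWComplex.closedCell_subset_complex p.1 p.2 ⟨x, hx, rfl⟩
  · intro x hx y hy hxy
    rcases (Collapse.proj_eq_iff E hE (hbC x hx) (hbC y hy)).1 hxy with h1 | h1
    · exact h.injOn hx hy h1
    · exact absurd h1.1 (hbE x hx)
  · exact fun x hx => mem_image_of_mem _ (h.mapsTo_sphere hx)
  · rintro x hx ⟨y, hy, hyx⟩
    rcases (Collapse.proj_eq_iff E hE (cellUnion_subset_complex _ hy) (hbC x hx)).1 hyx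
      with h1 | h1
    · exact h.disjoint x hx (h1 ▸ hy)
    · exact hbE x hx h1.2
  · rw [h.eq_union, image_union, image_comp]

/-- If the collapsed subcomplex has trivial rational reduced homology in degrees `m` and `m + 1`,
then the quotient has the same Betti number in degree `m + 1`. -/
theorem bettiRel_image_proj (E : Subcomplex C) (hE : (E : Set X).Nonempty) {m : ℕ}
    (h₁ : bettiRel (m + 1) (E : Set X) = 0)
    (h₀ : TorsionKer (RelH.map (pairMap_toPoint (E : Set X)) m))
    {T : Set (Σ n, cell C n)} (hT : IsClosedFamily T) (hET : cellsOf E ⊆ T) :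
    bettiRel (m + 1) (Collapse.proj E hE '' cellUnion T) = bettiRel (m + 1) (cellUnion T) := by
  -- Three properties are carried together: the cokernel step in degree m + 1 uses the kernel in
  -- degree m.
  have key : TorsionKer (RelH.map (pairMap_proj E hE (cellUnion_subset_complex T)) (m + 1)) ∧
      TorsionCoker (RelH.map (pairMap_proj E hE (cellUnion_subset_complex T)) (m + 1)) ∧
      TorsionKer (RelH.map (pairMap_proj E hE (cellUnion_subset_complex T)) m) := by
    refine (isClosedFamily_cellsOf E).induction (P := fun T =>
      TorsionKer (RelH.map (pairMap_proj E hE (cellUnion_subset_complex T)) (m + 1)) ∧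
      TorsionCoker (RelH.map (pairMap_proj E hE (cellUnion_subset_complex T)) (m + 1)) ∧
      TorsionKer (RelH.map (pairMap_proj E hE (cellUnion_subset_complex T)) m))
      ?_ ?_ hT hET
    · have him : Collapse.proj E hE '' cellUnion (cellsOf E) = {Collapse.base E hE} := by
        rw [cellUnion_cellsOf]
        ext q
        constructor
        · rintro ⟨x, hx, rfl⟩
          exact Collapse.proj_of_mem_sub E hE hx
        · rintro rfl
          exact ⟨hE.some, hE.some_mem, Collapse.proj_of_mem_sub E hE hE.some_mem⟩
      -- For `E` itself the image is a point. Its homology vanishes in degree m + 1, and in degree m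
      -- the constant map on `E` factors through the projection.
      refine ⟨fun x _ => ?_, fun y => ⟨1, one_ne_zero, 0, ?_⟩, fun x hx => ?_⟩
      · have := (isClosedFamily_cellsOf E).finite_relH (m + 1)
        rw [bettiRel, ← cellUnion_cellsOf, Module.finrank_eq_zero_iff] at h₁
        exact h₁ x
      · have : Subsingleton (RelH (m + 1) (Collapse.proj E hE '' cellUnion (cellsOf E)) ∅) := by
          rw [him]
          exact RelH.subsingleton_singleton m _
        exact Subsingleton.elim _ _
      · have h2 : TorsionKer (RelH.map (pairMap_toPoint (cellUnion (cellsOf E))) m) := by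
          rw [cellUnion_cellsOf]
          exact h₀
        refine h2 x ?_
        have h3 := congrArg (RelH.map (pairMap_toPoint (Collapse.proj E hE ''
          cellUnion (cellsOf E))) m) hx
        rw [RelH.map_map, map_zero] at h3
        exact h3
    · rintro T p hET hT hp hpT ⟨ih1, ih2, ih3⟩
      have h := hT.attaches hp hpT
      have h' := hT.attaches_proj E hE hET hp hpT
      exact ⟨h.torsionKer_map _ _ h' ih1, h.torsionCoker_map _ _ h' ih2 ih3,
        h.torsionKer_map _ _ h' ih3⟩
  exact (finrank_eq_of_torsion key.1 key.2.1).symm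

end Quotient

end

noncomputable section

/-! ### The closure of a cell -/

section CellClosure

variable {X : Type u} [TopologicalSpace X]

theorem betti_eq_bettiRel (n : ℕ) (A : Set X) : betti n A = bettiRel n A :=
  (singHEquiv n A).finrank_eq

variable {C : Set X} [CWComplex C] {k : ℕ}

theorem attaches_cellFrontier [T2Space X] (σ : cell C k) :
    Attaches k (map k σ) (closedCell k σ) (cellFrontier k σ) where
  isClosed := CWComplex.isClosed_cellFrontier
  continuousOn := RelCWComplex.continuousOn k σ
  injOn := by
    rw [← RelCWComplex.source_eq (C := C) k σ]
    exact (map k σ).injOn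
  mapsTo_sphere := fun x hx => ⟨x, hx, rfl⟩
  disjoint := fun x hx hxF => (CWComplex.disjoint_skeletonLT_openCell (C := C) (j := σ)
    le_rfl).notMem_of_mem_left (CWComplex.cellFrontier_subset_skeletonLT k σ hxF) ⟨x, hx, rfl⟩
  eq_union := (union_eq_self_of_subset_left (CWComplex.cellFrontier_subset_closedCell k σ)).symm

theorem eq_or_lt_of_mem_cellsOf {σ : cell C k} {E : Subcomplex C}
    (hE : (E : Set X) = closedCell k σ) {p : Σ n, cell C n} (hp : p ∈ cellsOf E) :
    p = ⟨k, σ⟩ ∨ p.1 < k := by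
  obtain ⟨x, hx⟩ := RelCWComplex.openCell_nonempty (C := C) p.1 p.2
  have h := openCell_subset_cellUnion hp hx
  rw [cellUnion_cellsOf, hE, ← CWComplex.cellFrontier_union_openCell_eq_closedCell] at h
  rcases h with h | h
  · obtain ⟨q, hq, hxq⟩ := mem_cellUnion.1 (cellFrontier_subset_cellUnion ⟨k, σ⟩ h)
    rw [eq_of_mem_openCell hx hxq]
    exact Or.inr hq
  · exact Or.inl (eq_of_mem_openCell (q := ⟨k, σ⟩) hx h)

theorem mem_cellsOf_self {σ : cell C k} {E : Subcomplex C} (hE : (E : Set X) = closedCell k σ) :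
    (⟨k, σ⟩ : Σ n, cell C n) ∈ cellsOf E := by
  refine mem_of_openCell_subset ?_
  rw [cellUnion_cellsOf, hE]
  exact CWComplex.openCell_subset_closedCell k σ

variable [T2Space X]

theorem isClosedFamily_faces {σ : cell C k} {E : Subcomplex C}
    (hE : (E : Set X) = closedCell k σ) : IsClosedFamily (cellsOf E \ {⟨k, σ⟩}) := fun q hq =>
  closedCell_subset_erase (isClosedFamily_cellsOf E q hq.1) hq.2
    ((eq_or_lt_of_mem_cellsOf hE hq.1).resolve_left hq.2).le

/-- As the closure of σ is a subcomplex, its frontier is a union of cells of smaller dimension.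
Hence the homology of the frontier is finitely generated and vanishes in the dimension of σ. -/
theorem cellUnion_faces {σ : cell C k} {E : Subcomplex C} (hE : (E : Set X) = closedCell k σ) :
    cellUnion (cellsOf E \ {⟨k, σ⟩}) = cellFrontier k σ := by
  have h1 : insert (⟨k, σ⟩ : Σ n, cell C n) (cellsOf E \ {⟨k, σ⟩}) = cellsOf E :=
    insert_sdiff_self_of_mem (mem_cellsOf_self hE)
  refine subset_antisymm (fun x hx => ?_) (IsClosedFamily.cellFrontier_subset (p := ⟨k, σ⟩) ?_)
  · have h2 := cellUnion_mono sdiff_subset hx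
    rw [cellUnion_cellsOf, hE, ← CWComplex.cellFrontier_union_openCell_eq_closedCell] at h2
    exact h2.resolve_right
      ((disjoint_openCell_cellUnion (p := ⟨k, σ⟩) fun h => h.2 rfl).notMem_of_mem_right hx)
  · rw [h1]
    exact isClosedFamily_cellsOf E

/-- If a boundary regular cell is not a loop, then the reduced homology of its closure is a
torsion group. -/
theorem torsionKer_toPoint_closedCell {m : ℕ} {σ : cell C (m + 1)}
    (h0 : toRel (closedCell (m + 1) σ) (cellFrontier (m + 1) σ) (m + 1) = 0)
    (hb : IsBoundaryRegular σ) :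
    TorsionKer (RelH.map (pairMap_toPoint (closedCell (m + 1) σ)) m) := by
  intro x hx
  have ha := attaches_cellFrontier σ
  obtain ⟨y, rfl⟩ := ha.surjective_inclH (j := m) (by lia) x
  obtain ⟨-, ⟨eL⟩⟩ := ha.concentrated
  -- The class of the frontier bounded by the cell. It dies in the closure, so it is a reduced
  -- class.
  set g := RelH.δ (closedCell (m + 1) σ) (B := cellFrontier (m + 1) σ) (C := ∅) m (eL.symm 1)
    with hg
  have hpt : ∀ z, RelH.map (pairMap_toPoint (closedCell (m + 1) σ)) m (inclH ha.subset m z) =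
      RelH.map (pairMap_toPoint (cellFrontier (m + 1) σ)) m z := fun z => RelH.map_map _ _ z
  have hgi : inclH ha.subset m g = 0 := (exact_δ_inclH ha.subset m).apply_apply_eq_zero _
  -- Otherwise the relative generator would come from a cycle of the closure, against `h0`.
  have hg0 : g ≠ 0 := by
    intro hg0
    obtain ⟨w, hw⟩ := (exact_toRel_δ ha.subset m _).1 hg0
    rw [h0, LinearMap.zero_apply, eq_comm, eL.symm.map_eq_zero_iff] at hw
    exact one_ne_zero hw
  obtain ⟨e⟩ := hb
  let eS := singHEquiv m (cellFrontier (m + 1) σ)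
  have hred : ∀ z, RelH.map (pairMap_toPoint (cellFrontier (m + 1) σ)) m z = 0 →
      eS.symm z ∈ redSingH m (cellFrontier (m + 1) σ) := fun z hz => by
    rw [mem_redSingH_iff, LinearEquiv.apply_symm_apply]
    exact hz
  let y' : redSingH m (cellFrontier (m + 1) σ) := ⟨eS.symm y, hred y (by rw [← hpt]; exact hx)⟩
  let g' : redSingH m (cellFrontier (m + 1) σ) :=
    ⟨eS.symm g, hred g (by rw [← hpt, hgi, map_zero])⟩
  have hne : e g' ≠ 0 := by
    rw [Ne, e.map_eq_zero_iff]
    intro h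
    exact hg0 (eS.symm.map_eq_zero_iff.1 (congrArg Subtype.val h))
  -- Any two elements of an infinite cyclic group are proportional; hence a nonzero multiple of y is
  -- a multiple of g and dies in the closure.
  have h1 : (e g') • y' = (e y') • g' := e.injective (by
    rw [map_zsmul, map_zsmul, smul_eq_mul, smul_eq_mul, mul_comm])
  let f : redSingH m (cellFrontier (m + 1) σ) →+ RelH m (cellFrontier (m + 1) σ) ∅ :=
    eS.toLinearMap.toAddMonoidHom.comp (redSingH m (cellFrontier (m + 1) σ)).subtype.toAddMonoidHom
  have hf : ∀ z hz, f ⟨eS.symm z, hz⟩ = z := fun z _ => eS.apply_symm_apply z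
  have h3 : e g' • y = e y' • g := by
    have h4 := congrArg f h1
    rwa [map_zsmul, map_zsmul, hf, hf] at h4
  refine ⟨e g', hne, ?_⟩
  rw [← map_zsmul, h3, map_zsmul, hgi, smul_zero]

variable [CWComplex.Finite C]

theorem finite_relH_cellFrontier {σ : cell C k} {E : Subcomplex C}
    (hE : (E : Set X) = closedCell k σ) (j : ℕ) :
    Module.Finite ℤ (RelH j (cellFrontier k σ) ∅) := by
  rw [← cellUnion_faces hE]
  exact (isClosedFamily_faces hE).finite_relH j

theorem subsingleton_relH_cellFrontier {σ : cell C k} {E : Subcomplex C}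
    (hE : (E : Set X) = closedCell k σ) : Subsingleton (RelH k (cellFrontier k σ) ∅) := by
  rw [← cellUnion_faces hE]
  exact (isClosedFamily_faces hE).subsingleton_relH fun p hp =>
    (eq_or_lt_of_mem_cellsOf hE hp.1).resolve_left hp.2

variable {m : ℕ} {σ : cell C (m + 1)} {E : Subcomplex C}

theorem bettiRel_closedCell_eq_zero (hE : (E : Set X) = closedCell (m + 1) σ)
    (h : toRel (closedCell (m + 1) σ) (cellFrontier (m + 1) σ) (m + 1) = 0) :
    bettiRel (m + 1) (closedCell (m + 1) σ) = 0 := by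
  have h1 := ((attaches_cellFrontier σ).bettiRel_of_eq_zero (finite_relH_cellFrontier hE) h).1
  have := subsingleton_relH_cellFrontier hE
  rw [h1, bettiRel, Module.finrank_zero_of_subsingleton]

/-- The frontier has no homology in the dimension of the cell, so the homology of the closure embeds
in the infinite cyclic relative group: it is either zero or infinite cyclic. -/
theorem isLoopCell_iff (hE : (E : Set X) = closedCell (m + 1) σ) : IsLoopCell σ ↔
    toRel (closedCell (m + 1) σ) (cellFrontier (m + 1) σ) (m + 1) ≠ 0 := by
  constructor
  · rintro ⟨e⟩ h0
    have h1 := bettiRel_closedCell_eq_zero hE h0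
    rw [← betti_eq_bettiRel, betti, e.finrank_eq, Module.finrank_self] at h1
    exact one_ne_zero h1
  · intro h0
    obtain ⟨e⟩ := (attaches_cellFrontier σ).nonempty_equiv_int
      (subsingleton_relH_cellFrontier hE) h0
    exact ⟨(singHEquiv _ _).trans e⟩

end CellClosure

/-! ### Generating functions of rank functions -/

section RankPoly

variable {κ κ' : Type*}

/-- The insertion of an element either raises `F` or lowers `G` by one. -/
def RankStep [DecidableEq κ] (F G : Finset κ → ℕ) : Prop :=
  ∀ A a, a ∉ A → (F (insert a A) = F A ∧ G A = G (insert a A) + 1) ∨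
    (F (insert a A) = F A + 1 ∧ G (insert a A) = G A)

/-- F - G - |·| is unchanged by each insertion: an Euler characteristic argument. -/
theorem RankStep.add_card [DecidableEq κ] {F G : Finset κ → ℕ} (h : RankStep F G)
    {A B : Finset κ} (hAB : A ⊆ B) : F B + G A + A.card = F A + G B + B.card := by
  obtain ⟨D, hD, rfl⟩ : ∃ D, Disjoint A D ∧ A ∪ D = B :=
    ⟨B \ A, Finset.disjoint_sdiff, Finset.union_sdiff_of_subset hAB⟩
  clear hAB
  induction D using Finset.induction_on with
  | empty => simp [add_comm, add_left_comm]
  | insert a D ha ih =>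
    rw [Finset.disjoint_insert_right] at hD
    have haD : a ∉ A ∪ D := by simp [hD.1, ha]
    have h1 := ih hD.2
    have h2 := h (A ∪ D) a haD
    rw [Finset.union_insert, Finset.card_insert_of_notMem haD]
    lia

/-- Ensures that the truncated subtraction in the exponents is a true one. -/
theorem RankStep.antitone [DecidableEq κ] {F G : Finset κ → ℕ} (h : RankStep F G)
    {A B : Finset κ} (hAB : A ⊆ B) : G B ≤ G A := by
  obtain ⟨D, rfl⟩ : ∃ D, A ∪ D = B := ⟨B \ A, Finset.union_sdiff_of_subset hAB⟩
  clear hAB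
  induction D using Finset.induction_on with
  | empty => simp
  | insert a D ha ih =>
    rw [Finset.union_insert]
    by_cases haD : a ∈ A ∪ D
    · rwa [Finset.insert_eq_of_mem haD]
    · have := h (A ∪ D) a haD
      lia

/-- The generating function of a pair of functions. -/
def rankPoly [Fintype κ] (F G : Finset κ → ℕ) : MvPolynomial (Fin 2) ℤ :=
  ∑ A, MvPolynomial.X 0 ^ (G A - G Finset.univ) * MvPolynomial.X 1 ^ F A

variable {F G : Finset κ → ℕ} {F' G' : Finset κ' → ℕ}
  {a : κ} {j : κ' ↪ κ}

theorem notMem_map (hj : ∀ b, b ≠ a ↔ b ∈ range j) (A : Finset κ') : a ∉ A.map j := by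
  intro h
  obtain ⟨b, -, hb⟩ := Finset.mem_map.1 h
  exact (hj a).2 ⟨b, hb⟩ rfl

theorem sum_map_eq_sum_powerset {M : Type*} [AddCommMonoid M] [Fintype κ'] (j : κ' ↪ κ) (f : Finset κ → M) :
    ∑ A : Finset κ', f (A.map j) = ∑ A ∈ (Finset.univ.map j).powerset, f A := by
  refine Finset.sum_nbij (fun A : Finset κ' => A.map j) (fun A _ => ?_) (fun A _ B _ h => ?_) ?_
    fun _ _ => rfl
  · exact Finset.mem_powerset.2 (Finset.map_subset_map.2 (Finset.subset_univ A))
  · exact Finset.map_injective j h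
  · intro B hB
    obtain ⟨A, -, hA⟩ := Finset.subset_map_iff.1 (Finset.mem_powerset.1 hB)
    exact ⟨A, Finset.mem_coe.2 (Finset.mem_univ _), hA.symm⟩

variable [Fintype κ] [Fintype κ']

/-- The hypothesis `hu` is the failure of the bridge condition: it makes the normalizations of the
exponent of X agree for the complex and its deletion. -/
theorem rankPoly_deletion (hF : ∀ A, F' A = F (A.map j)) (hG : ∀ A, G' A = G (A.map j))
    (hu : G (Finset.univ.map j) = G Finset.univ) :
    ∑ A : Finset κ', MvPolynomial.X 0 ^ (G (A.map j) - G Finset.univ) *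
      MvPolynomial.X 1 ^ F (A.map j) = rankPoly F' G' := by
  simp only [rankPoly, hF, hG, hu]

variable [DecidableEq κ]

theorem univ_eq_insert_map (hj : ∀ b, b ≠ a ↔ b ∈ range j) :
    Finset.univ = insert a (Finset.univ.map j) := by
  ext b
  have := hj b
  simp only [Finset.mem_univ, Finset.mem_insert, Finset.mem_map, true_and, true_iff]
  by_cases hb : b = a
  · exact Or.inl hb
  · exact Or.inr (this.1 hb)

/-- The top cells of the quotient and of the deletion are different types, but both enumerate the
cells other than σ. -/
theorem sum_map_congr {M κ'' : Type*} [AddCommMonoid M] [Fintype κ''] {j' : κ'' ↪ κ}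
    (hj : ∀ b, b ≠ a ↔ b ∈ range j) (hj' : ∀ b, b ≠ a ↔ b ∈ range j') (f : Finset κ → M) :
    ∑ A : Finset κ', f (A.map j) = ∑ A : Finset κ'', f (A.map j') := by
  rw [sum_map_eq_sum_powerset, sum_map_eq_sum_powerset]
  congr 2
  ext b
  simpa [mem_range] using (hj b).symm.trans (hj' b)

theorem sum_finset_eq_add {M : Type*} [AddCommMonoid M] (hj : ∀ b, b ≠ a ↔ b ∈ range j)
    (f : Finset κ → M) : ∑ A, f A = ∑ A : Finset κ', f (A.map j) +
      ∑ A : Finset κ', f (insert a (A.map j)) := by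
  rw [← Finset.powerset_univ, univ_eq_insert_map hj,
    Finset.sum_powerset_insert (notMem_map hj _), sum_map_eq_sum_powerset,
    sum_map_eq_sum_powerset j fun A => f (insert a A)]

theorem rankPoly_eq_add (hj : ∀ b, b ≠ a ↔ b ∈ range j) : rankPoly F G =
    ∑ A : Finset κ', MvPolynomial.X 0 ^ (G (A.map j) - G Finset.univ) *
      MvPolynomial.X 1 ^ F (A.map j) +
    ∑ A : Finset κ', MvPolynomial.X 0 ^ (G (insert a (A.map j)) - G Finset.univ) *
      MvPolynomial.X 1 ^ F (insert a (A.map j)) :=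
  sum_finset_eq_add hj _

/-- Only `F` is compared. By `add_card` the difference of the values of `G` depends on `F` and on
the number of missing elements, which is the same for `A` and for `insert a (A.map j)`. -/
theorem rankPoly_contraction [DecidableEq κ'] (hj : ∀ b, b ≠ a ↔ b ∈ range j) (h : RankStep F G)
    (h' : RankStep F' G') (hF : ∀ A, F' A = F (insert a (A.map j))) :
    ∑ A : Finset κ', MvPolynomial.X 0 ^ (G (insert a (A.map j)) - G Finset.univ) *
      MvPolynomial.X 1 ^ F (insert a (A.map j)) = rankPoly F' G' := by
  refine Finset.sum_congr rfl fun A _ => ?_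
  have h1 := h.add_card (Finset.subset_univ (insert a (A.map j)))
  have h2 := h'.add_card (Finset.subset_univ A)
  have h3 : (Finset.univ : Finset κ).card = (Finset.univ : Finset κ').card + 1 := by
    rw [univ_eq_insert_map hj, Finset.card_insert_of_notMem (notMem_map hj _), Finset.card_map]
  rw [Finset.card_insert_of_notMem (notMem_map hj _), Finset.card_map] at h1
  rw [hF, hF, ← univ_eq_insert_map hj] at h2
  rw [hF]
  congr 2
  lia

theorem rankPoly_deletion_contraction {κ'' : Type*} [Fintype κ''] [DecidableEq κ']
    {F'' G'' : Finset κ'' → ℕ} {j' : κ'' ↪ κ} (hj : ∀ b, b ≠ a ↔ b ∈ range j)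
    (hj' : ∀ b, b ≠ a ↔ b ∈ range j') (h : RankStep F G) (h' : RankStep F' G')
    (hF : ∀ A, F' A = F (insert a (A.map j))) (hF' : ∀ A, F'' A = F (A.map j'))
    (hG' : ∀ A, G'' A = G (A.map j')) (hu : G (Finset.univ.map j') = G Finset.univ) :
    rankPoly F G = rankPoly F' G' + rankPoly F'' G'' := by
  rw [rankPoly_eq_add hj, rankPoly_contraction hj h h' hF, add_comm,
    ← rankPoly_deletion hF' hG' hu]
  exact congrArg _ (sum_map_congr hj hj' fun A => MvPolynomial.X 0 ^ (G A - G Finset.univ) *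
    MvPolynomial.X 1 ^ F A)

theorem rankPoly_of_loop (hj : ∀ b, b ≠ a ↔ b ∈ range j) (hF : ∀ A, F' A = F (A.map j))
    (hG : ∀ A, G' A = G (A.map j))
    (hl : ∀ A, a ∉ A → F (insert a A) = F A + 1 ∧ G (insert a A) = G A) :
    rankPoly F G = (MvPolynomial.X 1 + 1) * rankPoly F' G' := by
  have hu : G (Finset.univ.map j) = G Finset.univ := by
    rw [univ_eq_insert_map hj, (hl _ (notMem_map hj _)).2]
  rw [rankPoly_eq_add hj, ← rankPoly_deletion hF hG hu, add_mul, one_mul, add_comm,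
    Finset.mul_sum]
  congr 1
  refine Finset.sum_congr rfl fun A _ => ?_
  rw [(hl _ (notMem_map hj A)).1, (hl _ (notMem_map hj A)).2, pow_succ]
  ring

theorem rankPoly_of_bridge [DecidableEq κ'] (hj : ∀ b, b ≠ a ↔ b ∈ range j) (h : RankStep F G)
    (h' : RankStep F' G') (hF : ∀ A, F' A = F (insert a (A.map j)))
    (hb : ∀ A, a ∉ A → F (insert a A) = F A ∧ G A = G (insert a A) + 1) :
    rankPoly F G = (MvPolynomial.X 0 + 1) * rankPoly F' G' := by
  rw [rankPoly_eq_add hj, ← rankPoly_contraction hj h h' hF, add_mul, one_mul, Finset.mul_sum]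
  congr 1
  refine Finset.sum_congr rfl fun A _ => ?_
  -- Needed to move the summand 1 out of the truncated subtraction, giving the factor X.
  have h1 := h.antitone (Finset.subset_univ (insert a (A.map j)))
  rw [(hb _ (notMem_map hj A)).1, (hb _ (notMem_map hj A)).2, Nat.sub_add_comm h1, pow_succ]
  ring

end RankPoly

end

noncomputable section

/-! ### Spanning subcomplexes and sets of top-dimensional cells -/

section Levels

variable {X : Type u} [TopologicalSpace X] {C : Set X} [CWComplex C] {k : ℕ}

/-- The family of all cells of dimension less than `k` and of the `k`-cells in `A`. -/
def levelFamily (A : Finset (cell C k)) : Set (Σ n, cell C n) :=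
  {p | p.1 < k} ∪ Sigma.mk k '' (A : Set (cell C k))

/-- The union of all cells of dimension less than `k` and of the `k`-cells in `A`. -/
def levelSet (A : Finset (cell C k)) : Set X := cellUnion (levelFamily A)

theorem isClosedFamily_levelFamily (A : Finset (cell C k)) : IsClosedFamily (levelFamily A) := by
  refine isClosedFamily_of_le (k := k) (fun p hp => Or.inl hp) ?_
  rintro p (hp | ⟨i, -, rfl⟩)
  · exact le_of_lt hp
  · exact le_rfl

theorem mk_mem_levelFamily {A : Finset (cell C k)} {i : cell C k} :
    (⟨k, i⟩ : Σ n, cell C n) ∈ levelFamily A ↔ i ∈ A := by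
  constructor
  · rintro (h | ⟨j, hj, h⟩)
    · exact absurd h (lt_irrefl k)
    · cases h
      exact hj
  · exact fun h => Or.inr ⟨i, h, rfl⟩

theorem levelFamily_insert [DecidableEq (cell C k)] (A : Finset (cell C k)) (i : cell C k) :
    levelFamily (insert i A) = insert ⟨k, i⟩ (levelFamily A) := by
  rw [levelFamily, Finset.coe_insert, image_insert_eq, union_insert]
  rfl

theorem levelFamily_injective : Function.Injective (levelFamily (C := C) (k := k)) := by
  intro A B h
  ext i
  rw [← mk_mem_levelFamily, h, mk_mem_levelFamily]

theorem levelSet_univ [Fintype (cell C k)] (hdim : ∀ n, k < n → IsEmpty (cell C n)) :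
    levelSet (Finset.univ : Finset (cell C k)) = C := by
  refine Eq.trans (congrArg cellUnion ?_) cellUnion_univ
  rw [eq_univ_iff_forall]
  rintro ⟨n, i⟩
  rcases lt_trichotomy n k with h | rfl | h
  · exact Or.inl h
  · exact mk_mem_levelFamily.2 (Finset.mem_univ i)
  · exact ((hdim n h).false i).elim

theorem cellFrontier_subset_levelSet (A : Finset (cell C k)) (i : cell C k) :
    cellFrontier k i ⊆ levelSet A :=
  (cellFrontier_subset_cellUnion ⟨k, i⟩).trans (cellUnion_mono subset_union_left)

variable [T2Space X]

theorem cellUnion_lt (k : ℕ) :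
    cellUnion {p : Σ n, cell C n | p.1 < k} = (skeletonLT C k : Set X) := by
  ext x
  rw [SetLike.mem_coe, CWComplex.mem_skeletonLT_iff, mem_cellUnion]
  constructor
  · rintro ⟨p, hp, hx⟩
    exact ⟨p.1, by exact_mod_cast hp, p.2, hx⟩
  · rintro ⟨n, hn, i, hx⟩
    exact ⟨⟨n, i⟩, by exact_mod_cast hn, hx⟩

/-- A subcomplex with the full lower skeleton has the same level sets, computed inside it or in the
ambient complex. -/
theorem levelSet_subcomplex (D : Subcomplex C) (hD : ∀ p : Σ n, cell C n, p.1 < k → p.2 ∈ D.I p.1)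
    (A : Finset (cell (D : Set X) k)) :
    levelSet A = levelSet (A.map (Function.Embedding.subtype fun i => i ∈ D.I k)) := by
  ext x
  rw [levelSet, levelSet, mem_cellUnion, mem_cellUnion]
  constructor
  · rintro ⟨p, hp | ⟨i, hi, rfl⟩, hx⟩
    · exact ⟨⟨p.1, p.2.1⟩, Or.inl hp, hx⟩
    · exact ⟨⟨k, i.1⟩, mk_mem_levelFamily.2 (Finset.mem_map.2 ⟨i, hi, rfl⟩), hx⟩
  · rintro ⟨p, hp | ⟨i, hi, rfl⟩, hx⟩
    · exact ⟨⟨p.1, ⟨p.2, hD p hp⟩⟩, Or.inl hp, hx⟩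
    · obtain ⟨j, hj, rfl⟩ := Finset.mem_map.1 hi
      exact ⟨⟨k, j⟩, mk_mem_levelFamily.2 hj, hx⟩

variable [CWComplex.Finite C]

theorem attaches_levelSet [DecidableEq (cell C k)] {A : Finset (cell C k)} {i : cell C k}
    (hi : i ∉ A) : Attaches k (map k i) (levelSet (insert i A)) (levelSet A) := by
  rw [levelSet, levelFamily_insert]
  exact (isClosedFamily_levelFamily A).attaches (p := ⟨k, i⟩)
    (fun h => hi (mk_mem_levelFamily.1 h))
    (levelFamily_insert A i ▸ isClosedFamily_levelFamily (insert i A))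

theorem rankStep_levelSet {m : ℕ} [DecidableEq (cell C (m + 1))] :
    RankStep (fun A : Finset (cell C (m + 1)) => bettiRel (m + 1) (levelSet A))
      (fun A => bettiRel m (levelSet A)) := by
  intro A i hi
  have hf := (isClosedFamily_levelFamily A).finite_relH
  by_cases h0 : toRel (levelSet (insert i A)) (levelSet A) (m + 1) = 0
  · exact Or.inl ((attaches_levelSet hi).bettiRel_of_eq_zero hf h0)
  · exact Or.inr ((attaches_levelSet hi).bettiRel_of_ne_zero hf h0)

theorem mem_spanningSubcomplexes {S : Subcomplex C} : S ∈ spanningSubcomplexes C k ↔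
    (skeletonLT C k : Set X) ⊆ S ∧ (S : Set X) ⊆ skeleton C k := by
  simp [spanningSubcomplexes]

/-- A spanning subcomplex is determined by its top cells, and these may be chosen freely since all
lower cells are present. Containment in the skeleton is automatic by `hdim`. -/
theorem tkrPoly_eq_rankPoly {m : ℕ} [Fintype (cell C (m + 1))]
    (hdim : ∀ n, m + 1 < n → IsEmpty (cell C n)) : tkrPoly C (m + 1) =
      rankPoly (fun A : Finset (cell C (m + 1)) => bettiRel (m + 1) (levelSet A))
        (fun A => bettiRel m (levelSet A)) := by
  have hu : bettiRel m (levelSet (Finset.univ : Finset (cell C (m + 1)))) = bettiRel m C :=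
    congrArg _ (levelSet_univ hdim)
  simp only [tkrPoly, rankPoly, hu]
  refine (Finset.sum_nbij (fun A : Finset (cell C (m + 1)) =>
    ofFamily _ (isClosedFamily_levelFamily A)) (fun A _ => ?_) (fun A _ B _ h => ?_) ?_
    fun A _ => ?_).symm
  · rw [mem_spanningSubcomplexes, coe_ofFamily, ← cellUnion_lt]
    refine ⟨cellUnion_mono subset_union_left, fun x hx => ?_⟩
    obtain ⟨p, hp, hx⟩ := mem_cellUnion.1 hx
    rw [SetLike.mem_coe, CWComplex.mem_skeleton_iff]
    refine ⟨p.1, ?_, p.2, hx⟩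
    by_contra h
    exact (hdim p.1 (by exact_mod_cast not_le.1 h)).false p.2
  · exact levelFamily_injective (cellUnion_injective 
      (congrArg (SetLike.coe : Subcomplex C → Set X) h))
  · classical
    intro S hS
    obtain ⟨hS, -⟩ := mem_spanningSubcomplexes.1 (Finset.mem_coe.1 hS)
    rw [← cellUnion_lt, ← cellUnion_cellsOf S] at hS
    refine ⟨Finset.univ.filter fun i => i ∈ S.I (m + 1), Finset.mem_coe.2 (Finset.mem_univ _), ?_⟩
    apply SetLike.coe_injective
    rw [coe_ofFamily, ← cellUnion_cellsOf S]
    congr 1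
    ext ⟨n, i⟩
    rcases lt_trichotomy n (m + 1) with h | rfl | h
    · exact iff_of_true (Or.inl h) (mem_of_openCell_subset
        ((openCell_subset_cellUnion (T := {p : Σ n, cell C n | p.1 < m + 1}) h).trans hS))
    · rw [mk_mem_levelFamily, Finset.mem_filter, and_iff_right (Finset.mem_univ _)]
      rfl
    · exact ((hdim n h).false i).elim
  · rw [coe_ofFamily, betti_eq_bettiRel, betti_eq_bettiRel, betti_eq_bettiRel]
    rfl

end Levels

/-! ### Top cells of the quotient and of the deletion -/

section Main

variable {X : Type u} [TopologicalSpace X] {C : Set X} [CWComplex C]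

/-- The cells of positive dimension of a quotient complex are cells of the complex. -/
def collapseCellEmbedding (E : Subcomplex C) (m : ℕ) : Collapse.cells E (m + 1) ↪ cell C (m + 1) where
  toFun := Sum.elim Subtype.val fun h => absurd h.down.down m.succ_ne_zero
  inj' := by
    rintro (i | ⟨⟨⟨h⟩⟩⟩) (j | ⟨⟨⟨h'⟩⟩⟩) hij
    · exact congrArg Sum.inl (Subtype.ext hij)
    · exact absurd h' m.succ_ne_zero
    · exact absurd h m.succ_ne_zero
    · exact absurd h m.succ_ne_zero

theorem isEmpty_cells_collapse {m : ℕ} (hdim : ∀ n, m + 1 < n → IsEmpty (cell C n)) (E : Subcomplex C)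
    (n : ℕ) (hn : m + 1 < n) : IsEmpty (Collapse.cells E n) := by
  refine ⟨?_⟩
  rintro (i | ⟨⟨⟨h⟩⟩⟩)
  · exact (hdim n hn).false i.1
  · lia

variable {m : ℕ} {σ : cell C (m + 1)} {E : Subcomplex C}

theorem cellsOf_subset_levelFamily (hE : (E : Set X) = closedCell (m + 1) σ)
    {A : Finset (cell C (m + 1))} (hA : σ ∈ A) : cellsOf E ⊆ levelFamily A := by
  intro p hp
  rcases eq_or_lt_of_mem_cellsOf hE hp with rfl | h
  · exact mk_mem_levelFamily.2 hA
  · exact Or.inl h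

theorem mem_range_collapseCellEmbedding
    (hE : (E : Set X) = closedCell (m + 1) σ)
    (τ : cell C (m + 1)) : τ ≠ σ ↔ τ ∈ range (collapseCellEmbedding E m) := by
  have h : τ ≠ σ ↔ τ ∉ E.I (m + 1) := by
    refine not_congr ⟨?_, fun h => ?_⟩
    · rintro rfl
      exact mem_cellsOf_self hE
    · rcases eq_or_lt_of_mem_cellsOf (p := ⟨m + 1, τ⟩) hE h with h | h
      · cases h
        rfl
      · exact absurd h (lt_irrefl _)
  rw [h]
  constructor
  · exact fun h => ⟨Sum.inl ⟨τ, h⟩, rfl⟩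
  · rintro ⟨i | ⟨⟨⟨h'⟩⟩⟩, rfl⟩
    · exact i.2
    · exact (m.succ_ne_zero h').elim

variable [T2Space X]

/-- Spanning subcomplexes of the quotient are the images of those containing σ: all cells of the
closure collapse to the new 0-cell, and σ is the only top cell among them. -/
theorem levelSet_collapse [CWComplex.Finite C] [DecidableEq (cell C (m + 1))] (hne : (E : Set X).Nonempty)
    (hE : (E : Set X) = closedCell (m + 1) σ) (A : Finset (Collapse.cells E (m + 1))) :
    letI := Collapse.cwComplex E hne
    levelSet (C := (univ : Set (Collapse E))) A =
      Collapse.proj E hne '' levelSet (insert σ (A.map (collapseCellEmbedding E m))) := by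
  let := Collapse.cwComplex E hne
  have hopen : ∀ (n : ℕ) (i : {i : cell C n // i ∉ E.I n}),
      openCell (C := (univ : Set (Collapse E))) n (Sum.inl i) =
        Collapse.proj E hne '' openCell n i.1 := fun n i =>
    Collapse.charMap_inl_image E hne i _
  have hbase : openCell (C := (univ : Set (Collapse E))) 0 (Sum.inr ⟨⟨rfl⟩⟩) =
      {Collapse.base E hne} :=
    Collapse.charMap_inr_image E hne _ (nonempty_ball.2 one_pos)
  ext q
  rw [levelSet, mem_cellUnion]
  constructor
  · rintro ⟨⟨n, i⟩, hp, hq⟩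
    rcases i with i | ⟨⟨⟨h⟩⟩⟩
    · have hq : q ∈ Collapse.proj E hne '' openCell n i.1 := hopen n i ▸ hq
      refine image_mono (openCell_subset_cellUnion (p := ⟨n, i.1⟩) ?_) hq
      rcases hp with hp | ⟨j, hj, h⟩
      · exact Or.inl hp
      · cases h
        exact mk_mem_levelFamily.2 (Finset.mem_insert_of_mem (Finset.mem_map.2 ⟨_, hj, rfl⟩))
    · subst h
      have hq : q ∈ ({Collapse.base E hne} : Set (Collapse E)) := hbase ▸ hq
      refine ⟨hne.some, ?_, (Collapse.proj_of_mem_sub E hne hne.some_mem).trans hq.symm⟩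
      refine cellUnion_mono (cellsOf_subset_levelFamily hE (Finset.mem_insert_self _ _)) ?_
      rw [cellUnion_cellsOf]
      exact hne.some_mem
  · rintro ⟨x, hx, rfl⟩
    obtain ⟨⟨n, i⟩, hp, hx⟩ := mem_cellUnion.1 hx
    by_cases hi : i ∈ E.I n
    -- The new 0-cell has dimension below m + 1, so it belongs to every level set of the quotient.
    · refine ⟨⟨0, Sum.inr ⟨⟨rfl⟩⟩⟩, Or.inl m.succ_pos, ?_⟩
      have h1 : Collapse.proj E hne x ∈ ({Collapse.base E hne} : Set (Collapse E)) :=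
        Collapse.proj_of_mem_sub E hne (CWComplex.Subcomplex.openCell_subset_of_mem E hi hx)
      exact hbase.symm ▸ h1
    · refine ⟨⟨n, Sum.inl ⟨i, hi⟩⟩, ?_, (hopen n ⟨i, hi⟩).symm ▸ mem_image_of_mem _ hx⟩
      rcases hp with hp | ⟨j, hj, h⟩
      · exact Or.inl hp
      · cases h
        rcases Finset.mem_insert.1 hj with rfl | hj
        · exact absurd (mem_cellsOf_self hE) hi
        · obtain ⟨i', hi', rfl⟩ := Finset.mem_map.1 hj
          rcases i' with j | ⟨⟨⟨h⟩⟩⟩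
          · exact mk_mem_levelFamily.2 hi'
          · exact absurd h m.succ_ne_zero

theorem mem_deleteCell_I {hdim : ∀ n, m + 1 < n → IsEmpty (cell C n)} {τ : cell C (m + 1)} :
    τ ∈ (deleteCell C hdim σ).I (m + 1) ↔ τ ≠ σ := by
  refine not_congr ⟨fun h => ?_, fun h => congrArg _ h⟩
  cases h
  rfl

/-- The top-dimensional cells of `C ∖ σ` are cells of `C`. -/
def deleteCellEmbedding (hdim : ∀ n, m + 1 < n → IsEmpty (cell C n)) (σ : cell C (m + 1)) :
    cell (deleteCell C hdim σ : Set X) (m + 1) ↪ cell C (m + 1) :=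
  Function.Embedding.subtype fun i => i ∈ (deleteCell C hdim σ).I (m + 1)

theorem mem_range_deleteCellEmbedding (hdim : ∀ n, m + 1 < n → IsEmpty (cell C n))
    (τ : cell C (m + 1)) : τ ≠ σ ↔ τ ∈ range (deleteCellEmbedding hdim σ) := by
  rw [← mem_deleteCell_I (hdim := hdim)]
  exact ⟨fun h => ⟨⟨τ, h⟩, rfl⟩, fun ⟨i, hi⟩ => hi ▸ i.2⟩

theorem levelSet_deleteCell (hdim : ∀ n, m + 1 < n → IsEmpty (cell C n))
    (A : Finset (cell (deleteCell C hdim σ : Set X) (m + 1))) :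
    levelSet A = levelSet (A.map (deleteCellEmbedding hdim σ)) := by
  refine levelSet_subcomplex (deleteCell C hdim σ) (fun p hp (h : p = ⟨m + 1, σ⟩) => ?_) A
  rw [h] at hp
  exact lt_irrefl _ hp

theorem isEmpty_cell_deleteCell (hdim : ∀ n, m + 1 < n → IsEmpty (cell C n)) (n : ℕ)
    (hn : m + 1 < n) : IsEmpty (cell (deleteCell C hdim σ : Set X) n) :=
  ⟨fun i => (hdim n hn).false i.1⟩

theorem levelSet_map_deleteCellEmbedding (hdim : ∀ n, m + 1 < n → IsEmpty (cell C n))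
    [Fintype (cell (deleteCell C hdim σ : Set X) (m + 1))] :
    levelSet (Finset.univ.map (deleteCellEmbedding hdim σ)) = C \ openCell (m + 1) σ := by
  rw [← levelSet_deleteCell]
  exact levelSet_univ (isEmpty_cell_deleteCell hdim)

theorem isBridgeCell_iff (hdim : ∀ n, m + 1 < n → IsEmpty (cell C n)) [Fintype (cell C (m + 1))]
    [Fintype (cell (deleteCell C hdim σ : Set X) (m + 1))] : IsBridgeCell σ ↔
      bettiRel m (levelSet (Finset.univ.map (deleteCellEmbedding hdim σ))) =
        bettiRel m (levelSet (Finset.univ : Finset (cell C (m + 1)))) + 1 := by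
  have h : bettiRel m (levelSet (Finset.univ : Finset (cell C (m + 1)))) = bettiRel m C :=
    congrArg _ (levelSet_univ hdim)
  rw [h, levelSet_map_deleteCellEmbedding, ← betti_eq_bettiRel, ← betti_eq_bettiRel]
  rfl

variable [CWComplex.Finite C] [DecidableEq (cell C (m + 1))]

/-- A loop creates a cycle whenever it is attached. -/
theorem IsLoopCell.bettiRel_insert (hE : (E : Set X) = closedCell (m + 1) σ) (hσ : IsLoopCell σ)
    {A : Finset (cell C (m + 1))} (hA : σ ∉ A) :
    bettiRel (m + 1) (levelSet (insert σ A)) = bettiRel (m + 1) (levelSet A) + 1 ∧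
      bettiRel m (levelSet (insert σ A)) = bettiRel m (levelSet A) :=
  (attaches_levelSet hA).bettiRel_of_ne_zero (isClosedFamily_levelFamily A).finite_relH
    fun h0 => (isLoopCell_iff hE).1 hσ ((attaches_levelSet hA).toRel_eq_zero_of_subset
      (attaches_cellFrontier σ) (cellFrontier_subset_levelSet A σ) h0)

/-- No cycle of the whole complex runs over a bridge. -/
theorem IsBridgeCell.toRel_eq_zero (hdim : ∀ n, m + 1 < n → IsEmpty (cell C n))
    [Fintype (cell (deleteCell C hdim σ : Set X) (m + 1))] (hσ : IsBridgeCell σ) :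
    toRel (levelSet (insert σ (Finset.univ.map (deleteCellEmbedding hdim σ))))
      (levelSet (Finset.univ.map (deleteCellEmbedding hdim σ))) (m + 1) = 0 := by
  have : Finite (cell C (m + 1)) := CWComplex.FiniteType.finite_cell (m + 1)
  have := Fintype.ofFinite (cell C (m + 1))
  have hj := mem_range_deleteCellEmbedding (σ := σ) hdim
  by_contra h0
  have h := ((attaches_levelSet (notMem_map hj _)).bettiRel_of_ne_zero
    (isClosedFamily_levelFamily _).finite_relH h0).2
  rw [← univ_eq_insert_map hj] at h
  rw [isBridgeCell_iff hdim] at hσ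
  lia

/-- A bridge kills a cycle whenever it is attached. -/
theorem IsBridgeCell.bettiRel_insert (hdim : ∀ n, m + 1 < n → IsEmpty (cell C n))
    (hσ : IsBridgeCell σ) {A : Finset (cell C (m + 1))} (hA : σ ∉ A) :
    bettiRel (m + 1) (levelSet (insert σ A)) = bettiRel (m + 1) (levelSet A) ∧
      bettiRel m (levelSet A) = bettiRel m (levelSet (insert σ A)) + 1 := by
  have : Finite (cell (deleteCell C hdim σ : Set X) (m + 1)) :=
    CWComplex.FiniteType.finite_cell (m + 1)
  have := Fintype.ofFinite (cell (deleteCell C hdim σ : Set X) (m + 1))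
  have hj := mem_range_deleteCellEmbedding (σ := σ) hdim
  -- Any set of top cells avoiding σ lies in the set of all others, so vanishing descends from the
  -- whole complex.
  refine (attaches_levelSet hA).bettiRel_of_eq_zero (isClosedFamily_levelFamily A).finite_relH
    ((attaches_levelSet (notMem_map hj _)).toRel_eq_zero_of_subset
      (attaches_levelSet hA) (cellUnion_mono ?_) (hσ.toRel_eq_zero hdim))
  refine union_subset_union_right _ (image_mono fun τ hτ => ?_)
  obtain ⟨i, hi⟩ := (hj τ).1 fun h => hA (h ▸ hτ)
  exact Finset.mem_coe.2 (Finset.mem_map.2 ⟨i, Finset.mem_univ _, hi⟩)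

/-- Attaching σ to the lower skeleton would both raise the top Betti number and leave it unchanged.
-/
theorem IsBridgeCell.not_isLoopCell (hdim : ∀ n, m + 1 < n → IsEmpty (cell C n))
    (hE : (E : Set X) = closedCell (m + 1) σ) (hσ : IsBridgeCell σ) : ¬ IsLoopCell σ := by
  intro h
  have h1 := (hσ.bettiRel_insert hdim (Finset.notMem_empty σ)).1
  have h2 := (h.bettiRel_insert hE (Finset.notMem_empty σ)).1
  lia

/-- Here both hypotheses on σ enter: without a loop the closure has no rational homology in degree m
+ 1, and with boundary regularity its reduced homology in degree m is torsion. -/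
theorem bettiRel_levelSet_collapse (hne : (E : Set X).Nonempty)
    (hE : (E : Set X) = closedCell (m + 1) σ) (hl : ¬ IsLoopCell σ) (hb : IsBoundaryRegular σ)
    (A : Finset (Collapse.cells E (m + 1))) :
    letI := Collapse.cwComplex E hne
    bettiRel (m + 1) (levelSet (C := (univ : Set (Collapse E))) A) =
      bettiRel (m + 1) (levelSet (insert σ (A.map (collapseCellEmbedding E m)))) := by
  rw [isLoopCell_iff hE, not_not] at hl
  rw [levelSet_collapse hne hE]
  refine bettiRel_image_proj E hne ?_ ?_ (isClosedFamily_levelFamily _)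
    (cellsOf_subset_levelFamily hE (Finset.mem_insert_self _ _))
  · rw [hE]
    exact bettiRel_closedCell_eq_zero hE hl
  · rw [hE]
    exact torsionKer_toPoint_closedCell hl hb

end Main

end
-- Deletion, contraction, loops and bridges
theorem mainTheorem2 {X : Type*} [TopologicalSpace X] [T2Space X] (C : Set X) [CWComplex C]
    [CWComplex.Finite C] (k : ℕ) (hk : 1 ≤ k) (hdim : ∀ n, k < n → IsEmpty (cell C n))
    (σ : cell C k) (E : Subcomplex C) (hE : (E : Set X) = closedCell k σ) :
    (¬ IsBridgeCell σ → ¬ IsLoopCell σ → IsBoundaryRegular σ →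
      tkrPoly C k =
        tkrPolyCollapse E (hE ▸ RelCWComplex.closedCell_nonempty k σ) k +
          tkrPoly (deleteCell C hdim σ : Set X) k) ∧
    (IsLoopCell σ →
      tkrPoly C k = (MvPolynomial.X 1 + 1) * tkrPoly (deleteCell C hdim σ : Set X) k) ∧
    (IsBridgeCell σ → IsBoundaryRegular σ →
      tkrPoly C k = (MvPolynomial.X 0 + 1) *
        tkrPolyCollapse E (hE ▸ RelCWComplex.closedCell_nonempty k σ) k) := by
  classical
  obtain ⟨m, rfl⟩ := Nat.exists_eq_succ_of_ne_zero (Nat.one_le_iff_ne_zero.1 hk)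
  have hne : (E : Set X).Nonempty := hE ▸ RelCWComplex.closedCell_nonempty _ σ
  have : Finite (cell C (m + 1)) := CWComplex.FiniteType.finite_cell (m + 1)
  have : Fintype (cell C (m + 1)) := Fintype.ofFinite _
  have : Finite (cell (deleteCell C hdim σ : Set X) (m + 1)) :=
    CWComplex.FiniteType.finite_cell (m + 1)
  have : Fintype (cell (deleteCell C hdim σ : Set X) (m + 1)) := Fintype.ofFinite _
  have hjd := mem_range_deleteCellEmbedding (σ := σ) hdim
  have hjc := mem_range_collapseCellEmbedding hE
  have hD := tkrPoly_eq_rankPoly (C := (deleteCell C hdim σ : Set X)) (isEmpty_cell_deleteCell hdim)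
  have hFd := fun A => congrArg (bettiRel (m + 1)) (levelSet_deleteCell (σ := σ) hdim A)
  have hGd := fun A => congrArg (bettiRel m) (levelSet_deleteCell (σ := σ) hdim A)
  let := Collapse.cwComplex E hne
  have := Collapse.finite_cwComplex E hne
  have : Finite (Collapse.cells E (m + 1)) := Collapse.finite_cells E (m + 1)
  have : Fintype (Collapse.cells E (m + 1)) := Fintype.ofFinite _
  have hQ : tkrPolyCollapse E hne (m + 1) = _ :=
    tkrPoly_eq_rankPoly (C := (univ : Set (Collapse E))) (isEmpty_cells_collapse hdim E)
  have hsQ := rankStep_levelSet (C := (univ : Set (Collapse E))) (m := m)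
  have hs := rankStep_levelSet (C := C) (m := m)
  rw [tkrPoly_eq_rankPoly (C := C) hdim, hD, hQ]
  refine ⟨fun hnb hl hb => ?_, fun hl => ?_, fun hb hr => ?_⟩
  -- Restoring σ to the complement either lowers the Betti number in degree m by one, which is the
  -- bridge condition, or preserves it.
  · have hu : bettiRel m (levelSet (Finset.univ.map (deleteCellEmbedding hdim σ))) =
        bettiRel m (levelSet (Finset.univ : Finset (cell C (m + 1)))) := by
      have h1 := hs _ σ (notMem_map hjd Finset.univ)
      rw [← univ_eq_insert_map hjd] at h1
      rw [isBridgeCell_iff hdim] at hnb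
      rcases h1 with h1 | h1
      · exact absurd h1.2 hnb
      · exact h1.2.symm
    exact rankPoly_deletion_contraction hjc hjd hs hsQ
      (bettiRel_levelSet_collapse hne hE hl hb) hFd hGd hu
  · exact rankPoly_of_loop hjd hFd hGd fun A hA => hl.bettiRel_insert hE hA
  -- The contraction needs σ not to be a loop, which is automatic for a bridge.
  · exact rankPoly_of_bridge hjc hs hsQ
      (bettiRel_levelSet_collapse hne hE (hb.not_isLoopCell hdim hE) hr)
      fun A hA => hb.bettiRel_insert hdim hA
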